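/- Let $\mathfrak A=\mathbb C\langle u_n;\,n\in\mathbb Z\rangle$ be the free associative algebra, with shift automorphism $\mathcal S(u_n)=u_{n+1}$. For $\alpha=(\alpha_1,\dots,\alpha_k)\in\mathbb Z^k$ put $u_\alpha=u_{\alpha_1}\cdots u_{\alpha_k}$, let $\nu(\alpha,i)$ be the number of entries of $\alpha$ equal to $i$, and write $\beta\sim\alpha$ if $\nu(\beta,i)=\nu(\alpha,i)$ for all $i$. Let $$\mathcal A^k=\{\alpha\in\mathbb Z^k:\ 1-j\le\alpha_j\le k-j\ (1\le j\le k),\ \ \alpha_{j+1}+1\ge\alpha_j\ (1\le j\le k-1)\},\qquad X^{(k)}=\sum_{\alpha\in\mathcal A^k}u_\alpha ,$$ $$\mathcal N^k=\{\alpha\in\mathcal A^k:\ \alpha_{j+1}+1\ge\alpha_j\ge\alpha_{j+1}\ (1\le j\le k-1),\ \ \alpha_k=0\}.$$ For $\omega\in\mathbb C^*$ let $\mathfrak A^b(\omega)$ be the quotient of $\mathfrak A$ by the two-sided ideal $\mathfrak I_b$ generated by the elements $u_nu_{n+1}-(-1)^n\omega u_{n+1}u_n$ ($n\in\mathbb Z$)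 and $u_nu_m+u_mu_n$ ($|n-m|\ge2$), and let $\pi_\omega:\mathfrak A\to\mathfrak A^b(\omega)$ be the projection. For $\ell\ge1$ and $\alpha\in\mathcal N^{2\ell}$ there is a unique polynomial $P_\alpha=P_\alpha^{\mathfrak I_b}\in\mathbb Z[\omega]$ such that $P_\alpha(\omega)\,\pi_\omega(u_\alpha)=\pi_\omega\big(\sum_{\beta\in\mathcal A^{2\ell},\,\beta\sim\alpha}u_\beta\big)$ for all $\omega\in\mathbb C^*$. Now let $\omega=q^2=e^{\mathrm i\hbar}$, $q=e^{\frac12\mathrm i\hbar}$, $\hbar\in\mathbb R$, and let $\dagger$ be the conjugate-linear anti-automorphism of $\mathfrak A^b(\omega)$ with $u_n^\dagger=u_n$. For each integer $\ell\ge1$ such that $\omega^m\ne1$ and $(-\omega)^m\ne1$ for $1\le m\le2\ell$ (that is, no denominator below vanishes), define the formal infinite sum $$\hat H_{2\ell}=\sum_{k\in\mathbb Z}\ \sum_{\alpha\in\mathcal N^{2\ell}}\frac{\omega^{2\ell}-1}{((-1)^k\omega)^{\nu(\alpha,0)}-1}\,P_\alpha\big((-1)^k\omega\big)\,\pi_\omega(\mathcal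 S^k u_\alpha).$$ It belongs to the completion of $\mathfrak A^b(\omega)$ given by the inverse limit of the truncations $u_n\mapsto0$ for $|n|\ge N$. The following holds. 1. There is a unique derivation $\partial_{t_{2\ell}}$ of $\mathfrak A^b(\omega)$ with $\partial_{t_{2\ell}}(u_n)=q^{2\ell}\,\pi_\omega\mathcal S^n\big(\mathcal S(X^{(2\ell)})u_0-u_0\mathcal S^{-1}(X^{(2\ell)})\big)$ for all $n\in\mathbb Z$ (the $2\ell$-th member of the quantum Volterra hierarchy), and it has the Heisenberg form $$\partial_{t_{2\ell}}(u_n)=\frac{\mathrm i}{2\sin(\ell\hbar)}\,[\hat H_{2\ell},u_n],\qquad n\in\mathbb Z .$$ 2. $\hat H_{2\ell}^\dagger=\hat H_{2\ell}$. 3. $[\hat H_{2\ell_1},\hat H_{2\ell_2}]=0$ for all $\ell_1,\ell_2\ge1$ that both satisfy the condition above. -/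

import Mathlib

namespace Volterra

open Polynomial

/-! ### The free difference algebra and the nonabelian Volterra hierarchy -/

/-- The free associative algebra `ℂ⟨u_n ; n ∈ ℤ⟩`. -/
abbrev FreeAlg : Type := FreeAlgebra ℂ ℤ

/-- The generator `u_n` of the free algebra. -/
def gen (n : ℤ) : FreeAlg := FreeAlgebra.ι ℂ n

/-- The power `S^k` of the shift automorphism, `S^k (u_n) = u_{n+k}`. -/
noncomputable def shift (k : ℤ) : FreeAlg →ₐ[ℂ] FreeAlg :=
  FreeAlgebra.lift ℂ fun n => gen (n + k)

/-- The monomial `u_α = u_{α_1} u_{α_2} ⋯ u_{α_k}`. -/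
def monomial {k : ℕ} (α : Fin k → ℤ) : FreeAlg := (List.ofFn fun j => gen (α j)).prod

/-- The multiplicity `ν(α, i)` of `u_i` in `u_α`. -/
def mult {k : ℕ} (α : Fin k → ℤ) (i : ℤ) : ℕ := (Finset.univ.filter fun j => α j = i).card

/-- `α ∼ β`: every generator has the same multiplicity in `u_α` and in `u_β`. -/
def Similar {k : ℕ} (α β : Fin k → ℤ) : Prop := ∀ i : ℤ, mult α i = mult β i

/-- The admissible multi-indices: `1 - j ≤ α_j ≤ k - j` for `j = 1, …, k` and
`α_{j+1} + 1 ≥ α_j` for `j = 1, …, k-1` (in Lean the positions start at `0`). -/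
noncomputable def admissible (k : ℕ) : Finset (Fin k → ℤ) :=
  (Fintype.piFinset fun j : Fin k => Finset.Icc (-(j : ℤ)) ((k : ℤ) - 1 - (j : ℤ))).filter
    fun α => ∀ i j : Fin k, (j : ℕ) = (i : ℕ) + 1 → α i ≤ α j + 1

/-- The set `𝒩^k` of the admissible multi-indices which are nonincreasing,
`α_{j+1} + 1 ≥ α_j ≥ α_{j+1}`, and whose last entry is `α_k = 0`. -/
noncomputable def indexSet (k : ℕ) : Finset (Fin k → ℤ) :=
  (admissible k).filter fun α =>
    (∀ i j : Fin k, (j : ℕ) = (i : ℕ) + 1 → α j ≤ α i) ∧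
    (∀ i : Fin k, (i : ℕ) + 1 = k → α i = 0)

/-- The polynomial `X^{(k)}`, the sum of all admissible monomials of degree `k`. -/
noncomputable def volterraX (k : ℕ) : FreeAlg := ∑ α ∈ admissible k, monomial α

/-- The right-hand side of the `k`-th equation of the nonabelian Volterra hierarchy at the site
`n`: `S^n (S(X^{(k)}) u_0 - u_0 S^{-1}(X^{(k)}))`. -/
noncomputable def volterraK (k : ℕ) (n : ℤ) : FreeAlg :=
  shift n (shift 1 (volterraX k) * gen 0 - gen 0 * shift (-1) (volterraX k))

/-! ### The quantum algebra -/

/-- The generating relations `u_n u_{n+1} = (-1)^n ω u_{n+1} u_n` and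
`u_n u_m = - u_m u_n` for `|n - m| ≥ 2`. -/
inductive Rel (ω : ℂ) : FreeAlg → FreeAlg → Prop
  | adjacent (n : ℤ) : Rel ω (gen n * gen (n + 1)) (((-1 : ℂ) ^ n * ω) • (gen (n + 1) * gen n))
  | far (n m : ℤ) (h : 2 ≤ |n - m|) : Rel ω (gen n * gen m) (-(gen m * gen n))

/-- The quantum algebra: the quotient of the free algebra by the two-sided ideal generated by the
relations. -/
def QAlg (ω : ℂ) : Type := RingQuot (Rel ω)

noncomputable instance (ω : ℂ) : Ring (QAlg ω) := inferInstanceAs (Ring (RingQuot (Rel ω)))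

noncomputable instance (ω : ℂ) : Algebra ℂ (QAlg ω) :=
  inferInstanceAs (Algebra ℂ (RingQuot (Rel ω)))

/-- The canonical projection of the free algebra onto the quantum algebra. -/
noncomputable def proj (ω : ℂ) : FreeAlg →ₐ[ℂ] QAlg ω := RingQuot.mkAlgHom ℂ (Rel ω)

/-- The generator `u_n` of the quantum algebra. -/
noncomputable def u (ω : ℂ) (n : ℤ) : QAlg ω := proj ω (gen n)

theorem proj_surjective (ω : ℂ) : Function.Surjective (proj ω) :=
  RingQuot.mkAlgHom_surjective ℂ (Rel ω)

theorem u_adjacent (ω : ℂ) (n : ℤ) :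
    u ω n * u ω (n + 1) = ((-1 : ℂ) ^ n * ω) • (u ω (n + 1) * u ω n) := by
  have h : proj ω _ = proj ω _ := RingQuot.mkAlgHom_rel ℂ (Rel.adjacent (ω := ω) n)
  rw [map_mul, map_smul, map_mul] at h
  exact h

theorem u_far (ω : ℂ) (n m : ℤ) (h : 2 ≤ |n - m|) : u ω n * u ω m = -(u ω m * u ω n) := by
  have h : proj ω _ = proj ω _ := RingQuot.mkAlgHom_rel ℂ (Rel.far (ω := ω) n m h)
  rw [map_mul, map_neg, map_mul] at h
  exact h

/-- Algebra homomorphisms out of the quantum algebra: images of the generators which satisfy the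
relations. -/
noncomputable def liftHom (ω : ℂ) {B : Type*} [Ring B] [Algebra ℂ B] (v : ℤ → B)
    (h₁ : ∀ n, v n * v (n + 1) = ((-1 : ℂ) ^ n * ω) • (v (n + 1) * v n))
    (h₂ : ∀ n m : ℤ, 2 ≤ |n - m| → v n * v m = -(v m * v n)) : QAlg ω →ₐ[ℂ] B :=
  RingQuot.liftAlgHom ℂ ⟨FreeAlgebra.lift ℂ v, by
    intro x y hxy
    cases hxy with
    | adjacent n => simpa [gen] using h₁ n
    | far n m h => simpa [gen] using h₂ n m h⟩

@[simp]
theorem liftHom_u (ω : ℂ) {B : Type*} [Ring B] [Algebra ℂ B] (v : ℤ → B)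
    (h₁ : ∀ n, v n * v (n + 1) = ((-1 : ℂ) ^ n * ω) • (v (n + 1) * v n))
    (h₂ : ∀ n m : ℤ, 2 ≤ |n - m| → v n * v m = -(v m * v n)) (n : ℤ) :
    liftHom ω v h₁ h₂ (u ω n) = v n := by
  unfold liftHom u proj gen
  erw [RingQuot.liftAlgHom_mkAlgHom_apply]
  simp

theorem QAlg.induction {ω : ℂ} {p : QAlg ω → Prop} (hc : ∀ c : ℂ, p (algebraMap ℂ _ c))
    (hu : ∀ n, p (u ω n)) (hadd : ∀ a b, p a → p b → p (a + b))
    (hmul : ∀ a b, p a → p b → p (a * b)) (a : QAlg ω) : p a := by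
  obtain ⟨x, rfl⟩ := proj_surjective ω a
  induction x using FreeAlgebra.induction with
  | grade0 c => rw [AlgHom.commutes]; exact hc c
  | grade1 n => exact hu n
  | add a b ha hb => rw [map_add]; exact hadd _ _ ha hb
  | mul a b ha hb => rw [map_mul]; exact hmul _ _ ha hb

/-- `D` is the `k`-th flow of the quantised Volterra hierarchy: the derivation of the quantum
algebra with `D (u_n) = q^k S^n (S(X^{(k)}) u_0 - u_0 S^{-1}(X^{(k)}))`. -/
def IsVolterraFlow (q ω : ℂ) (k : ℕ) (D : QAlg ω →ₗ[ℂ] QAlg ω) : Prop :=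
  (∀ a b, D (a * b) = D a * b + a * D b) ∧ ∀ n : ℤ, D (u ω n) = q ^ k • proj ω (volterraK k n)

/-! ### The normal ordering polynomials -/

open Classical in
/-- `p` is the normal ordering polynomial of `α`: for every `ω ∈ ℂ*`, in the quantum algebra with
parameter `ω`, `p(ω) u_α` is the sum of the admissible monomials which are similar to `u_α`. -/
def IsNormalPoly {k : ℕ} (α : Fin k → ℤ) (p : ℤ[X]) : Prop :=
  ∀ ω : ℂ, ω ≠ 0 →
    (aeval ω p) • proj ω (monomial α) =
      proj ω (∑ β ∈ (admissible k).filter (fun β => Similar β α), monomial β)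

/-- The normal ordering polynomial `P_α`. That it exists and is unique for the `α` in question is
part of the theorem. -/
noncomputable def normalPoly {k : ℕ} (α : Fin k → ℤ) : ℤ[X] := Classical.epsilon (IsNormalPoly α)

/-! ### The Hermitian conjugation -/

/-- The opposite algebra, with scalars acting through complex conjugation. -/
def ConjOp (B : Type) : Type := Bᵐᵒᵖ

noncomputable instance (B : Type) [Ring B] : Ring (ConjOp B) := inferInstanceAs (Ring Bᵐᵒᵖ)


noncomputable instance (B : Type) [Ring B] [Algebra ℂ B] : Algebra ℂ (ConjOp B) :=
  RingHom.toAlgebra' (R := ℂ) (S := Bᵐᵒᵖ) ((algebraMap ℂ Bᵐᵒᵖ).comp (starRingEnd ℂ))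
    fun c x => Algebra.commutes (starRingEnd ℂ c) x

/-- An element of `B`, as an element of `ConjOp B`. -/
def ConjOp.mk {B : Type} (x : B) : ConjOp B := MulOpposite.op x

theorem ConjOp.mk_mul {B : Type} [Ring B] (x y : B) : mk x * mk y = mk (y * x) := rfl

theorem ConjOp.neg_mk {B : Type} [Ring B] (x : B) : -mk x = mk (-x) := rfl

theorem ConjOp.smul_mk {B : Type} [Ring B] [Algebra ℂ B] (c : ℂ) (x : B) :
    c • mk x = mk (starRingEnd ℂ c • x) := by
  rw [Algebra.smul_def, Algebra.smul_def, Algebra.commutes]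
  rfl

/-- The homomorphism which underlies the Hermitian conjugation; here `|ω| = 1`. -/
noncomputable def daggerHom (ω : Circle) : QAlg ω →ₐ[ℂ] ConjOp (QAlg ω) :=
  liftHom ω (fun n => ConjOp.mk (u ω n))
    (by
      intro n
      have h : starRingEnd ℂ ((-1 : ℂ) ^ n * (ω : ℂ)) * ((-1 : ℂ) ^ n * (ω : ℂ)) = 1 := by
        rw [← Complex.normSq_eq_conj_mul_self, Complex.normSq_eq_norm_sq]
        rw [norm_mul, norm_zpow, norm_neg, norm_one, one_zpow, Circle.norm_coe]
        norm_num
      rw [ConjOp.mk_mul, ConjOp.mk_mul, ConjOp.smul_mk, u_adjacent, smul_smul, h, one_smul])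
    (by
      intro n m h
      rw [ConjOp.mk_mul, ConjOp.mk_mul, ConjOp.neg_mk, u_far ω n m h, neg_neg])

/-- The Hermitian conjugation `†` of the quantum algebra with `|ω| = 1`. -/
noncomputable def dagger (ω : Circle) (a : QAlg ω) : QAlg ω :=
  MulOpposite.unop (daggerHom ω a : (QAlg ω)ᵐᵒᵖ)

theorem dagger_u (ω : Circle) (n : ℤ) : dagger ω (u ω n) = u ω n := by
  unfold dagger daggerHom
  rw [liftHom_u]
  rfl

theorem dagger_add (ω : Circle) (a b : QAlg ω) :
    dagger ω (a + b) = dagger ω a + dagger ω b := by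
  unfold dagger
  rw [map_add]
  rfl

theorem dagger_mul (ω : Circle) (a b : QAlg ω) :
    dagger ω (a * b) = dagger ω b * dagger ω a := by
  unfold dagger
  rw [map_mul]
  rfl

theorem dagger_algebraMap (ω : Circle) (c : ℂ) :
    dagger ω (algebraMap ℂ _ c) = algebraMap ℂ _ (starRingEnd ℂ c) := by
  unfold dagger
  rw [AlgHom.commutes]
  rfl

theorem dagger_dagger (ω : Circle) (a : QAlg ω) : dagger ω (dagger ω a) = a := by
  induction a using QAlg.induction with
  | hc c => simp [dagger_algebraMap]
  | hu n => simp [dagger_u]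
  | hadd a b ha hb => rw [dagger_add, dagger_add, ha, hb]
  | hmul a b ha hb => rw [dagger_mul, dagger_mul, ha, hb]

noncomputable instance (ω : Circle) : StarRing (QAlg (ω : ℂ)) where
  star := dagger ω
  star_involutive := dagger_dagger ω
  star_mul := dagger_mul ω
  star_add := dagger_add ω

theorem star_u (ω : Circle) (n : ℤ) : star (u ω n) = u ω n := dagger_u ω n

theorem star_algebraMap (ω : Circle) (c : ℂ) :
    star (algebraMap ℂ (QAlg ω) c) = algebraMap ℂ (QAlg ω) (starRingEnd ℂ c) :=
  dagger_algebraMap ω c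

/-! ### Formal infinite sums

The Hamiltonians are infinite sums `∑_{k ∈ ℤ} h_k` of elements of the quantum algebra such that
each finite set of generators `u_n`, `|n| < N`, occurs in only finitely many `h_k`. They live in the
completion of the quantum algebra, the inverse limit of its truncations `u_n ↦ 0` for `|n| ≥ N`. -/

/-- The truncation of the quantum algebra: `u_n ↦ u_n` for `|n| < N` and `u_n ↦ 0` for
`|n| ≥ N`. -/
noncomputable def trunc (ω : ℂ) (N : ℕ) : QAlg ω →ₐ[ℂ] QAlg ω :=
  liftHom ω (fun n => if |n| < (N : ℤ) then u ω n else 0)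
    (by
      intro n
      by_cases h₁ : |n| < (N : ℤ) <;> by_cases h₂ : |n + 1| < (N : ℤ) <;>
        simp [h₁, h₂, u_adjacent ω n])
    (by
      intro n m h
      by_cases h₁ : |n| < (N : ℤ) <;> by_cases h₂ : |m| < (N : ℤ) <;>
        simp [h₁, h₂, u_far ω n m h])

theorem trunc_u (ω : ℂ) (N : ℕ) (n : ℤ) :
    trunc ω N (u ω n) = if |n| < (N : ℤ) then u ω n else 0 := liftHom_u _ _ _ _ _

theorem trunc_trunc (ω : ℂ) {N M : ℕ} (h : N ≤ M) (a : QAlg ω) :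
    trunc ω N (trunc ω M a) = trunc ω N a := by
  induction a using QAlg.induction with
  | hc c => simp only [AlgHom.commutes]
  | hu n =>
    rw [trunc_u ω M]
    split_ifs with h₁
    · rfl
    · rw [map_zero, trunc_u, if_neg]
      have hNM : (N : ℤ) ≤ M := by exact_mod_cast h
      exact fun hN => h₁ (lt_of_lt_of_le hN hNM)
  | hadd a b ha hb => simp only [map_add, ha, hb]
  | hmul a b ha hb => simp only [map_mul, ha, hb]

/-- An element of the quantum algebra contains only finitely many generators. -/
theorem exists_trunc_eq (ω : ℂ) (a : QAlg ω) : ∃ N₀ : ℕ, ∀ N, N₀ ≤ N → trunc ω N a = a := by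
  induction a using QAlg.induction with
  | hc c => exact ⟨0, fun N _ => by rw [AlgHom.commutes]⟩
  | hu n =>
    refine ⟨n.natAbs + 1, fun N hN => ?_⟩
    rw [trunc_u, if_pos]
    rw [Int.abs_eq_natAbs]
    exact_mod_cast hN
  | hadd a b ha hb =>
    obtain ⟨A, hA⟩ := ha
    obtain ⟨B, hB⟩ := hb
    exact ⟨max A B, fun N hN => by
      rw [map_add, hA N (le_trans (le_max_left _ _) hN), hB N (le_trans (le_max_right _ _) hN)]⟩
  | hmul a b ha hb =>
    obtain ⟨A, hA⟩ := ha
    obtain ⟨B, hB⟩ := hb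
    exact ⟨max A B, fun N hN => by
      rw [map_mul, hA N (le_trans (le_max_left _ _) hN), hB N (le_trans (le_max_right _ _) hN)]⟩

theorem trunc_star (ω : Circle) (N : ℕ) (a : QAlg (ω : ℂ)) :
    trunc ω N (star a) = star (trunc ω N a) := by
  induction a using QAlg.induction with
  | hc c => rw [star_algebraMap, AlgHom.commutes, AlgHom.commutes, star_algebraMap]
  | hu n => rw [star_u, trunc_u]; split_ifs <;> simp [star_u]
  | hadd a b ha hb => simp only [map_add, star_add, ha, hb]
  | hmul a b ha hb => simp only [map_mul, star_mul, ha, hb]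

/-- The algebra of formal sums: the compatible families of truncations. Sums and products are
computed truncation by truncation. -/
def Formal (ω : ℂ) : Subalgebra ℂ (ℕ → QAlg ω) where
  carrier := {f | ∀ N M, N ≤ M → trunc ω N (f M) = f N}
  mul_mem' := fun ha hb N M h => by
    rw [Pi.mul_apply, Pi.mul_apply, map_mul, ha N M h, hb N M h]
  add_mem' := fun ha hb N M h => by
    rw [Pi.add_apply, Pi.add_apply, map_add, ha N M h, hb N M h]
  algebraMap_mem' := fun c N M _ => by
    rw [Pi.algebraMap_apply, Pi.algebraMap_apply, AlgHom.commutes]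

/-- The Hermitian conjugation of formal sums, term by term. -/
noncomputable instance (ω : Circle) : Star (Formal (ω : ℂ)) where
  star f := ⟨fun N => star (f.1 N), fun N M h => by rw [trunc_star, f.2 N M h]⟩

/-- The inclusion of the quantum algebra into the algebra of formal sums. -/
noncomputable def toFormal (ω : ℂ) : QAlg ω →ₐ[ℂ] Formal ω :=
  (AlgHom.pi fun N => trunc ω N).codRestrict (Formal ω) fun a _ _ h => trunc_trunc ω h a

theorem toFormal_injective (ω : ℂ) : Function.Injective (toFormal ω) := by
  intro a b hab
  obtain ⟨A, hA⟩ := exists_trunc_eq ω a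
  obtain ⟨B, hB⟩ := exists_trunc_eq ω b
  have h : trunc ω (max A B) a = trunc ω (max A B) b :=
    congrFun (congrArg Subtype.val hab) (max A B)
  rwa [hA _ (le_max_left _ _), hB _ (le_max_right _ _)] at h

/-- The formal sum `∑_{k ∈ ℤ} h_k` of a locally finite family. -/
noncomputable def formalSum (ω : ℂ) (h : ℤ → QAlg ω)
    (hfin : ∀ N : ℕ, {k : ℤ | trunc ω N (h k) ≠ 0}.Finite) : Formal ω :=
  ⟨fun N => ∑ᶠ k, trunc ω N (h k), fun N M hNM => by
    change trunc ω N (∑ᶠ k, trunc ω M (h k)) = ∑ᶠ k, trunc ω N (h k)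
    rw [map_finsum _ (hfin M)]
    exact finsum_congr fun k => trunc_trunc ω hNM (h k)⟩

/-! ### The Hamiltonians -/

/-- The `k`-th term of the Hamiltonian of degree `m`:
`∑_{α ∈ 𝒩^m} (ω^m - 1) / (((-1)^k ω)^{ν(α,0)} - 1) * P_α((-1)^k ω) S^k u_α`. -/
noncomputable def hamiltonianTerm (ω : ℂ) (m : ℕ) (k : ℤ) : QAlg ω :=
  ∑ α ∈ indexSet m,
    ((ω ^ m - 1) / (((-1) ^ k * ω) ^ mult α 0 - 1) * aeval ((-1) ^ k * ω) (normalPoly α)) •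
      proj ω (shift k (monomial α))

theorem hamiltonianTerm_finite (ω : ℂ) (m : ℕ) (hm : 0 < m) (N : ℕ) :
    {k : ℤ | trunc ω N (hamiltonianTerm ω m k) ≠ 0}.Finite := by
  refine (Set.finite_Ioo (-(N : ℤ)) N).subset fun k hk => ?_
  by_contra hkN
  refine hk ?_
  unfold hamiltonianTerm
  rw [map_sum]
  refine Finset.sum_eq_zero fun α hα => ?_
  rw [map_smul]
  suffices h : trunc ω N (proj ω (shift k (monomial α))) = 0 by rw [h, smul_zero]
  obtain ⟨m, rfl⟩ : ∃ l, m = l + 1 := ⟨m - 1, by omega⟩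
  have h0 : α (Fin.last m) = 0 := by
    simp only [indexSet, Finset.mem_filter] at hα
    exact hα.2.2 (Fin.last m) (by simp)
  have hz : trunc ω N (proj ω (shift k (gen (α (Fin.last m))))) = 0 := by
    have : shift k (gen (α (Fin.last m))) = gen k := by simp [shift, gen, h0]
    rw [this]
    change trunc ω N (u ω k) = 0
    rw [trunc_u, if_neg]
    rwa [abs_lt]
  unfold monomial
  simp only [map_list_prod, List.map_ofFn]
  apply List.prod_eq_zero
  rw [List.mem_ofFn]
  exact ⟨Fin.last m, hz⟩

/-- The Hamiltonian `Ĥ_{2ℓ} = ∑_{k ∈ ℤ} ∑_{α ∈ 𝒩^{2ℓ}} …`, a formal sum. -/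
noncomputable def hamiltonian (ω : ℂ) (l : ℕ+) : Formal ω :=
  formalSum ω (hamiltonianTerm ω (2 * l))
    (hamiltonianTerm_finite ω (2 * l) (Nat.mul_pos two_pos l.pos))

/-- No denominator of `Ĥ_{2ℓ}` vanishes: `(±ω)^m ≠ 1` for `1 ≤ m ≤ 2ℓ`. -/
def NonResonant (ω : ℂ) (l : ℕ+) : Prop :=
  ∀ m : ℕ, 1 ≤ m → m ≤ 2 * l → ω ^ m ≠ 1 ∧ (-ω) ^ m ≠ 1

end Volterra

/-! The Hamiltonian is a common potential for all the currents. Fix an even degree `m`, let `X_j` be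
the image of `S^j X^{(m)}` (`current`), and let `θ_j` rescale `u_i` by `-1` for `i < j`, by `(-1)^j
ω` for `i = j` and by `1` for `i > j` (`theta`). The defining relations say that `θ_{n+1}(a) u_n =
u_n θ'_{n-1}(a)`, where `θ'` has all weights of `θ` negated (`scale_theta_mul_u`); in even degree
the negation is invisible. Hence any `h` of degree `m` with `θ_j h = h + X_j` for all `j` satisfies
`[h, u_n] = u_n X_{n-1} - X_{n+1} u_n`, which is the Heisenberg equation up to the factor `1 - ω^m`.

Decreasing words form a basis, by a Fock-type representation, and `θ_j` multiplies the basis vector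
of content `s` by a number `eig ω j s`. So a potential exists as soon as the coefficient of `X_j` at
`s`, divided by `eig ω j s - 1`, does not depend on `j` (`cf_current_mul`). To compare `j` with `j +
1`, words are cut between these heights. With continued fractions `T_j = v_j (1 - T_{j-1})⁻¹` and
`R_{j+1} = (1 - R_{j+2})⁻¹ v_{j+1}` and `W = (1 - T_j - R_{j+1})⁻¹`, the currents are the
coefficients of `W T_j` and `R_{j+1} W`. The even and odd parts of `T_j` and `R_{j+1}` commute up to
factors `±k`, `k = (-1)^{j+1} ω`, and the noncommutative identity `IsAdic.key` with its mirror image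
`IsAdic.key'` relates `W` to both products, content by content (`eig_relations`). Eliminating `W` is
legitimate for `|ω| > 1`, because `|eig ω j s|` is a power of `|ω|`; the case `|ω| = 1` follows by
continuity. Taking for `j` the smallest letter `k` of the content turns the denominator into
`((-1)^k ω)^ν - 1` and the numerator into the normal ordering polynomial (`hamiltonianTerm_eq`).

Self-adjointness: reversing the words of `X_k` with smallest letter `k` amounts to a rescaling
(`star_currentMin`) whose eigenvalue times `eig ω k s` is `ω^m`. This gives `star h = -ω^m h`
(`star_density`), and the prefactor `ω^m - 1` compensates.

Commutativity: `θ_j` sends `[h_p, h_q]` to `[h_p + X_p, h_q + X_q]`, and the extra terms cancel by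
the zero-curvature identity `sum_flow_sub_sum_flow`, a count of insertions of admissible words into
one another. So the commutator is invariant under every `θ_j`. For `|ω| > 1` only the empty content
could survive, and it does not; continuity again reaches the unit circle. -/

namespace Volterra

open Polynomial

/-! ### Words, contents and coefficients -/

/-- The exchange factors: `u_n u_i = (exch n i / exch i n) u_i u_n`. -/
noncomputable def exch (ω : ℂ) (n i : ℤ) : ℂ :=
  if n < i then (if i = n + 1 then (-1) ^ n * ω else -1) else 1

theorem u_mul_u_of_lt (ω : ℂ) {n i : ℤ} (h : n < i) :
    u ω n * u ω i = exch ω n i • (u ω i * u ω n) := by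
  unfold exch
  rw [if_pos h]
  split_ifs with h1
  · subst h1; exact u_adjacent ω n
  · rw [u_far ω n i (by rw [abs_sub_comm, abs_of_pos] <;> omega), neg_one_smul]

theorem neg_one_zpow_ne_zero (n : ℤ) : ((-1 : ℂ) ^ n) ≠ 0 :=
  zpow_ne_zero _ (by norm_num)

/-- The word `u_{l_1} u_{l_2} ⋯` in the quantum algebra. -/
noncomputable def word (ω : ℂ) (l : List ℤ) : QAlg ω := (l.map (u ω)).prod

@[simp] theorem word_nil (ω : ℂ) : word ω [] = 1 := rfl

@[simp] theorem word_cons (ω : ℂ) (n : ℤ) (l : List ℤ) :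
    word ω (n :: l) = u ω n * word ω l := by simp [word]

@[simp] theorem word_append (ω : ℂ) (l l' : List ℤ) :
    word ω (l ++ l') = word ω l * word ω l' := by simp [word]

/-- The factor which `u_n` acquires when it is moved to its place in a decreasing word. -/
noncomputable def cost (ω : ℂ) (n : ℤ) (s : Multiset ℤ) : ℂ := (s.map (exch ω n)).prod

/-- The factor between a word and its decreasing rearrangement. -/
noncomputable def wt (ω : ℂ) : List ℤ → ℂ
  | [] => 1
  | n :: l => cost ω n l * wt ω l

@[simp] theorem cost_cons (ω : ℂ) (n i : ℤ) (s : Multiset ℤ) :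
    cost ω n (i ::ₘ s) = exch ω n i * cost ω n s := by simp [cost]

theorem cost_eq_one {ω : ℂ} {n : ℤ} {s : Multiset ℤ} (h : ∀ i ∈ s, i ≤ n) : cost ω n s = 1 := by
  unfold cost
  refine Multiset.prod_eq_one fun x hx => ?_
  obtain ⟨i, hi, rfl⟩ := Multiset.mem_map.1 hx
  exact if_neg (not_lt.2 (h i hi))

theorem wt_eq_one {ω : ℂ} {l : List ℤ} (h : l.Pairwise (· ≥ ·)) : wt ω l = 1 := by
  induction l with
  | nil => rfl
  | cons n l ih =>
    rw [List.pairwise_cons] at h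
    rw [wt, ih h.2, cost_eq_one (fun i hi => h.1 i (by simpa using hi)), one_mul]

theorem u_mul_word (ω : ℂ) (n : ℤ) {l : List ℤ} (h : l.Pairwise (· ≥ ·)) :
    u ω n * word ω l = cost ω n l • word ω (l.orderedInsert (· ≥ ·) n) := by
  induction l with
  | nil => simp [cost]
  | cons i l ih =>
    rw [List.pairwise_cons] at h
    by_cases hn : n ≥ i
    · rw [List.orderedInsert_cons_of_le _ l hn, word_cons ω n, cost_eq_one, one_smul]
      intro j hj
      rcases List.mem_cons.1 (by simpa using hj) with rfl | hj
      · exact hn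
      · exact (h.1 j hj).le.trans hn
    · rw [List.orderedInsert_of_not_le (r := (· ≥ ·)) l hn, word_cons, ← mul_assoc,
        u_mul_u_of_lt ω (not_le.1 hn), smul_mul_assoc, mul_assoc, ih h.2, word_cons,
        mul_smul_comm, smul_smul, ← Multiset.cons_coe, cost_cons]

/-! ### The Fock representation -/

/-- Formal linear combinations of contents. -/
abbrev Fock : Type := Multiset ℤ →₀ ℂ

/-- The action of the generator `u_n` on the decreasing words. -/
noncomputable def fockU (ω : ℂ) (n : ℤ) : Module.End ℂ Fock :=
  Finsupp.lsum ℂ fun s => cost ω n s • Finsupp.lsingle (n ::ₘ s)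

theorem fockU_single (ω : ℂ) (n : ℤ) (s : Multiset ℤ) (c : ℂ) :
    fockU ω n (Finsupp.single s c) = Finsupp.single (n ::ₘ s) (cost ω n s * c) := by
  simp [fockU]

/-- Both orders add the same two letters; they differ only in the price of `n` passing `i`, since
`i` passes the smaller `n` for free. -/
theorem fockU_mul_of_lt (ω : ℂ) {n i : ℤ} (h : n < i) :
    fockU ω n * fockU ω i = exch ω n i • (fockU ω i * fockU ω n) := by
  refine Finsupp.lhom_ext fun s c => ?_
  have h' : exch ω i n = 1 := if_neg (by omega)
  rw [LinearMap.smul_apply, Module.End.mul_apply, Module.End.mul_apply]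
  simp only [fockU_single, cost_cons, h', Finsupp.smul_single, Multiset.cons_swap n i s,
    smul_eq_mul]
  congr 1
  ring

theorem fockU_mul_of_add_lt (ω : ℂ) {n i : ℤ} (h : n + 1 < i) :
    fockU ω n * fockU ω i = -(fockU ω i * fockU ω n) := by
  refine LinearMap.ext fun e => ?_
  have := DFunLike.congr_fun (fockU_mul_of_lt ω (by omega : n < i)) e
  rw [exch, if_pos (by omega), if_neg (by omega), LinearMap.smul_apply] at this
  rw [this, LinearMap.neg_apply, neg_smul, one_smul]

/-- The representation of the quantum algebra on the combinations of contents. -/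
noncomputable def fock (ω : ℂ) : QAlg ω →ₐ[ℂ] Module.End ℂ Fock :=
  liftHom ω (fockU ω)
    (fun n => by
      rw [fockU_mul_of_lt ω (by omega : n < n + 1)]
      simp [exch])
    (fun n m h => by
      rcases le_abs.1 h with h | h
      · refine LinearMap.ext fun e => ?_
        rw [fockU_mul_of_add_lt ω (by omega : m + 1 < n)]
        exact (neg_neg ((fockU ω n * fockU ω m) e)).symm
      · exact fockU_mul_of_add_lt ω (by omega))

@[simp] theorem fock_u (ω : ℂ) (n : ℤ) : fock ω (u ω n) = fockU ω n := liftHom_u _ _ _ _ _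

/-- The expansion of an element of the quantum algebra in decreasing words. -/
noncomputable def expand (ω : ℂ) : QAlg ω →ₗ[ℂ] Fock :=
  (LinearMap.applyₗ (Finsupp.single 0 1)).comp (fock ω).toLinearMap

theorem expand_apply (ω : ℂ) (a : QAlg ω) :
    expand ω a = fock ω a (Finsupp.single 0 1) := rfl

theorem expand_word (ω : ℂ) (l : List ℤ) :
    expand ω (word ω l) = Finsupp.single (l : Multiset ℤ) (wt ω l) := by
  induction l with
  | nil => simp [expand_apply, wt]
  | cons n l ih =>
    rw [expand_apply] at ih ⊢
    rw [word_cons, map_mul, Module.End.mul_apply, ih, fock_u, fockU_single]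
    rfl

/-- The combination of decreasing words with given coefficients. -/
noncomputable def assemble (ω : ℂ) : Fock →ₗ[ℂ] QAlg ω :=
  Finsupp.lsum ℂ fun s => LinearMap.toSpanSingleton ℂ _ (word ω (s.sort (· ≥ ·)))

theorem assemble_single (ω : ℂ) (s : Multiset ℤ) (c : ℂ) :
    assemble ω (Finsupp.single s c) = c • word ω (s.sort (· ≥ ·)) := by
  simp [assemble]

/-- At the vacuum `single 0 1` this makes `assemble` a left inverse of `expand`, so elements of the
algebra may be compared coefficient by coefficient. -/
theorem assemble_fock (ω : ℂ) (a : QAlg ω) (e : Fock) :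
    assemble ω (fock ω a e) = a * assemble ω e := by
  induction a using QAlg.induction generalizing e with
  | hc c => simp [Algebra.algebraMap_eq_smul_one]
  | hu n =>
    induction e using Finsupp.induction_linear with
    | zero => simp
    | add f g hf hg => rw [map_add, map_add, map_add, mul_add, hf, hg]
    | single s c =>
      rw [fock_u, fockU_single, assemble_single, assemble_single, mul_smul_comm,
        u_mul_word ω n (Multiset.pairwise_sort s _), smul_smul, Multiset.sort_eq, mul_comm c]
      congr 2
      refine List.Perm.eq_of_pairwise' (r := (· ≥ ·)) (Multiset.pairwise_sort _ _)
        ((Multiset.pairwise_sort s _).orderedInsert n _) ?_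
      rw [← Multiset.coe_eq_coe, Multiset.sort_eq,
        Multiset.coe_eq_coe.2 (List.perm_orderedInsert _ n _), ← Multiset.cons_coe,
        Multiset.sort_eq]
  | hadd a b ha hb => rw [map_add, LinearMap.add_apply, map_add, ha, hb, add_mul]
  | hmul a b ha hb => rw [map_mul, Module.End.mul_apply, ha, hb, mul_assoc]

theorem expand_injective (ω : ℂ) : Function.Injective (expand ω) := by
  refine Function.LeftInverse.injective (g := assemble ω) fun a => ?_
  rw [expand_apply, assemble_fock, assemble_single]
  simp

/-- The coefficient of the decreasing word of content `s`. -/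
noncomputable def cf (ω : ℂ) (s : Multiset ℤ) : QAlg ω →ₗ[ℂ] ℂ :=
  (Finsupp.lapply s).comp (expand ω)

theorem cf_word (ω : ℂ) (s : Multiset ℤ) (l : List ℤ) :
    cf ω s (word ω l) = if (l : Multiset ℤ) = s then wt ω l else 0 := by
  simp [cf, expand_word, Finsupp.single_apply]

theorem ext_cf {ω : ℂ} {a b : QAlg ω} (h : ∀ s, cf ω s a = cf ω s b) : a = b :=
  expand_injective ω (Finsupp.ext h)

/-! ### Scaling homomorphisms -/

/-- The endomorphism `u_n ↦ f_n u_n`. -/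
noncomputable def scale (ω : ℂ) (f : ℤ → ℂ) : QAlg ω →ₐ[ℂ] QAlg ω :=
  liftHom ω (fun n => f n • u ω n)
    (fun n => by
      simp only [smul_mul_smul_comm, u_adjacent ω n, smul_smul]
      congr 1; ring)
    (fun n m h => by
      simp only [smul_mul_smul_comm, u_far ω n m h, smul_neg, mul_comm (f n)])

@[simp] theorem scale_u (ω : ℂ) (f : ℤ → ℂ) (n : ℤ) : scale ω f (u ω n) = f n • u ω n :=
  liftHom_u _ _ _ _ _

theorem scale_word (ω : ℂ) (f : ℤ → ℂ) (l : List ℤ) :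
    scale ω f (word ω l) = ((l : Multiset ℤ).map f).prod • word ω l := by
  induction l with
  | nil => simp
  | cons n l ih =>
    rw [word_cons, map_mul, ih, scale_u, smul_mul_smul_comm, ← Multiset.cons_coe,
      Multiset.map_cons, Multiset.prod_cons]

theorem scale_scale (ω : ℂ) (f g : ℤ → ℂ) (a : QAlg ω) :
    scale ω f (scale ω g a) = scale ω (f * g) a := by
  induction a using QAlg.induction with
  | hc c => simp only [AlgHom.commutes]
  | hu n => simp [smul_smul, mul_comm]
  | hadd a b ha hb => simp only [map_add, ha, hb]
  | hmul a b ha hb => simp only [map_mul, ha, hb]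

/-- Words span the quantum algebra. -/
theorem word_induction {ω : ℂ} {p : QAlg ω → Prop} (h0 : p 0) (hw : ∀ l, p (word ω l))
    (hadd : ∀ a b, p a → p b → p (a + b)) (hsmul : ∀ (c : ℂ) a, p a → p (c • a))
    (a : QAlg ω) : p a := by
  have ha : a = assemble ω (expand ω a) := by
    rw [expand_apply, assemble_fock, assemble_single]; simp
  rw [ha]
  induction expand ω a using Finsupp.induction_linear with
  | zero => rwa [map_zero]
  | add f g hf hg => rw [map_add]; exact hadd _ _ hf hg
  | single s c => rw [assemble_single]; exact hsmul _ _ (hw _)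

/-- All rescalings are diagonal in the basis of decreasing words, with eigenvalues depending on the
content only. This is how identities between rescaled elements become scalar identities. -/
theorem cf_scale (ω : ℂ) (f : ℤ → ℂ) (s : Multiset ℤ) (a : QAlg ω) :
    cf ω s (scale ω f a) = (s.map f).prod * cf ω s a := by
  induction a using word_induction with
  | h0 => simp
  | hw l =>
    rw [scale_word, map_smul, cf_word]
    split_ifs with h
    · rw [h, smul_eq_mul]
    · simp
  | hadd a b ha hb => rw [map_add, map_add, map_add, ha, hb, mul_add]
  | hsmul c a ha => rw [map_smul, map_smul, map_smul, ha, smul_eq_mul, smul_eq_mul]; ring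

/-! ### Geometric series in rings with a topologically nilpotent central element -/

/-- The geometric series `(1 - x)⁻¹`. -/
noncomputable def geo {B : Type*} [Ring B] (x : B) : B := Ring.inverse (1 - x)

/-- A central element `z` such that all `1 - z x` are invertible. -/
structure IsAdic {B : Type*} [Ring B] (z : B) : Prop where
  comm : ∀ x : B, z * x = x * z
  isUnit : ∀ x : B, IsUnit (1 - z * x)

section Geo

variable {B : Type*} [Ring B] {z : B}

theorem IsAdic.dvd_mul (hz : IsAdic z) {x y : B} (hy : z ∣ y) : z ∣ x * y := by
  obtain ⟨t, rfl⟩ := hy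
  exact ⟨x * t, by rw [← mul_assoc, ← hz.comm, mul_assoc]⟩

theorem IsAdic.unit (hz : IsAdic z) {x : B} (hx : z ∣ x) : IsUnit (1 - x) := by
  obtain ⟨t, rfl⟩ := hx
  exact hz.isUnit t

theorem IsAdic.geo_mul (hz : IsAdic z) {x : B} (hx : z ∣ x) : geo x * (1 - x) = 1 :=
  Ring.inverse_mul_cancel _ (hz.unit hx)

theorem IsAdic.mul_geo (hz : IsAdic z) {x : B} (hx : z ∣ x) : (1 - x) * geo x = 1 :=
  Ring.mul_inverse_cancel _ (hz.unit hx)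

theorem IsAdic.op (hz : IsAdic z) : IsAdic (MulOpposite.op z) where
  comm x := by
    apply MulOpposite.unop_injective
    simp [hz.comm]
  isUnit x := by
    have := (hz.isUnit x.unop).op
    rwa [hz.comm, MulOpposite.op_sub, MulOpposite.op_mul, MulOpposite.op_one,
      MulOpposite.op_unop] at this

theorem geo_eq_of_mul {x y : B} (h1 : y * (1 - x) = 1) (h2 : (1 - x) * y = 1) : geo x = y :=
  Ring.inverse_unit (⟨1 - x, y, h2, h1⟩ : Bˣ)

theorem geo_op (x : B) : geo (MulOpposite.op x) = MulOpposite.op (geo x) := by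
  unfold geo
  by_cases h : IsUnit (1 - x)
  · have e : (1 : Bᵐᵒᵖ) - MulOpposite.op x = MulOpposite.op (1 - x) := rfl
    rw [e]
    exact Ring.inverse_unit (⟨MulOpposite.op (1 - x), MulOpposite.op (Ring.inverse (1 - x)),
      by rw [← MulOpposite.op_mul, Ring.inverse_mul_cancel _ h]; rfl,
      by rw [← MulOpposite.op_mul, Ring.mul_inverse_cancel _ h]; rfl⟩ : (Bᵐᵒᵖ)ˣ)
  · rw [Ring.inverse_non_unit _ h, Ring.inverse_non_unit]
    · rfl
    · intro h'
      exact h h'.unop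

theorem IsAdic.map_geo {C : Type*} [Ring C] (hz : IsAdic z) (f : B →+* C) {x : B}
    (hx : z ∣ x) : f (geo x) = geo (f x) := by
  refine (geo_eq_of_mul ?_ ?_).symm
  · rw [← map_one f, ← map_sub, ← map_mul, hz.geo_mul hx]
  · rw [← map_one f, ← map_sub, ← map_mul, hz.mul_geo hx]

/-- Intertwining relations pass to geometric series. -/
theorem IsAdic.geo_mul_eq (hz : IsAdic z) {x y w : B} (hx : z ∣ x) (hy : z ∣ y)
    (h : x * w = w * y) : geo x * w = w * geo y := by
  have h' : (1 - x) * w = w * (1 - y) := by rw [sub_mul, mul_sub, one_mul, mul_one, h]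
  calc geo x * w = geo x * (w * ((1 - y) * geo y)) := by rw [hz.mul_geo hy, mul_one]
    _ = geo x * ((1 - x) * w) * geo y := by rw [h']; simp only [mul_assoc]
    _ = w * geo y := by rw [← mul_assoc (geo x), hz.geo_mul hx, one_mul]

/-- The resolvent identity. -/
theorem IsAdic.geo_sub_geo (hz : IsAdic z) {x y : B} (hx : z ∣ x) (hy : z ∣ y) :
    geo x - geo y = geo x * (x - y) * geo y := by
  have : x - y = (1 - y) - (1 - x) := by abel
  rw [this, mul_sub, sub_mul, hz.geo_mul hx, one_mul, mul_assoc, hz.mul_geo hy, mul_one]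

end Geo

/-! ### The key identity for four families of atoms that commute up to scalars. -/

section Key

variable {B : Type*} [Ring B] [Algebra ℂ B] {z : B}

theorem IsAdic.dvd_smul {x : B} (k : ℂ) (hx : z ∣ x) : z ∣ k • x := by
  obtain ⟨t, rfl⟩ := hx
  exact ⟨k • t, by rw [mul_smul_comm]⟩

/-- With `s = a + y + d`, the commutation relations give a second factorisation `(1 - s)(1 - k s) =
(1 - (a + k y + k d))(1 - (k a + y + d))`; the left-hand side is a resolvent difference of `s` and
`k s`. -/
theorem IsAdic.smul_geo_sub (hz : IsAdic z) {k : ℂ} {a y d : B}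
    (ha : z ∣ a) (hy : z ∣ y) (hd : z ∣ d)
    (hay : a * y = k • (y * a)) (hyd : y * d = k • (d * y)) (had : a * d = k • (d * a)) :
    k • geo (k • (a + y + d)) - geo (a + y + d) =
      (k - 1) • (geo (k • a + y + d) * geo (a + k • y + k • d)) := by
  have hs : z ∣ a + y + d := dvd_add (dvd_add ha hy) hd
  have hks : z ∣ k • (a + y + d) := IsAdic.dvd_smul k hs
  have ht : z ∣ k • a + y + d := dvd_add (dvd_add (IsAdic.dvd_smul k ha) hy) hd
  have ht2 : z ∣ a + k • y + k • d :=
    dvd_add (dvd_add ha (IsAdic.dvd_smul k hy)) (IsAdic.dvd_smul k hd)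
  have h1 : k • geo (k • (a + y + d)) - geo (a + y + d) =
      (k - 1) • (geo (k • (a + y + d)) * geo (a + y + d)) := by
    have e : k • (1 - (a + y + d)) - (1 - k • (a + y + d)) = (k - 1) • (1 : B) := by module
    calc _ = geo (k • (a + y + d)) * (k • (1 - (a + y + d)) - (1 - k • (a + y + d))) *
          geo (a + y + d) := by
          rw [mul_sub, sub_mul, hz.geo_mul hks, one_mul, mul_smul_comm, smul_mul_assoc,
            mul_assoc, hz.mul_geo hs, mul_one]
      _ = _ := by rw [e, mul_smul_comm, mul_one, smul_mul_assoc]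
  have h2 : (1 - (a + y + d)) * (1 - k • (a + y + d)) =
      (1 - (a + k • y + k • d)) * (1 - (k • a + y + d)) := by
    simp only [mul_add, add_mul, mul_sub, sub_mul, smul_mul_assoc, mul_smul_comm, smul_add,
      mul_one, one_mul, hay, hyd, had]
    module
  have h3 : geo (k • (a + y + d)) * geo (a + y + d) =
      geo (k • a + y + d) * geo (a + k • y + k • d) := by
    calc _ = geo (k • (a + y + d)) * geo (a + y + d) * ((1 - (a + k • y + k • d)) *
          ((1 - (k • a + y + d)) * geo (k • a + y + d)) * geo (a + k • y + k • d)) := by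
          rw [hz.mul_geo ht, mul_one, hz.mul_geo ht2, mul_one]
      _ = geo (k • (a + y + d)) * (geo (a + y + d) * ((1 - (a + k • y + k • d)) *
          (1 - (k • a + y + d)))) * (geo (k • a + y + d) * geo (a + k • y + k • d)) := by
          simp only [mul_assoc]
      _ = _ := by
          rw [← h2, ← mul_assoc (geo (a + y + d)), hz.geo_mul hs, one_mul, hz.geo_mul hks,
            one_mul]
  rw [h1, h3]

/-- The resolvent identity leaves `a` between two geometric series; it moves to the right because
`(a + k y + k d) a = a (a + y + d)`. -/
theorem IsAdic.geo_sub_first (hz : IsAdic z) {k : ℂ} {a y d : B}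
    (ha : z ∣ a) (hy : z ∣ y) (hd : z ∣ d)
    (hay : a * y = k • (y * a)) (had : a * d = k • (d * a)) :
    geo (k • a + y + d) - geo (a + y + d) =
      (k - 1) • (geo (k • a + y + d) * geo (a + k • y + k • d) * a) := by
  have hs : z ∣ a + y + d := dvd_add (dvd_add ha hy) hd
  have ht : z ∣ k • a + y + d := dvd_add (dvd_add (IsAdic.dvd_smul k ha) hy) hd
  have ht2 : z ∣ a + k • y + k • d :=
    dvd_add (dvd_add ha (IsAdic.dvd_smul k hy)) (IsAdic.dvd_smul k hd)
  have e : k • a + y + d - (a + y + d) = (k - 1) • a := by module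
  rw [hz.geo_sub_geo ht hs, e, mul_smul_comm, smul_mul_assoc, mul_assoc, mul_assoc,
    hz.geo_mul_eq ht2 hs]
  simp only [mul_add, add_mul, smul_mul_assoc, hay, had]

/-- Separates the parts even and odd in `y`. Since `y (1 - (k a + d)) = (1 - (a + k d)) y`, left
multiplication of `1 - (k a + y + d)` by `1 + h y` removes the term linear in `y`, and what remains
contains `y` only through `h y y`. -/
theorem IsAdic.geo_add_middle (hz : IsAdic z) {k : ℂ} {a y d : B}
    (ha : z ∣ a) (hy : z ∣ y) (hd : z ∣ d)
    (hay : a * y = k • (y * a)) (hyd : y * d = k • (d * y)) :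
    geo (k • a + y + d) =
      geo (k • a + geo (a + k • d) * y * y + d) * (1 + geo (a + k • d) * y) := by
  have ht : z ∣ k • a + y + d := dvd_add (dvd_add (IsAdic.dvd_smul k ha) hy) hd
  have hp : z ∣ a + k • d := dvd_add ha (IsAdic.dvd_smul k hd)
  have ht' : z ∣ k • a + geo (a + k • d) * y * y + d :=
    dvd_add (dvd_add (IsAdic.dvd_smul k ha) (hz.dvd_mul hy)) hd
  set h := geo (a + k • d) with hh
  have h1 : h * y * (1 - (k • a + d)) = y := by
    have : y * (1 - (k • a + d)) = (1 - (a + k • d)) * y := by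
      simp only [mul_add, add_mul, mul_sub, sub_mul, smul_mul_assoc, mul_smul_comm, mul_one,
        one_mul, hay, hyd]
    rw [mul_assoc, this, ← mul_assoc, hh, hz.geo_mul hp, one_mul]
  have h2 : (1 + h * y) * (1 - (k • a + y + d)) = 1 - (k • a + h * y * y + d) := by
    have : 1 - (k • a + y + d) = 1 - (k • a + d) - y := by abel
    rw [this, add_mul, one_mul, mul_sub, h1]
    abel
  calc _ = geo (k • a + h * y * y + d) * ((1 + h * y) * (1 - (k • a + y + d))) *
        geo (k • a + y + d) := by rw [h2, hz.geo_mul ht', one_mul]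
    _ = _ := by rw [mul_assoc, mul_assoc (1 + h * y), hz.mul_geo ht, mul_one]

theorem IsAdic.geo_add_middle' (hz : IsAdic z) (k : ℂ) {a y d : B}
    (ha : z ∣ a) (hy : z ∣ y) (hd : z ∣ d) :
    geo (a + k • y + k • d) = (1 + k • (geo (a + k • d) * y)) *
      geo (a + k ^ 2 • (y * geo (a + k • d) * y) + k • d) := by
  have hp : z ∣ a + k • d := dvd_add ha (IsAdic.dvd_smul k hd)
  have ht : z ∣ a + k • y + k • d :=
    dvd_add (dvd_add ha (IsAdic.dvd_smul k hy)) (IsAdic.dvd_smul k hd)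
  have ht' : z ∣ a + k ^ 2 • (y * geo (a + k • d) * y) + k • d :=
    dvd_add (dvd_add ha (IsAdic.dvd_smul _ (hz.dvd_mul hy))) (IsAdic.dvd_smul k hd)
  set h := geo (a + k • d) with hh
  have h2 : (1 - (a + k • y + k • d)) * (1 + k • (h * y)) =
      1 - (a + k ^ 2 • (y * h * y) + k • d) := by
    have : 1 - (a + k • y + k • d) = 1 - (a + k • d) - k • y := by abel
    rw [this, sub_mul, mul_add, mul_smul_comm, ← mul_assoc, hh, hz.mul_geo hp]
    simp only [one_mul, mul_one, mul_add, smul_mul_assoc, mul_smul_comm, mul_assoc]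
    module
  calc _ = geo (a + k • y + k • d) * ((1 - (a + k • y + k • d)) * (1 + k • (h * y)) *
        geo (a + k ^ 2 • (y * h * y) + k • d)) := by rw [h2, hz.mul_geo ht', mul_one]
    _ = _ := by rw [← mul_assoc, ← mul_assoc, hz.geo_mul ht, one_mul]

/-- Relations between the four families of atoms. -/
structure AtomRel (k : ℂ) (a b c d : B) : Prop where
  ab : a * b = k • (b * a)
  ac : a * c = k • (c * a)
  ad : a * d = k • (d * a)
  bc : b * c = -(k • (c * b))
  bd : b * d = k • (d * b)
  cd : c * d = k • (d * c)

/-- Write `y = b + c` and `y' = c - k b`. Then `y' y' - y y = (k² - 1) y b` and `b y' = -k y b`: the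
first evaluates the resolvent difference, the second carries `b` through the geometric series in
`y'`, which becomes one in `y`. -/
theorem IsAdic.geo_middle_sub (hz : IsAdic z) {k : ℂ} (hk : k ≠ 0) {a b c d : B}
    (ha : z ∣ a) (hb : z ∣ b) (hc : z ∣ c) (hd : z ∣ d) (r : AtomRel k a b c d) :
    geo (k • a + geo (a + k • d) * (c - k • b) * (c - k • b) + d) -
      geo (k • a + geo (a + k • d) * (b + c) * (b + c) + d) =
    (k ^ 2 - 1) • (geo (k • a + geo (a + k • d) * (b + c) * (b + c) + d) * geo (a + k • d) *
      (b + c) * geo (a + k ^ 2 • ((b + c) * geo (a + k • d) * (b + c)) + k • d) * b) := by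
  have hy : z ∣ b + c := dvd_add hb hc
  have hy' : z ∣ c - k • b := dvd_sub hc (IsAdic.dvd_smul k hb)
  have hp : z ∣ a + k • d := dvd_add ha (IsAdic.dvd_smul k hd)
  have hp2 : z ∣ k⁻¹ • a + k ^ 2 • d := dvd_add (IsAdic.dvd_smul _ ha) (IsAdic.dvd_smul _ hd)
  have hu : z ∣ k • a + geo (a + k • d) * (b + c) * (b + c) + d :=
    dvd_add (dvd_add (IsAdic.dvd_smul k ha) (hz.dvd_mul hy)) hd
  have hv : z ∣ k • a + geo (a + k • d) * (c - k • b) * (c - k • b) + d :=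
    dvd_add (dvd_add (IsAdic.dvd_smul k ha) (hz.dvd_mul hy')) hd
  have hu2 : z ∣ a + k ^ 2 • ((b + c) * geo (a + k • d) * (b + c)) + k • d :=
    dvd_add (dvd_add ha (IsAdic.dvd_smul _ (hz.dvd_mul hy))) (IsAdic.dvd_smul k hd)
  have hba : b * a = k⁻¹ • (a * b) := by rw [r.ab, inv_smul_smul₀ hk]
  have hca : c * a = k⁻¹ • (a * c) := by rw [r.ac, inv_smul_smul₀ hk]
  set h := geo (a + k • d) with hh
  have hbh : geo (k⁻¹ • a + k ^ 2 • d) * b = b * h := by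
    refine hz.geo_mul_eq hp2 hp ?_
    simp only [mul_add, add_mul, smul_mul_assoc, mul_smul_comm, hba, r.bd, smul_smul, sq]
  have hyh : geo (k⁻¹ • a + k ^ 2 • d) * (b + c) = (b + c) * h := by
    refine hz.geo_mul_eq hp2 hp ?_
    simp only [mul_add, add_mul, smul_mul_assoc, mul_smul_comm, hba, hca, r.bd, r.cd]
    module
  have hby : b * (c - k • b) = -(k • ((b + c) * b)) := by
    simp only [mul_sub, add_mul, mul_smul_comm, r.bc]
    module
  have hsq : (c - k • b) * (c - k • b) - (b + c) * (b + c) = (k ^ 2 - 1) • ((b + c) * b) := by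
    simp only [mul_sub, sub_mul, mul_add, add_mul, smul_mul_assoc, mul_smul_comm, r.bc]
    module
  have hbv : geo (a + k ^ 2 • ((b + c) * h * (b + c)) + k • d) * b =
      b * geo (k • a + h * (c - k • b) * (c - k • b) + d) := by
    refine hz.geo_mul_eq hu2 hv ?_
    have e : b * (h * (c - k • b) * (c - k • b)) = k ^ 2 • ((b + c) * h * (b + c) * b) := by
      calc b * (h * (c - k • b) * (c - k • b)) = b * h * (c - k • b) * (c - k • b) := by
            simp only [mul_assoc]
        _ = geo (k⁻¹ • a + k ^ 2 • d) * (b * (c - k • b)) * (c - k • b) := by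
            rw [← hbh]; simp only [mul_assoc]
        _ = geo (k⁻¹ • a + k ^ 2 • d) * -(k • ((b + c) * b)) * (c - k • b) := by rw [hby]
        _ = -(k • (geo (k⁻¹ • a + k ^ 2 • d) * (b + c) * (b * (c - k • b)))) := by
            simp only [mul_assoc, mul_neg, neg_mul, mul_smul_comm, smul_mul_assoc]
        _ = k ^ 2 • ((b + c) * h * (b + c) * b) := by
            rw [hby, hyh]
            simp only [mul_assoc, mul_neg, mul_smul_comm]
            module
    rw [mul_add b (_ + _) d, mul_add b (k • a), e, add_mul, add_mul _ _ b, smul_mul_assoc,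
      smul_mul_assoc, mul_smul_comm, r.ab, r.bd]
  have hvu : geo (k • a + h * (c - k • b) * (c - k • b) + d) -
      geo (k • a + h * (b + c) * (b + c) + d) =
      geo (k • a + h * (b + c) * (b + c) + d) * (h * ((c - k • b) * (c - k • b) -
        (b + c) * (b + c))) * geo (k • a + h * (c - k • b) * (c - k • b) + d) := by
    have e : h * ((c - k • b) * (c - k • b) - (b + c) * (b + c)) =
        -((k • a + h * (b + c) * (b + c) + d) - (k • a + h * (c - k • b) * (c - k • b) + d)) := by
      simp only [mul_sub, ← mul_assoc]
      abel
    rw [e, mul_neg, neg_mul, ← hz.geo_sub_geo hu hv, neg_sub]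
  rw [hvu, hsq]
  simp only [mul_smul_comm, smul_mul_assoc, mul_assoc] at hbv ⊢
  rw [hbv]

/-- The key identity between the generating series of all words, with one family of atoms
rescaled, and of the words whose last atom belongs to that family. -/
theorem IsAdic.key (hz : IsAdic z) {k : ℂ} (hk : k ≠ 0) {a b c d : B}
    (ha : z ∣ a) (hb : z ∣ b) (hc : z ∣ c) (hd : z ∣ d) (r : AtomRel k a b c d) :
    (geo (k • a + (c - k • b) + d) + geo (k • a + -(c - k • b) + d)) -
      (geo (a + (b + c) + d) + geo (a + -(b + c) + d)) =
    (k • geo (k • (a + (b + c) + d)) - geo (a + (b + c) + d)) * (a + b) +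
      (k • geo (k • (a + -(b + c) + d)) - geo (a + -(b + c) + d)) * (a - b) := by
  have hy : z ∣ b + c := dvd_add hb hc
  have hy' : z ∣ c - k • b := dvd_sub hc (IsAdic.dvd_smul k hb)
  have hny : z ∣ -(b + c) := (dvd_neg).2 hy
  have hny' : z ∣ -(c - k • b) := (dvd_neg).2 hy'
  have hay : a * (b + c) = k • ((b + c) * a) := by
    rw [mul_add, add_mul, smul_add, r.ab, r.ac]
  have hyd : (b + c) * d = k • (d * (b + c)) := by
    rw [mul_add, add_mul, smul_add, r.bd, r.cd]
  have hay' : a * (c - k • b) = k • ((c - k • b) * a) := by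
    rw [mul_sub, sub_mul, smul_sub, mul_smul_comm, smul_mul_assoc, r.ab, r.ac]
  have hyd' : (c - k • b) * d = k • (d * (c - k • b)) := by
    rw [mul_sub, sub_mul, smul_sub, mul_smul_comm, smul_mul_assoc, r.bd, r.cd]
  have hnay : a * -(b + c) = k • (-(b + c) * a) := by rw [mul_neg, hay, neg_mul, smul_neg]
  have hnyd : -(b + c) * d = k • (d * -(b + c)) := by rw [mul_neg, smul_neg, neg_mul, hyd]
  have hnay' : a * -(c - k • b) = k • (-(c - k • b) * a) := by
    rw [mul_neg, hay', neg_mul, smul_neg]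
  have hnyd' : -(c - k • b) * d = k • (d * -(c - k • b)) := by
    rw [mul_neg, smul_neg, neg_mul, hyd']
  have e1 := hz.smul_geo_sub ha hy hd hay hyd r.ad
  have e2 := hz.smul_geo_sub ha hny hd hnay hnyd r.ad
  have f1 := hz.geo_sub_first ha hy hd hay r.ad
  have f2 := hz.geo_sub_first ha hny hd hnay r.ad
  have g1 := hz.geo_add_middle ha hy hd hay hyd
  have g2 := hz.geo_add_middle ha hny hd hnay hnyd
  have g3 := hz.geo_add_middle ha hy' hd hay' hyd'
  have g4 := hz.geo_add_middle ha hny' hd hnay' hnyd'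
  have l1 := hz.geo_add_middle' k ha hy hd
  have l2 := hz.geo_add_middle' k ha hny hd
  have m := hz.geo_middle_sub hk ha hb hc hd r
  rw [e1, e2, mul_add, mul_sub, smul_mul_assoc, smul_mul_assoc, smul_mul_assoc, smul_mul_assoc,
    ← f1, ← f2]
  simp only [mul_neg, neg_mul, neg_neg] at g2 g4 l2
  -- The terms with `a` on the right have just become differences of geometric series by
  -- `geo_sub_first`. Only the terms with `b` are left, and they involve the part odd in `b + c`.
  suffices key : (geo (k • a + (c - k • b) + d) + geo (k • a + -(c - k • b) + d)) -
      (geo (k • a + (b + c) + d) + geo (k • a + -(b + c) + d)) =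
      (k - 1) • ((geo (k • a + (b + c) + d) * geo (a + k • (b + c) + k • d) -
      geo (k • a + -(b + c) + d) * geo (a + k • -(b + c) + k • d)) * b) by
    rw [sub_mul, smul_sub] at key
    rw [sub_eq_iff_eq_add] at key ⊢
    rw [key]
    abel
  rw [g1, g2, g3, g4, l1, l2]
  set h := geo (a + k • d)
  set Ue := geo (k • a + h * (b + c) * (b + c) + d)
  set Ve := geo (k • a + h * (c - k • b) * (c - k • b) + d)
  set U2e := geo (a + k ^ 2 • ((b + c) * h * (b + c)) + k • d)
  have hV : Ve = Ue + (k ^ 2 - 1) • (Ue * h * (b + c) * U2e * b) := by rw [← m]; abel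
  have hl : Ve * (1 + h * (c - k • b)) + Ve * (1 + -(h * (c - k • b))) -
      (Ue * (1 + h * (b + c)) + Ue * (1 + -(h * (b + c)))) = (2 : ℂ) • (Ve - Ue) := by
    simp only [mul_add, mul_neg, mul_one]
    module
  -- The constant is that of `(1 + t)(1 + k t) - (1 - t)(1 - k t) = 2 (k + 1) t`; times `k - 1` it
  -- matches twice the `k² - 1` of `geo_middle_sub`.
  have hr : Ue * (1 + h * (b + c)) * ((1 + k • (h * (b + c))) * U2e) -
      Ue * (1 + -(h * (b + c))) * ((1 + k • -(h * (b + c))) * U2e) =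
      (2 * (k + 1)) • (Ue * h * (b + c) * U2e) := by
    rw [show Ue * h * (b + c) * U2e = Ue * (h * (b + c)) * U2e by simp only [mul_assoc]]
    generalize h * (b + c) = t
    simp only [mul_add, add_mul, mul_neg, neg_mul, mul_one, one_mul, smul_neg, mul_smul_comm,
      smul_mul_assoc, mul_assoc]
    module
  rw [hl, hr, hV]
  simp only [smul_mul_assoc]
  module

end Key

set_option linter.unusedSectionVars false

/-! ### Continued fractions -/

section Tower

variable {B : Type*} [Ring B] [Algebra ℂ B] {z : B}

/-- The even and the odd part of `v (1 - S)⁻¹`, from the even and the odd part of `S`. -/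
noncomputable def towerStep (v : B) (p : B × B) : B × B :=
  (v * geo (p.1 + p.2 * geo p.1 * p.2) * p.2 * geo p.1, v * geo (p.1 + p.2 * geo p.1 * p.2))

/-- The even and the odd part of the continued fraction
`T_x = v_x (1 - T_{x-1})⁻¹` of a given depth. -/
noncomputable def tower (v : ℤ → B) : ℕ → ℤ → B × B
  | 0, _ => 0
  | d + 1, x => towerStep (v x) (tower v d (x - 1))

theorem tower_dvd {v : ℤ → B} (hv : ∀ i, z ∣ v i) (d : ℕ) (x : ℤ) :
    z ∣ (tower v d x).1 ∧ z ∣ (tower v d x).2 := by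
  cases d with
  | zero => exact ⟨dvd_zero z, dvd_zero z⟩
  | succ d =>
    refine ⟨?_, ?_⟩ <;> simp only [tower, towerStep, mul_assoc] <;>
      exact dvd_mul_of_dvd_left (hv x) _

theorem tower_inner_dvd (hz : IsAdic z) {v : ℤ → B} (hv : ∀ i, z ∣ v i) (d : ℕ) (x : ℤ) :
    z ∣ (tower v d x).1 + (tower v d x).2 * geo (tower v d x).1 * (tower v d x).2 :=
  dvd_add (tower_dvd hv d x).1 (hz.dvd_mul (tower_dvd hv d x).2)

/-- A block inversion: `(1 + p.2 m)(1 - p.1 - p.2) = 1 - p.1 - p.2 m p.2` for `m = geo p.1`. Keeping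
track of the depth makes the recursion exact, without any limit of continued fractions. -/
theorem tower_mul (hz : IsAdic z) {v : ℤ → B} (hv : ∀ i, z ∣ v i) (d : ℕ) (x : ℤ) :
    ((tower v (d + 1) x).1 + (tower v (d + 1) x).2) *
      (1 - ((tower v d (x - 1)).1 + (tower v d (x - 1)).2)) = v x := by
  have h1 := (tower_dvd hv d (x - 1)).1
  have h2 := tower_inner_dvd hz hv d (x - 1)
  rw [tower, towerStep]
  set p := tower v d (x - 1)
  simp only
  set m := geo p.1 with hm
  set E := geo (p.1 + p.2 * m * p.2) with hE
  have e1 : m * (1 - (p.1 + p.2)) = 1 - m * p.2 := by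
    rw [← sub_sub, mul_sub, hm, hz.geo_mul h1]
  calc _ = v x * (E * (p.2 * (m * (1 - (p.1 + p.2))) + (1 - (p.1 + p.2)))) := by
        simp only [add_mul, mul_add, mul_assoc]
    _ = v x * (E * (1 - (p.1 + p.2 * m * p.2))) := by
        rw [e1]; congr 2; rw [mul_sub, mul_one, mul_assoc]; abel
    _ = v x := by rw [hE, hz.geo_mul h2, mul_one]

/-- A relation between elements of two rings which is compatible with the operations. -/
structure IsCongr (z : B) (Q : B → B → Prop) : Prop where
  zero : Q 0 0
  add : ∀ {x y x' y'}, Q x x' → Q y y' → Q (x + y) (x' + y')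
  mul : ∀ {x y x' y'}, Q x x' → Q y y' → Q (x * y) (x' * y')
  geo : ∀ {x x'}, z ∣ x → z ∣ x' → Q x x' → Q (geo x) (geo x')

theorem IsAdic.isCongr_intertwine (hz : IsAdic z) (w : B) :
    IsCongr z fun x y => x * w = w * y where
  zero := by rw [zero_mul, mul_zero]
  add h h' := by rw [add_mul, mul_add, h, h']
  mul h h' := by rw [mul_assoc, h', ← mul_assoc, h, mul_assoc]
  geo hx hy h := hz.geo_mul_eq hx hy h

theorem IsAdic.isCongr_hom (hz : IsAdic z) (σ : B →+* B) : IsCongr z fun x y => σ x = y where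
  zero := map_zero σ
  add h h' := by rw [map_add, h, h']
  mul h h' := by rw [map_mul, h, h']
  geo hx _ h := by rw [hz.map_geo σ hx, h]

/-- Rescaling the generators, with the same sign for all of them but the top one, rescales
the even and the odd part of a continued fraction. -/
theorem tower_congr (hz : IsAdic z) {v : ℤ → B} (hv : ∀ i, z ∣ v i) {Q : B → B → Prop}
    (hQ : IsCongr z Q) {ε : ℂ} (hε : ε * ε = 1) {d : ℕ} {x : ℤ} {f : ℤ → ℂ}
    (hf : ∀ i, i < x → f i = ε) (hvQ : ∀ i, i ≤ x → Q (v i) (f i • v i)) :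
    Q (tower v d x).1 ((ε * f x) • (tower v d x).1) ∧ Q (tower v d x).2 (f x • (tower v d x).2) := by
  induction d generalizing x with
  | zero =>
    have h : (tower v 0 x) = 0 := rfl
    rw [h]
    exact ⟨by rw [Prod.fst_zero, smul_zero]; exact hQ.zero,
      by rw [Prod.snd_zero, smul_zero]; exact hQ.zero⟩
  | succ d ih =>
    obtain ⟨h1, h2⟩ := ih (x := x - 1) (fun i hi => hf i (by omega)) (fun i hi => hvQ i (by omega))
    -- In the inner tower every letter, including the top one, carries `ε`; hence its even part is
    -- fixed and its odd part is multiplied by `ε`.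
    rw [hf (x - 1) (by omega), hε, one_smul] at h1
    rw [hf (x - 1) (by omega)] at h2
    have d1 := (tower_dvd hv d (x - 1)).1
    have d2 := tower_inner_dvd hz hv d (x - 1)
    rw [tower, towerStep]
    set p := tower v d (x - 1)
    have h3 : Q (geo p.1) (geo p.1) := hQ.geo d1 d1 h1
    have h4 : Q (geo (p.1 + p.2 * geo p.1 * p.2)) (geo (p.1 + p.2 * geo p.1 * p.2)) := by
      refine hQ.geo d2 d2 ?_
      have := hQ.add h1 (hQ.mul (hQ.mul h2 h3) h2)
      rwa [smul_mul_assoc, smul_mul_assoc, mul_smul_comm, smul_smul, hε, one_smul] at this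
    have h5 := hQ.mul (hvQ x le_rfl) h4
    refine ⟨?_, ?_⟩
    · have := hQ.mul (hQ.mul h5 h2) h3
      simpa only [smul_mul_assoc, mul_smul_comm, smul_smul] using this
    · simpa only [smul_mul_assoc] using h5

/-- The relations of the generators of the quantum algebra. -/
structure TowerRel (η : ℂ) (v : ℤ → B) : Prop where
  adjacent : ∀ i, v i * v (i + 1) = ((-1) ^ i * η) • (v (i + 1) * v i)
  far : ∀ i j, i + 1 < j → v i * v j = -(v j * v i)

theorem neg_one_zpow_sub_one (x : ℤ) : (-1 : ℂ) ^ (x - 1) = -(-1) ^ x := by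
  rw [zpow_sub_one₀ (by norm_num)]
  norm_num

theorem neg_one_zpow_add_one (x : ℤ) : (-1 : ℂ) ^ (x + 1) = -(-1) ^ x := by
  rw [zpow_add_one₀ (by norm_num)]
  norm_num

/-- Induction on the depth: with `k = (-1)^x η`, the even and odd inner parts pass `v x` with
factors `k` and `-k`, and pass each other with the factor `k`. The product then reorders by `m p.2 E
= E p.2 m`. -/
theorem tower_even_mul_odd (hz : IsAdic z) {v : ℤ → B} (hv : ∀ i, z ∣ v i) {η : ℂ}
    (r : TowerRel η v) (d : ℕ) (x : ℤ) :
    (tower v d x).1 * (tower v d x).2 =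
      ((-1) ^ (x + 1) * η) • ((tower v d x).2 * (tower v d x).1) := by
  induction d generalizing x with
  | zero =>
    have h : (tower v 0 x) = 0 := rfl
    rw [h, Prod.fst_zero, zero_mul, mul_zero, smul_zero]
  | succ d ih =>
    have ih := ih (x - 1)
    obtain ⟨h1, h2⟩ := tower_congr hz hv (hz.isCongr_intertwine (v x)) (ε := -1) (by norm_num)
      (d := d) (x := x - 1) (f := fun i => if i = x - 1 then (-1) ^ (x - 1) * η else -1)
      (fun i hi => if_neg hi.ne) (fun i hi => by
        rw [mul_smul_comm]
        split_ifs with h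
        · subst h
          have := r.adjacent (x - 1)
          rwa [sub_add_cancel] at this
        · rw [r.far i x (by omega), neg_one_smul])
    have d1 := (tower_dvd hv d (x - 1)).1
    have d2 := tower_inner_dvd hz hv d (x - 1)
    rw [tower, towerStep]
    rw [sub_add_cancel] at ih
    simp only [if_true, neg_one_zpow_sub_one] at h1 h2
    rw [neg_one_zpow_add_one]
    set p := tower v d (x - 1)
    simp only
    generalize hk : (-1 : ℂ) ^ x * η = k at *
    have e1 : -1 * (-(-1) ^ x * η) = k := by rw [← hk]; ring
    have e2 : -(-1) ^ x * η = -k := by rw [← hk]; ring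
    rw [e1] at h1
    rw [e2] at h2 ⊢
    set m := geo p.1 with hm
    set E := geo (p.1 + p.2 * m * p.2) with hE
    have hp : (1 - p.1) * p.2 = p.2 * (1 - k • p.1) := by
      rw [sub_mul, mul_sub, one_mul, mul_one, mul_smul_comm, ih]
    have dk : z ∣ k • p.1 := IsAdic.dvd_smul k d1
    have h3 : m * v x = v x * geo (k • p.1) :=
      hz.geo_mul_eq d1 dk (by rw [h1, mul_smul_comm])
    have h4 : m * p.2 = p.2 * geo (k • p.1) :=
      hz.geo_mul_eq d1 dk (by rw [ih, mul_smul_comm])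
    -- Both sides equal `p.2 - p.2 m p.2 m p.2`.
    have h5 : (1 - (p.1 + p.2 * m * p.2)) * (m * p.2) =
        p.2 * m * (1 - (p.1 + p.2 * m * p.2)) := by
      have a1 : (1 - p.1) * (m * p.2) = p.2 := by
        rw [← mul_assoc, hm, hz.mul_geo d1, one_mul]
      have a2 : p.2 * m * (1 - p.1) = p.2 := by
        rw [mul_assoc, hm, hz.geo_mul d1, mul_one]
      rw [← sub_sub, sub_mul, a1, mul_sub, a2]
      simp only [mul_assoc]
    have h6 : m * p.2 * E = E * (p.2 * m) := by
      calc m * p.2 * E = E * ((1 - (p.1 + p.2 * m * p.2)) * (m * p.2)) * E := by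
            rw [← mul_assoc, hE, hz.geo_mul d2, one_mul]
        _ = E * (p.2 * m) * ((1 - (p.1 + p.2 * m * p.2)) * E) := by
            rw [h5]; simp only [mul_assoc]
        _ = E * (p.2 * m) := by rw [hE, hz.mul_geo d2, mul_one]
    calc v x * E * p.2 * m * (v x * E) = v x * E * (p.2 * (m * v x)) * E := by
          simp only [mul_assoc]
      _ = v x * E * ((p.2 * v x) * geo (k • p.1)) * E := by rw [h3]; simp only [mul_assoc]
      _ = -k • (v x * E * (v x * (p.2 * geo (k • p.1) * E))) := by
          rw [h2]
          simp only [mul_smul_comm, smul_mul_assoc, mul_assoc]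
      _ = -k • (v x * E * (v x * E * p.2 * m)) := by
          rw [← h4, h6]; simp only [mul_assoc]

/-! ### Two-sided continued fractions -/

/-- The generators in the opposite order, in the opposite ring. -/
def opGen (v : ℤ → B) (i : ℤ) : Bᵐᵒᵖ := MulOpposite.op (v (-i))

theorem opGen_dvd (hz : IsAdic z) {v : ℤ → B} (hv : ∀ i, z ∣ v i) (i : ℤ) :
    MulOpposite.op z ∣ opGen v i := by
  obtain ⟨t, ht⟩ := hv (-i)
  exact ⟨MulOpposite.op t, by rw [opGen, ht, hz.comm, MulOpposite.op_mul]⟩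

/-- The reflection `i ↦ -i` sends the pair `i, i + 1` to the pair starting at `-(i + 1)`, whose
parity is opposite; hence the sign of `η`. -/
theorem TowerRel.opGen {η : ℂ} {v : ℤ → B} (r : TowerRel η v) : TowerRel (-η) (opGen v) where
  adjacent i := by
    have h := r.adjacent (-(i + 1))
    have e : -(i + 1) + 1 = -i := by ring
    rw [e] at h
    have e2 : (-1 : ℂ) ^ (-(i + 1)) = -(-1) ^ i := by
      rw [zpow_neg, ← inv_zpow, inv_neg, inv_one, neg_one_zpow_add_one]
    rw [e2] at h
    apply MulOpposite.unop_injective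
    simp only [Volterra.opGen, MulOpposite.unop_mul, MulOpposite.unop_op, MulOpposite.unop_smul]
    rw [h]
    congr 1; ring
  far i j h := by
    apply MulOpposite.unop_injective
    simp only [Volterra.opGen, MulOpposite.unop_mul, MulOpposite.unop_op, MulOpposite.unop_neg]
    exact r.far _ _ (by omega)

/-- The even and the odd part of the continued fraction `R_x = (1 - R_{x+1})⁻¹ v_x`. -/
noncomputable def opTower (v : ℤ → B) (d : ℕ) (x : ℤ) : B × B :=
  ((tower (opGen v) d (-x)).1.unop, (tower (opGen v) d (-x)).2.unop)

theorem unop_dvd (hz : IsAdic z) {x : Bᵐᵒᵖ} (h : MulOpposite.op z ∣ x) : z ∣ x.unop := by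
  obtain ⟨t, rfl⟩ := h
  exact ⟨t.unop, by rw [MulOpposite.unop_mul, MulOpposite.unop_op, hz.comm]⟩

theorem op_dvd (hz : IsAdic z) {x : B} (h : z ∣ x) : MulOpposite.op z ∣ MulOpposite.op x := by
  obtain ⟨t, rfl⟩ := h
  exact ⟨MulOpposite.op t, by rw [hz.comm, MulOpposite.op_mul]⟩

theorem opTower_dvd (hz : IsAdic z) {v : ℤ → B} (hv : ∀ i, z ∣ v i) (d : ℕ) (x : ℤ) :
    z ∣ (opTower v d x).1 ∧ z ∣ (opTower v d x).2 :=
  ⟨unop_dvd hz (tower_dvd (opGen_dvd hz hv) d _).1,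
    unop_dvd hz (tower_dvd (opGen_dvd hz hv) d _).2⟩

theorem mul_opTower (hz : IsAdic z) {v : ℤ → B} (hv : ∀ i, z ∣ v i) (d : ℕ) (x : ℤ) :
    (1 - ((opTower v d (x + 1)).1 + (opTower v d (x + 1)).2)) *
      ((opTower v (d + 1) x).1 + (opTower v (d + 1) x).2) = v x := by
  have h := congrArg MulOpposite.unop (tower_mul hz.op (opGen_dvd hz hv) d (-x))
  have e : -x - 1 = -(x + 1) := by ring
  rw [e] at h
  simpa [opTower, opGen] using h

theorem opTower_congr (hz : IsAdic z) {v : ℤ → B} (hv : ∀ i, z ∣ v i) {Q : B → B → Prop}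
    (hQ : IsCongr (MulOpposite.op z) fun x y : Bᵐᵒᵖ => Q x.unop y.unop) {ε : ℂ} (hε : ε * ε = 1)
    {d : ℕ} {x : ℤ} {f : ℤ → ℂ}
    (hf : ∀ i, x < i → f i = ε) (hvQ : ∀ i, x ≤ i → Q (v i) (f i • v i)) :
    Q (opTower v d x).1 ((ε * f x) • (opTower v d x).1) ∧
      Q (opTower v d x).2 (f x • (opTower v d x).2) := by
  have := tower_congr hz.op (opGen_dvd hz hv) hQ hε (d := d) (x := -x) (f := fun i => f (-i))
    (fun i hi => hf _ (by omega)) (fun i hi => hvQ _ (by omega))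
  simpa [opTower] using this

theorem IsAdic.isCongr_op_hom (hz : IsAdic z) (σ : B →+* B) :
    IsCongr (MulOpposite.op z) fun x y : Bᵐᵒᵖ => σ x.unop = y.unop where
  zero := map_zero σ
  add h h' := by rw [MulOpposite.unop_add, map_add, h, h', MulOpposite.unop_add]
  mul h h' := by rw [MulOpposite.unop_mul, map_mul, h, h', MulOpposite.unop_mul]
  geo {x x'} hx _ h := by
    have e : ∀ y : Bᵐᵒᵖ, (Volterra.geo y).unop = Volterra.geo y.unop := fun y => by
      rw [← MulOpposite.op_unop y, geo_op]; rfl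
    rw [e, e, hz.map_geo σ (unop_dvd hz hx), h]

theorem IsAdic.isCongr_op_intertwine (hz : IsAdic z) (w : B) :
    IsCongr (MulOpposite.op z) fun x y : Bᵐᵒᵖ => w * x.unop = y.unop * w := by
  have := hz.op.isCongr_intertwine (MulOpposite.op w)
  refine ⟨?_, ?_, ?_, ?_⟩
  · simp
  · intro x y x' y' h h'
    simp only [MulOpposite.unop_add, mul_add, add_mul, h, h']
  · intro x y x' y' h h'
    rw [MulOpposite.unop_mul, MulOpposite.unop_mul, ← mul_assoc, h', mul_assoc, h, mul_assoc]
  · intro x x' hx hx' h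
    have h1 : x * MulOpposite.op w = MulOpposite.op w * x' := MulOpposite.unop_injective h
    exact congrArg MulOpposite.unop (this.geo hx hx' h1)

/-- The parts of the two continued fractions which start at neighbouring sites are atoms. -/
theorem atomRel_tower (hz : IsAdic z) {v : ℤ → B} (hv : ∀ i, z ∣ v i) {η : ℂ}
    (r : TowerRel η v) (d d' : ℕ) (j : ℤ) :
    AtomRel ((-1) ^ (j + 1) * η) (tower v d j).1 (tower v d j).2
      (opTower v d' (j + 1)).2 (opTower v d' (j + 1)).1 := by
  -- A letter below `j` anticommutes with every letter of the high atoms, so only the parity of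
  -- their length is felt.
  have hlow : ∀ i, i < j → v i * (opTower v d' (j + 1)).1 = (opTower v d' (j + 1)).1 * v i ∧
      v i * (opTower v d' (j + 1)).2 = -((opTower v d' (j + 1)).2 * v i) := by
    intro i hi
    have := opTower_congr hz hv (Q := fun x y => v i * x = y * v i)
      (hz.isCongr_op_intertwine (v i)) (ε := -1) (by norm_num)
      (d := d') (x := j + 1) (f := fun _ => -1) (fun _ _ => rfl) (fun l hl => by
        rw [r.far i l (by omega), neg_one_smul, neg_mul])
    simpa using this
  -- Among the letters of a high atom only `j + 1` is adjacent to `j`, and it occurs exactly once,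
  -- at the end.
  have htop : v j * (opTower v d' (j + 1)).1 =
        ((-1) ^ (j + 1) * η) • ((opTower v d' (j + 1)).1 * v j) ∧
      v j * (opTower v d' (j + 1)).2 =
        (-((-1) ^ (j + 1) * η)) • ((opTower v d' (j + 1)).2 * v j) := by
    have := opTower_congr hz hv (Q := fun x y => v j * x = y * v j)
      (hz.isCongr_op_intertwine (v j)) (ε := -1) (by norm_num)
      (d := d') (x := j + 1) (f := fun i => if i = j + 1 then (-1) ^ j * η else -1)
      (fun i hi => if_neg hi.ne') (fun l hl => by
        split_ifs with h
        · rw [h, r.adjacent, smul_mul_assoc]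
        · rw [r.far j l (by omega), neg_one_smul, neg_mul])
    simp only [if_true, smul_mul_assoc] at this
    rw [neg_one_zpow_add_one]
    refine ⟨this.1.trans ?_, this.2.trans ?_⟩ <;> congr 1 <;> ring
  have hc := tower_congr hz hv (hz.isCongr_intertwine (opTower v d' (j + 1)).2) (ε := -1)
    (by norm_num) (d := d) (x := j) (f := fun i => if i = j then -((-1) ^ (j + 1) * η) else -1)
    (fun i hi => if_neg hi.ne) (fun l hl => by
        rw [mul_smul_comm]
        split_ifs with h
        · rw [h, htop.2]
        · rw [(hlow l (by omega)).2, neg_one_smul])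
  have hd := tower_congr hz hv (hz.isCongr_intertwine (opTower v d' (j + 1)).1) (ε := 1)
    (by norm_num) (d := d) (x := j) (f := fun i => if i = j then ((-1) ^ (j + 1) * η) else 1)
    (fun i hi => if_neg hi.ne) (fun l hl => by
        rw [mul_smul_comm]
        split_ifs with h
        · rw [h, htop.1]
        · rw [(hlow l (by omega)).1, one_smul])
  simp only [if_true, mul_smul_comm] at hc hd
  refine ⟨tower_even_mul_odd hz hv r d j, ?_, ?_, ?_, ?_, ?_⟩
  · rw [hc.1]; congr 1; ring
  · rw [hd.1, one_mul]
  · rw [hc.2, neg_smul]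
  · exact hd.2
  · have := congrArg MulOpposite.unop
      (tower_even_mul_odd hz.op (opGen_dvd hz hv) r.opGen d' (-(j + 1)))
    simp only [MulOpposite.unop_mul, MulOpposite.unop_smul] at this
    refine this.trans ?_
    congr 1
    have e : (-1 : ℂ) ^ (-(j + 1) + 1) = (-1) ^ j := by
      rw [show -(j + 1) + 1 = -j by ring, zpow_neg, ← inv_zpow]; norm_num
    rw [e, neg_one_zpow_add_one]
    ring

theorem AtomRel.op {k : ℂ} {a b c d : B} (r : AtomRel k a b c d) :
    AtomRel k (MulOpposite.op d) (MulOpposite.op c) (MulOpposite.op b) (MulOpposite.op a) where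
  ab := congrArg MulOpposite.op r.cd
  ac := congrArg MulOpposite.op r.bd
  ad := congrArg MulOpposite.op r.ad
  bc := congrArg MulOpposite.op r.bc
  bd := congrArg MulOpposite.op r.ac
  cd := congrArg MulOpposite.op r.ab

/-- The mirror image of `IsAdic.key`. -/
theorem IsAdic.key' (hz : IsAdic z) {k : ℂ} (hk : k ≠ 0) {a b c d : B}
    (ha : z ∣ a) (hb : z ∣ b) (hc : z ∣ c) (hd : z ∣ d) (r : AtomRel k a b c d) :
    (geo (k • d + (b - k • c) + a) + geo (k • d + -(b - k • c) + a)) -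
      (geo (a + (b + c) + d) + geo (a + -(b + c) + d)) =
    (d + c) * (k • geo (k • (a + (b + c) + d)) - geo (a + (b + c) + d)) +
      (d - c) * (k • geo (k • (a + -(b + c) + d)) - geo (a + -(b + c) + d)) := by
  have h := congrArg MulOpposite.unop
    (hz.op.key hk (op_dvd hz hd) (op_dvd hz hc) (op_dvd hz hb) (op_dvd hz ha) r.op)
  simp only [← MulOpposite.op_add, ← MulOpposite.op_sub, ← MulOpposite.op_neg,
    ← MulOpposite.op_smul, geo_op, ← MulOpposite.op_mul, MulOpposite.unop_op] at h
  rw [add_comm c b, show d + (b + c) + a = a + (b + c) + d by abel,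
    show d + -(b + c) + a = a + -(b + c) + d by abel] at h
  exact h

end Tower

/-! ### Generating series over the quantum algebra -/

theorem isAdic_X (R : Type*) [Ring R] : IsAdic (PowerSeries.X : PowerSeries R) where
  comm _ := PowerSeries.X_mul
  isUnit x := by
    have h : PowerSeries.constantCoeff (1 - PowerSeries.X * x) = ((1 : Rˣ) : R) := by simp
    exact ⟨⟨_, _, PowerSeries.mul_invOfUnit _ 1 h, PowerSeries.invOfUnit_mul _ 1 h⟩, rfl⟩

/-- The series `z u_i`. -/
noncomputable def pgen (ω : ℂ) (i : ℤ) : PowerSeries (QAlg ω) :=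
  PowerSeries.X * PowerSeries.C (u ω i)

theorem pgen_dvd (ω : ℂ) (i : ℤ) : PowerSeries.X ∣ pgen ω i := Dvd.intro _ rfl

theorem pgen_mul_pgen (ω : ℂ) (i j : ℤ) :
    pgen ω i * pgen ω j = PowerSeries.X * (PowerSeries.X * PowerSeries.C (u ω i * u ω j)) := by
  unfold pgen
  rw [mul_assoc, ← mul_assoc _ PowerSeries.X, ← PowerSeries.X_mul, mul_assoc, map_mul]

theorem C_smul' {ω : ℂ} (c : ℂ) (a : QAlg ω) :
    (PowerSeries.C (c • a) : PowerSeries (QAlg ω)) = c • PowerSeries.C a := by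
  ext n
  rw [PowerSeries.coeff_smul, PowerSeries.coeff_C, PowerSeries.coeff_C]
  split_ifs <;> simp

theorem towerRel_pgen (ω : ℂ) : TowerRel ω (pgen ω) where
  adjacent i := by
    rw [pgen_mul_pgen, pgen_mul_pgen, u_adjacent, C_smul', mul_smul_comm, mul_smul_comm]
  far i j h := by
    rw [pgen_mul_pgen, pgen_mul_pgen,
      u_far ω i j (by rw [abs_sub_comm, abs_of_pos] <;> omega), map_neg, mul_neg, mul_neg]

/-- The rescaling `u_n ↦ f_n u_n` of series. -/
noncomputable def pscale (ω : ℂ) (f : ℤ → ℂ) : PowerSeries (QAlg ω) →+* PowerSeries (QAlg ω) :=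
  PowerSeries.map (scale ω f).toRingHom

theorem coeff_pscale (ω : ℂ) (f : ℤ → ℂ) (n : ℕ) (x : PowerSeries (QAlg ω)) :
    PowerSeries.coeff n (pscale ω f x) = scale ω f (PowerSeries.coeff n x) :=
  PowerSeries.coeff_map _ _ _

theorem pscale_smul (ω : ℂ) (f : ℤ → ℂ) (c : ℂ) (x : PowerSeries (QAlg ω)) :
    pscale ω f (c • x) = c • pscale ω f x := by
  ext n
  rw [coeff_pscale, PowerSeries.coeff_smul, PowerSeries.coeff_smul, coeff_pscale, map_smul]

theorem pscale_pgen (ω : ℂ) (f : ℤ → ℂ) (i : ℤ) : pscale ω f (pgen ω i) = f i • pgen ω i := by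
  unfold pgen pscale
  rw [map_mul, PowerSeries.map_X, PowerSeries.map_C]
  change PowerSeries.X * PowerSeries.C (scale ω f (u ω i)) = _
  rw [scale_u, C_smul', mul_smul_comm]

/-- The coefficient of `z^n` times the decreasing word of content `s`. -/
noncomputable def pcf (ω : ℂ) (n : ℕ) (s : Multiset ℤ) : PowerSeries (QAlg ω) →+ ℂ :=
  (cf ω s).toAddMonoidHom.comp (PowerSeries.coeff n).toAddMonoidHom

theorem pcf_apply (ω : ℂ) (n : ℕ) (s : Multiset ℤ) (x : PowerSeries (QAlg ω)) :
    pcf ω n s x = cf ω s (PowerSeries.coeff n x) := rfl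

theorem pcf_pscale (ω : ℂ) (n : ℕ) (s : Multiset ℤ) (f : ℤ → ℂ) (x : PowerSeries (QAlg ω)) :
    pcf ω n s (pscale ω f x) = (s.map f).prod * pcf ω n s x := by
  rw [pcf_apply, coeff_pscale, cf_scale, pcf_apply]

/-- The weights of the rescaling by which the current at the site `j` is obtained from the
Hamiltonian density. -/
noncomputable def theta (ω : ℂ) (j i : ℤ) : ℂ :=
  if i < j then -1 else if i = j then (-1) ^ j * ω else 1

/-- The eigenvalue of the rescaling `theta` on words of content `s`. -/
noncomputable def eig (ω : ℂ) (j : ℤ) (s : Multiset ℤ) : ℂ := (s.map (theta ω j)).prod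

/-- The series of the sequences of low and high atoms at the sites `j` and `j + 1`. -/
noncomputable def atomSeries (ω : ℂ) (d d' : ℕ) (j : ℤ) : PowerSeries (QAlg ω) :=
  geo ((tower (pgen ω) d j).1 + ((tower (pgen ω) d j).2 + (opTower (pgen ω) d' (j + 1)).2) +
    (opTower (pgen ω) d' (j + 1)).1)

theorem tower_pscale (ω : ℂ) {ε : ℂ} (hε : ε * ε = 1) (d : ℕ) (x : ℤ) {f : ℤ → ℂ}
    (hf : ∀ i, i < x → f i = ε) :
    pscale ω f (tower (pgen ω) d x).1 = (ε * f x) • (tower (pgen ω) d x).1 ∧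
      pscale ω f (tower (pgen ω) d x).2 = f x • (tower (pgen ω) d x).2 :=
  tower_congr (isAdic_X _) (pgen_dvd ω) ((isAdic_X _).isCongr_hom (pscale ω f)) hε hf
    fun i _ => pscale_pgen ω f i

theorem opTower_pscale (ω : ℂ) {ε : ℂ} (hε : ε * ε = 1) (d : ℕ) (x : ℤ) {f : ℤ → ℂ}
    (hf : ∀ i, x < i → f i = ε) :
    pscale ω f (opTower (pgen ω) d x).1 = (ε * f x) • (opTower (pgen ω) d x).1 ∧
      pscale ω f (opTower (pgen ω) d x).2 = f x • (opTower (pgen ω) d x).2 :=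
  opTower_congr (isAdic_X _) (pgen_dvd ω) (Q := fun x y => pscale ω f x = y)
    ((isAdic_X _).isCongr_op_hom (pscale ω f)) hε hf fun i _ => pscale_pgen ω f i

/-- The identities `key` and `key'` read at one content. Write `a, b` for the even and odd low atoms
and `c, e` for the odd and even high ones. The rescaling `θ_j` multiplies `a, b, c, e` by `k, -k, 1,
1`, and `θ_{j+1}` multiplies them by `1, -1, k, k`; together they multiply every atom by `k`.
Negating all letters changes the signs of `b` and `c`. Thus each geometric series in the identities
is a rescaling of the single series `W`. -/
theorem eig_relations {ω : ℂ} (hω : ω ≠ 0) (d d' : ℕ) (j : ℤ) (n : ℕ) {s : Multiset ℤ}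
    (hs : Even (Multiset.card s)) :
    (eig ω j s - 1) * pcf ω n s (atomSeries ω d d' j) =
      (eig ω j s * eig ω (j + 1) s - 1) * pcf ω n s (atomSeries ω d d' j *
        ((tower (pgen ω) d j).1 + (tower (pgen ω) d j).2)) ∧
    (eig ω (j + 1) s - 1) * pcf ω n s (atomSeries ω d d' j) =
      (eig ω j s * eig ω (j + 1) s - 1) * pcf ω n s (((opTower (pgen ω) d' (j + 1)).1 +
        (opTower (pgen ω) d' (j + 1)).2) * atomSeries ω d d' j) := by
  have hz := isAdic_X (QAlg ω)
  have hT := tower_dvd (z := PowerSeries.X) (pgen_dvd ω) d j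
  have hR := opTower_dvd hz (pgen_dvd ω) d' (j + 1)
  have r := atomRel_tower hz (pgen_dvd ω) (towerRel_pgen ω) d d' j
  have hk : (-1) ^ (j + 1) * ω ≠ 0 := mul_ne_zero (neg_one_zpow_ne_zero _) hω
  have t1 := tower_pscale ω (ε := -1) (by norm_num) d j (f := theta ω j) (fun i hi => if_pos hi)
  have t2 := tower_pscale ω (ε := -1) (by norm_num) d j (f := theta ω (j + 1))
    (fun i hi => if_pos (by omega))
  have t3 := tower_pscale ω (ε := -1) (by norm_num) d j (f := fun _ => -1) (fun _ _ => rfl)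
  have s1 := opTower_pscale ω (ε := 1) (by norm_num) d' (j + 1) (f := theta ω j)
    (fun i hi => by rw [theta, if_neg (by omega), if_neg (by omega)])
  have s2 := opTower_pscale ω (ε := 1) (by norm_num) d' (j + 1) (f := theta ω (j + 1))
    (fun i hi => by rw [theta, if_neg (by omega), if_neg (by omega)])
  have s3 := opTower_pscale ω (ε := -1) (by norm_num) d' (j + 1) (f := fun _ => -1)
    (fun _ _ => rfl)
  have v1 : theta ω j j = -((-1) ^ (j + 1) * ω) := by
    rw [theta, if_neg (by omega), if_pos rfl, neg_one_zpow_add_one]; ring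
  have v2 : theta ω (j + 1) j = -1 := if_pos (by omega)
  have v3 : theta ω j (j + 1) = 1 := by rw [theta, if_neg (by omega), if_neg (by omega)]
  have v4 : theta ω (j + 1) (j + 1) = (-1) ^ (j + 1) * ω := by
    rw [theta, if_neg (by omega), if_pos rfl]
  rw [v1] at t1
  rw [v2] at t2
  rw [v3] at s1
  rw [v4] at s2
  simp only [neg_mul_neg, one_mul, one_smul, neg_smul, mul_one] at t1 t2 t3 s1 s2 s3
  unfold atomSeries
  have key := hz.key hk hT.1 hT.2 hR.2 hR.1 r
  have key' := hz.key' hk hT.1 hT.2 hR.2 hR.1 r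
  set k := (-1) ^ (j + 1) * ω
  set a := (tower (pgen ω) d j).1
  set b := (tower (pgen ω) d j).2
  set c := (opTower (pgen ω) d' (j + 1)).2
  set e := (opTower (pgen ω) d' (j + 1)).1
  have hs : PowerSeries.X ∣ a + (b + c) + e :=
    dvd_add (dvd_add hT.1 (dvd_add hT.2 hR.2)) hR.1
  have hs' : PowerSeries.X ∣ a + -(b + c) + e :=
    dvd_add (dvd_add hT.1 ((dvd_neg).2 (dvd_add hT.2 hR.2))) hR.1
  set W := geo (a + (b + c) + e) with hW
  have hbar : geo (a + -(b + c) + e) = pscale ω (fun _ => -1) W := by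
    rw [hW, hz.map_geo _ hs]
    simp only [map_add, t3, s3]
    congr 1; abel
  have hj : geo (k • a + (c - k • b) + e) = pscale ω (theta ω j) W := by
    rw [hW, hz.map_geo _ hs]
    simp only [map_add, t1, s1]
    congr 1; abel
  have hj' : geo (k • a + -(c - k • b) + e) =
      pscale ω (theta ω j) (pscale ω (fun _ => -1) W) := by
    rw [← hbar, hz.map_geo _ hs']
    simp only [map_add, map_neg, t1, s1]
    congr 1; abel
  have hi : geo (k • e + (b - k • c) + a) =
      pscale ω (theta ω (j + 1)) (pscale ω (fun _ => -1) W) := by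
    rw [← hbar, hz.map_geo _ hs']
    simp only [map_add, map_neg, t2, s2]
    congr 1; abel
  have hi' : geo (k • e + -(b - k • c) + a) = pscale ω (theta ω (j + 1)) W := by
    rw [hW, hz.map_geo _ hs]
    simp only [map_add, t2, s2]
    congr 1; abel
  have hO : geo (k • (a + (b + c) + e)) = pscale ω (theta ω j) (pscale ω (theta ω (j + 1)) W) := by
    rw [hW, hz.map_geo _ hs, hz.map_geo]
    · simp only [map_add, map_neg, t2, s2, t1, s1, pscale_smul, smul_add]
      congr 1; abel
    · simp only [map_add, t2, s2]
      exact dvd_add (dvd_add hT.1 (dvd_add ((dvd_neg).2 hT.2) (IsAdic.dvd_smul _ hR.2)))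
        (IsAdic.dvd_smul _ hR.1)
  have hO' : geo (k • (a + -(b + c) + e)) =
      pscale ω (theta ω j) (pscale ω (theta ω (j + 1)) (pscale ω (fun _ => -1) W)) := by
    rw [← hbar, hz.map_geo _ hs', hz.map_geo]
    · simp only [map_add, map_neg, t2, s2, t1, s1, pscale_smul, smul_add, smul_neg]
      congr 1; abel
    · simp only [map_add, map_neg, t2, s2]
      exact dvd_add (dvd_add hT.1 ((dvd_neg).2
        (dvd_add ((dvd_neg).2 hT.2) (IsAdic.dvd_smul _ hR.2)))) (IsAdic.dvd_smul _ hR.1)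
  have ab : a - b = pscale ω (fun _ => -1) (a + b) := by
    simp only [map_add, t3]; abel
  have ec : e - c = pscale ω (fun _ => -1) (e + c) := by
    simp only [map_add, s3]; abel
  have kab : ∀ x, k • x * (a + b) = x * pscale ω (theta ω j) (pscale ω (theta ω (j + 1)) (a + b)) :=
    fun x => by
      simp only [map_add, map_neg, t2, t1, smul_mul_assoc]
      rw [neg_neg, ← smul_add, mul_smul_comm]
  have kab' : ∀ x, k • x * (a - b) = x * pscale ω (theta ω j) (pscale ω (theta ω (j + 1))
      (pscale ω (fun _ => -1) (a + b))) := fun x => by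
      rw [← ab]
      simp only [map_sub, map_neg, t2, t1, smul_mul_assoc]
      rw [neg_neg, ← smul_sub, mul_smul_comm]
  have kec : ∀ x, (e + c) * k • x =
      pscale ω (theta ω j) (pscale ω (theta ω (j + 1)) (e + c)) * x := fun x => by
      simp only [map_add, s2, s1, pscale_smul]
      rw [← smul_add, mul_smul_comm, smul_mul_assoc]
  have kec' : ∀ x, (e - c) * k • x = pscale ω (theta ω j) (pscale ω (theta ω (j + 1))
      (pscale ω (fun _ => -1) (e + c))) * x := fun x => by
      rw [← ec]
      simp only [map_sub, s2, s1, pscale_smul]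
      rw [← smul_sub, mul_smul_comm, smul_mul_assoc]
  have hm : (s.map fun _ => (-1 : ℂ)).prod = 1 := by
    rw [Multiset.map_const', Multiset.prod_replicate]
    exact ‹Even (Multiset.card s)›.neg_one_pow
  rw [hj, hj', hbar, hO, hO', sub_mul, sub_mul, kab, kab', ab, ← map_mul, ← map_mul,
    ← map_mul, ← map_mul, ← map_mul] at key
  rw [hi, hi', hbar, hO, hO', mul_sub, mul_sub, kec, kec', ec, ← map_mul, ← map_mul,
    ← map_mul, ← map_mul, ← map_mul] at key'
  have k1 := congrArg (pcf ω n s) key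
  have k2 := congrArg (pcf ω n s) key'
  simp only [map_add, map_sub, pcf_pscale, hm, one_mul] at k1 k2
  unfold eig
  -- On even contents the negated series has the same coefficients as the original one, so every
  -- term occurs twice.
  exact ⟨by linear_combination (1 / 2) * k1, by linear_combination (1 / 2) * k2⟩

/-! ### Slowly descending words -/

/-- The condition on neighbouring letters of an admissible word. -/
def Slow (p q : ℤ) : Prop := p ≤ q + 1

/-- The slowly descending words of length `n` with letters in `[a, b]`, whose first letter may
follow `x` and whose last letter is at most `j`. -/
noncomputable def slowWords (a b j : ℤ) : ℕ → ℤ → Finset (List ℤ)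
  | 0, x => if x ≤ j then {[]} else ∅
  | n + 1, x => (Finset.Icc (max a (x - 1)) b).biUnion fun y =>
      (slowWords a b j n y).image (List.cons y)

theorem mem_slowWords {a b j : ℤ} {n : ℕ} {x : ℤ} {l : List ℤ} :
    l ∈ slowWords a b j n x ↔ l.length = n ∧ (∀ y ∈ l, a ≤ y ∧ y ≤ b) ∧
      List.IsChain Slow (x :: (l ++ [j - 1])) := by
  induction n generalizing x l with
  | zero =>
    rw [slowWords]
    constructor
    · intro h
      split_ifs at h with hx
      · rw [Finset.mem_singleton] at h
        subst h
        simp [Slow, hx]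
      · simp at h
    · rintro ⟨h1, -, h2⟩
      rw [List.length_eq_zero_iff] at h1
      subst h1
      rw [if_pos (by simpa [Slow] using h2), Finset.mem_singleton]
  | succ n ih =>
    rw [slowWords, Finset.mem_biUnion]
    constructor
    · rintro ⟨y, hy, h⟩
      obtain ⟨l', hl', rfl⟩ := Finset.mem_image.1 h
      obtain ⟨h1, h2, h3⟩ := ih.1 hl'
      rw [Finset.mem_Icc, max_le_iff] at hy
      refine ⟨by simp [h1], ?_, ?_⟩
      · intro w hw
        rcases List.mem_cons.1 hw with rfl | hw
        · exact ⟨hy.1.1, hy.2⟩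
        · exact h2 w hw
      · rw [List.cons_append, List.isChain_cons_cons]
        exact ⟨by unfold Slow; omega, h3⟩
    · rintro ⟨h1, h2, h3⟩
      cases l with
      | nil => simp at h1
      | cons y l' =>
        rw [List.cons_append, List.isChain_cons_cons] at h3
        have hy := h2 y (by simp)
        refine ⟨y, ?_, Finset.mem_image.2 ⟨l', ih.2 ⟨by simpa using h1,
          fun w hw => h2 w (by simp [hw]), h3.2⟩, rfl⟩⟩
        have := h3.1
        unfold Slow at this
        rw [Finset.mem_Icc, max_le_iff]
        omega

theorem sum_slowWords (ω : ℂ) (a b j : ℤ) (n : ℕ) (x : ℤ) :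
    ∑ l ∈ slowWords a b j (n + 1) x, word ω l =
      ∑ y ∈ Finset.Icc (max a (x - 1)) b, u ω y * ∑ l ∈ slowWords a b j n y, word ω l := by
  rw [slowWords, Finset.sum_biUnion]
  · refine Finset.sum_congr rfl fun y _ => ?_
    rw [Finset.sum_image (fun _ _ _ _ h => (List.cons.inj h).2), Finset.mul_sum]
    simp only [word_cons]
  · intro y _ y' _ hne
    rw [Function.onFun, Finset.disjoint_left]
    intro l hl hl'
    obtain ⟨l1, -, rfl⟩ := Finset.mem_image.1 hl
    obtain ⟨l2, -, h⟩ := Finset.mem_image.1 hl'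
    exact hne (List.cons.inj h).1.symm

/-- The generating series of the slowly descending words which start at least at the height `x`
and end at most at the height `j`. -/
noncomputable def slowSeries (ω : ℂ) (a b j x : ℤ) : PowerSeries (QAlg ω) :=
  PowerSeries.mk fun n => ∑ l ∈ slowWords a b j n (x + 1), word ω l

theorem coeff_zero_slowSeries (ω : ℂ) (a b j x : ℤ) :
    PowerSeries.coeff 0 (slowSeries ω a b j x) = if x + 1 ≤ j then 1 else 0 := by
  rw [slowSeries, PowerSeries.coeff_mk, slowWords]
  split_ifs <;> simp

theorem coeff_succ_slowSeries (ω : ℂ) (a b j x : ℤ) (n : ℕ) :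
    PowerSeries.coeff (n + 1) (slowSeries ω a b j x) =
      ∑ y ∈ Finset.Icc (max a x) b, u ω y * ∑ l ∈ slowWords a b j n y, word ω l := by
  rw [slowSeries, PowerSeries.coeff_mk, sum_slowWords, add_sub_cancel_right]

/-- The first letter is either `x` or larger, and after `x` the word may continue from `x - 1`
upwards. The indicator accounts for the empty word, which is counted for `x < j` only. -/
theorem slowSeries_sub (ω : ℂ) {a b j x : ℤ} (hax : a ≤ x) (hxb : x ≤ b) :
    slowSeries ω a b j x = slowSeries ω a b j (x + 1) + (if x + 1 = j then 1 else 0) +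
      pgen ω x * slowSeries ω a b j (x - 1) := by
  ext n
  cases n with
  | zero =>
    rw [map_add, map_add, coeff_zero_slowSeries, coeff_zero_slowSeries, pgen, mul_assoc,
      PowerSeries.coeff_zero_X_mul, add_zero]
    by_cases h : x + 1 = j
    · rw [if_pos h.le, if_neg (by omega), if_pos h]; simp
    · rw [if_neg h]
      by_cases h' : x + 1 ≤ j
      · rw [if_pos h', if_pos (by omega)]; simp
      · rw [if_neg h', if_neg (by omega)]; simp
  | succ n =>
    have h0 : PowerSeries.coeff (n + 1)
        ((if x + 1 = j then 1 else 0 : PowerSeries (QAlg ω))) = 0 := by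
      split_ifs
      · rw [PowerSeries.coeff_one, if_neg (by omega)]
      · simp
    have hI : Finset.Icc (max a x) b = insert x (Finset.Icc (max a (x + 1)) b) := by
      ext y
      simp only [Finset.mem_Icc, Finset.mem_insert, max_le_iff]
      omega
    rw [map_add, map_add, coeff_succ_slowSeries, coeff_succ_slowSeries, h0, add_zero, pgen,
      mul_assoc, PowerSeries.coeff_succ_X_mul, PowerSeries.coeff_C_mul, hI, Finset.sum_insert,
      add_comm, slowSeries, PowerSeries.coeff_mk, sub_add_cancel]
    simp

theorem slowSeries_sub_bot (ω : ℂ) (a b j : ℤ) :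
    slowSeries ω a b j (a - 1) = slowSeries ω a b j a + (if a = j then 1 else 0) := by
  ext n
  cases n with
  | zero =>
    rw [map_add, coeff_zero_slowSeries, coeff_zero_slowSeries, sub_add_cancel]
    by_cases h : a = j
    · rw [if_pos h.le, if_neg (by omega), if_pos h]; simp
    · rw [if_neg h]
      by_cases h' : a ≤ j
      · rw [if_pos h', if_pos (by omega)]; simp
      · rw [if_neg h', if_neg (by omega)]; simp
  | succ n =>
    have h0 : PowerSeries.coeff (n + 1)
        ((if a = j then 1 else 0 : PowerSeries (QAlg ω))) = 0 := by
      split_ifs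
      · rw [PowerSeries.coeff_one, if_neg (by omega)]
      · simp
    rw [map_add, coeff_succ_slowSeries, coeff_succ_slowSeries, h0, add_zero, max_self,
      max_eq_left (by omega : a - 1 ≤ a)]

theorem slowSeries_top (ω : ℂ) {a b j : ℤ} (h : j ≤ b + 1) :
    slowSeries ω a b j (b + 1) = 0 := by
  ext n
  cases n with
  | zero => rw [coeff_zero_slowSeries, if_neg (by omega)]; simp
  | succ n =>
    rw [coeff_succ_slowSeries, Finset.Icc_eq_empty (by rw [max_le_iff]; omega)]
    simp

/-! ### Slowly descending words as products of low and high atoms. -/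

/-- The continued fraction `T_x = v_x (1 - T_{x-1})⁻¹`. -/
noncomputable def lowSeries (ω : ℂ) (d : ℕ) (x : ℤ) : PowerSeries (QAlg ω) :=
  (tower (pgen ω) d x).1 + (tower (pgen ω) d x).2

/-- The continued fraction `R_x = (1 - R_{x+1})⁻¹ v_x`. -/
noncomputable def highSeries (ω : ℂ) (d : ℕ) (x : ℤ) : PowerSeries (QAlg ω) :=
  (opTower (pgen ω) d x).1 + (opTower (pgen ω) d x).2

theorem lowSeries_dvd (ω : ℂ) (d : ℕ) (x : ℤ) : PowerSeries.X ∣ lowSeries ω d x :=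
  dvd_add (tower_dvd (pgen_dvd ω) d x).1 (tower_dvd (pgen_dvd ω) d x).2

theorem highSeries_dvd (ω : ℂ) (d : ℕ) (x : ℤ) : PowerSeries.X ∣ highSeries ω d x :=
  dvd_add (opTower_dvd (isAdic_X _) (pgen_dvd ω) d x).1
    (opTower_dvd (isAdic_X _) (pgen_dvd ω) d x).2

theorem lowSeries_mul (ω : ℂ) (d : ℕ) (x : ℤ) :
    lowSeries ω (d + 1) x * (1 - lowSeries ω d (x - 1)) = pgen ω x :=
  tower_mul (isAdic_X _) (pgen_dvd ω) d x

theorem mul_highSeries (ω : ℂ) (d : ℕ) (x : ℤ) :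
    (1 - highSeries ω d (x + 1)) * highSeries ω (d + 1) x = pgen ω x :=
  mul_opTower (isAdic_X _) (pgen_dvd ω) d x

theorem lowSeries_zero (ω : ℂ) (x : ℤ) : lowSeries ω 0 x = 0 := by
  simp [lowSeries, tower]

theorem highSeries_zero (ω : ℂ) (x : ℤ) : highSeries ω 0 x = 0 := by
  simp [highSeries, opTower, tower]

theorem atomSeries_eq (ω : ℂ) (d d' : ℕ) (j : ℤ) :
    atomSeries ω d d' j = geo (lowSeries ω d j + highSeries ω d' (j + 1)) := by
  unfold atomSeries lowSeries highSeries
  congr 1; abel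

/-- Eliminating the starting heights from the bottom of the window upwards: each new height adds one
level to the continued fraction. `slowSeries_high` does the same from the top downwards, and the two
meet at `x = j` in `slowSeries_mid`. -/
theorem slowSeries_low (ω : ℂ) {a b j : ℤ} (hjb : j ≤ b) (d : ℕ) (hd : a + d ≤ j) :
    (1 - lowSeries ω d (a + d - 1)) * slowSeries ω a b j (a + d - 1) =
      slowSeries ω a b j (a + d) + (if a + d = j then 1 else 0) := by
  induction d with
  | zero => simpa [lowSeries_zero] using slowSeries_sub_bot ω a b j
  | succ d ih =>
    have e : a + ((d + 1 : ℕ) : ℤ) = a + d + 1 := by push_cast; ring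
    rw [e] at hd ⊢
    have ih := ih (by omega)
    rw [if_neg (by omega), add_zero] at ih
    rw [add_sub_cancel_right, sub_mul, one_mul]
    nth_rw 1 [slowSeries_sub ω (by omega) (by omega)]
    rw [← lowSeries_mul ω d, mul_assoc, ih]
    abel

theorem slowSeries_high (ω : ℂ) {a b j : ℤ} (haj : a ≤ j) (d : ℕ) (hd : j ≤ b - d) :
    slowSeries ω a b j (b + 1 - d) =
      highSeries ω d (b + 1 - d) * slowSeries ω a b j (b - d) := by
  induction d with
  | zero =>
    simp only [Nat.cast_zero, sub_zero] at hd ⊢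
    rw [slowSeries_top ω (by omega), highSeries_zero, zero_mul]
  | succ d ih =>
    have e : b + 1 - ((d + 1 : ℕ) : ℤ) = b - d := by push_cast; ring
    have e' : b - ((d + 1 : ℕ) : ℤ) = b - d - 1 := by push_cast; ring
    rw [e'] at hd
    rw [e, e']
    have ih := ih (by omega)
    have h1 := slowSeries_sub ω (a := a) (b := b) (j := j) (x := b - d) (by omega) (by omega)
    rw [if_neg (by omega), add_zero, show b - (d : ℤ) + 1 = b + 1 - d by ring, ih,
      ← mul_highSeries ω d, show b - (d : ℤ) + 1 = b + 1 - d by ring] at h1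
    refine ((isAdic_X _).unit (highSeries_dvd ω d (b + 1 - d))).mul_left_cancel ?_
    rw [sub_mul, one_mul, sub_eq_iff_eq_add, ← mul_assoc, add_comm]
    exact h1

theorem slowSeries_mid (ω : ℂ) (d d' : ℕ) (j : ℤ) :
    (1 - (lowSeries ω (d + 1) j + highSeries ω d' (j + 1))) *
      slowSeries ω (j - d) (j + d') j j = lowSeries ω (d + 1) j := by
  have h1 := slowSeries_sub ω (a := j - d) (b := j + d') (j := j) (x := j) (by omega) (by omega)
  have h2 := slowSeries_low ω (a := j - d) (b := j + d') (j := j) (by omega) d (by omega)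
  have h3 := slowSeries_high ω (a := j - d) (b := j + d') (j := j) (by omega) d' (by omega)
  rw [sub_add_cancel, if_pos rfl] at h2
  rw [show j + (d' : ℤ) + 1 - d' = j + 1 by ring, add_sub_cancel_right] at h3
  rw [if_neg (by omega), add_zero, ← lowSeries_mul ω d, mul_assoc, h2, h3] at h1
  rw [sub_mul, one_mul, add_mul, sub_eq_iff_eq_add]
  nth_rw 1 [h1]
  rw [mul_add, mul_one]
  abel

/-- A low atom starts with `j` and stays below it afterwards; a high atom ends with `j + 1` and
stays above it before. The words counted here are the sequences of atoms whose last atom is low. -/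
theorem slowSeries_eq (ω : ℂ) (d d' : ℕ) (j : ℤ) :
    slowSeries ω (j - d) (j + d') j j =
      atomSeries ω (d + 1) d' j * lowSeries ω (d + 1) j := by
  have hz := isAdic_X (QAlg ω)
  have hd : PowerSeries.X ∣ lowSeries ω (d + 1) j + highSeries ω d' (j + 1) :=
    dvd_add (lowSeries_dvd ω _ _) (highSeries_dvd ω _ _)
  refine (hz.unit hd).mul_left_cancel ?_
  rw [slowSeries_mid, atomSeries_eq, ← mul_assoc, hz.mul_geo hd, one_mul]

/-- In terms of the same atoms, the words at the site `j + 1` are the sequences whose first atom is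
high. This is derived from the cut above `j + 1`, with series `T'`, `R'`, through `T' (1 - T) =
v_{j+1} = (1 - R') R`. -/
theorem slowSeries_succ_eq (ω : ℂ) (d d' : ℕ) (j : ℤ) :
    slowSeries ω (j - d) (j + 1 + d') (j + 1) (j + 1) =
      highSeries ω (d' + 1) (j + 1) * atomSeries ω (d + 1) (d' + 1) j := by
  have hz := isAdic_X (QAlg ω)
  have hd : PowerSeries.X ∣ lowSeries ω (d + 1) j + highSeries ω (d' + 1) (j + 1) :=
    dvd_add (lowSeries_dvd ω _ _) (highSeries_dvd ω _ _)
  have hd2 : PowerSeries.X ∣ lowSeries ω (d + 1 + 1) (j + 1) + highSeries ω d' (j + 1 + 1) :=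
    dvd_add (lowSeries_dvd ω _ _) (highSeries_dvd ω _ _)
  have h := slowSeries_mid ω (d + 1) d' (j + 1)
  rw [show j + 1 - ((d + 1 : ℕ) : ℤ) = j - d by push_cast; ring] at h
  refine (hz.unit hd2).mul_left_cancel (h.trans ?_)
  have h1 := mul_highSeries ω d' (j + 1)
  have h2 := lowSeries_mul ω (d + 1) (j + 1)
  rw [add_sub_cancel_right] at h2
  rw [atomSeries_eq]
  set T := lowSeries ω (d + 1) j
  set R := highSeries ω (d' + 1) (j + 1)
  set T' := lowSeries ω (d + 1 + 1) (j + 1)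
  set R' := highSeries ω d' (j + 1 + 1)
  have e : (1 - (T' + R')) * (R * geo (T + R)) =
      T' * ((1 - (T + R)) * geo (T + R)) := by
    have e1 : (1 - (T' + R')) * R = T' * (1 - (T + R)) := by
      have : (1 - (T' + R')) * R = (1 - R') * R - T' * R := by
        rw [← sub_mul]; congr 1; abel
      rw [this, h1, ← h2, ← mul_sub]; congr 1; abel
    rw [← mul_assoc, e1, mul_assoc]
  rw [e, hz.mul_geo hd, mul_one]

/-! ### The admissible words -/

/-- The words of length `m` in the `j`-th shift of `X^{(m)}`. -/
noncomputable def adm (m : ℕ) (j : ℤ) : Finset (List ℤ) := slowWords (j - m) (j + m) j m (j + 1)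

theorem le_of_isChain_slow {x : ℤ} {l : List ℤ} (h : List.IsChain Slow (x :: l)) :
    ∀ y ∈ l, x - l.length ≤ y := by
  induction l generalizing x with
  | nil => simp
  | cons w l ih =>
    rw [List.isChain_cons_cons] at h
    have h1 := h.1
    unfold Slow at h1
    intro y hy
    rw [List.length_cons]
    push_cast
    rcases List.mem_cons.1 hy with rfl | hy
    · omega
    · have := ih h.2 y hy
      omega

theorem le_add_of_isChain_slow {w : ℤ} {l : List ℤ} (h : List.IsChain Slow (l ++ [w])) :
    ∀ y ∈ l, y ≤ w + l.length := by
  induction l with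
  | nil => simp
  | cons x l ih =>
    rw [List.cons_append] at h
    have ih := ih h.of_cons
    intro y hy
    rw [List.length_cons]
    push_cast
    rcases List.mem_cons.1 hy with rfl | hy
    · cases l with
      | nil =>
        rw [List.nil_append, List.isChain_cons_cons] at h
        have := h.1
        unfold Slow at this
        simp; omega
      | cons v l =>
        rw [List.cons_append, List.isChain_cons_cons] at h
        have h1 := h.1
        unfold Slow at h1
        have := ih v (by simp)
        omega
    · have := ih y hy
      omega

theorem bounds_of_isChain_slow {j : ℤ} {l : List ℤ}
    (h : List.IsChain Slow ((j + 1) :: (l ++ [j - 1]))) :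
    ∀ y ∈ l, j - l.length ≤ y ∧ y ≤ j + l.length := by
  intro y hy
  have h1 := le_of_isChain_slow h y (by simp [hy])
  have h2 := le_add_of_isChain_slow h.of_cons y hy
  rw [List.length_append, List.length_singleton] at h1
  push_cast at h1
  omega

theorem mem_adm {m : ℕ} {j : ℤ} {l : List ℤ} :
    l ∈ adm m j ↔ l.length = m ∧ List.IsChain Slow ((j + 1) :: (l ++ [j - 1])) := by
  rw [adm, mem_slowWords]
  refine ⟨fun h => ⟨h.1, h.2.2⟩, fun h => ⟨h.1, fun y hy => ?_, h.2⟩⟩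
  have := bounds_of_isChain_slow h.2 y hy
  rwa [h.1] at this

theorem slowWords_eq_adm {m : ℕ} {a b j : ℤ} (ha : a ≤ j - m) (hb : j + m ≤ b) :
    slowWords a b j m (j + 1) = adm m j := by
  ext l
  rw [mem_adm, mem_slowWords]
  refine ⟨fun h => ⟨h.1, h.2.2⟩, fun h => ⟨h.1, fun y hy => ?_, h.2⟩⟩
  have := bounds_of_isChain_slow h.2 y hy
  rw [h.1] at this
  omega

/-- The current: the image of the `j`-th shift of `X^{(m)}` in the quantum algebra. -/
noncomputable def current (ω : ℂ) (m : ℕ) (j : ℤ) : QAlg ω := ∑ l ∈ adm m j, word ω l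

theorem coeff_slowSeries (ω : ℂ) {m : ℕ} {a b j : ℤ} (ha : a ≤ j - m) (hb : j + m ≤ b) :
    PowerSeries.coeff m (slowSeries ω a b j j) = current ω m j := by
  rw [slowSeries, PowerSeries.coeff_mk, slowWords_eq_adm ha hb, current]

/-- The witness is the coefficient of the series of all sequences of atoms. Depth `m + 1` suffices
because admissible words of length `m` stay within distance `m` of their site. -/
theorem exists_potential {ω : ℂ} (hω : ω ≠ 0) (m : ℕ) (j : ℤ) {s : Multiset ℤ}
    (hs : Even (Multiset.card s)) :
    ∃ w : ℂ, (eig ω j s - 1) * w =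
        (eig ω j s * eig ω (j + 1) s - 1) * cf ω s (current ω m j) ∧
      (eig ω (j + 1) s - 1) * w =
        (eig ω j s * eig ω (j + 1) s - 1) * cf ω s (current ω m (j + 1)) := by
  have h := eig_relations hω (m + 1) (m + 1) j m hs
  have h1 := slowSeries_eq ω m (m + 1) j
  have h2 := slowSeries_succ_eq ω m m j
  refine ⟨_, h.1.trans ?_, h.2.trans ?_⟩
  · rw [show (tower (pgen ω) (m + 1) j).1 + (tower (pgen ω) (m + 1) j).2 =
      lowSeries ω (m + 1) j from rfl, ← h1, pcf_apply, coeff_slowSeries] <;> push_cast <;> omega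
  · rw [show (opTower (pgen ω) (m + 1) (j + 1)).1 + (opTower (pgen ω) (m + 1) (j + 1)).2 =
      highSeries ω (m + 1) (j + 1) from rfl, ← h2, pcf_apply, coeff_slowSeries] <;> omega

/-! ### The Hamiltonian density -/

theorem mem_of_isChain_of_le {x : ℤ} {l : List ℤ} (h : List.IsChain Slow (x :: l)) {w y : ℤ}
    (hw : w ∈ l) (hwy : w ≤ y) (hy : y < x) : y ∈ l := by
  induction l generalizing x with
  | nil => simp at hw
  | cons v l ih =>
    rw [List.isChain_cons_cons] at h
    have h1 := h.1
    unfold Slow at h1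
    rcases eq_or_ne y v with rfl | hne
    · simp
    · rcases List.mem_cons.1 hw with rfl | hw
      · omega
      · exact List.mem_cons_of_mem _ (ih h.2 hw (by omega))

theorem mem_of_isChain_of_ge {v : ℤ} {l : List ℤ} (h : List.IsChain Slow (l ++ [v])) {w y : ℤ}
    (hw : w ∈ l) (hwy : y ≤ w) (hy : v < y) : y ∈ l := by
  induction l generalizing w with
  | nil => simp at hw
  | cons x l ih =>
    rw [List.cons_append] at h
    rcases List.mem_cons.1 hw with rfl | hw
    · rcases eq_or_ne y w with rfl | hne
      · simp
      · cases l with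
        | nil =>
          rw [List.nil_append, List.isChain_cons_cons] at h
          have := h.1
          unfold Slow at this
          omega
        | cons x' l =>
          rw [List.cons_append, List.isChain_cons_cons] at h
          have h1 := h.1
          unfold Slow at h1
          exact List.mem_cons_of_mem _ (ih h.2 (w := x') (by simp) (by omega))
    · exact List.mem_cons_of_mem _ (ih h.of_cons hw hwy)

/-- Admissible words descend by at most one at a time, from height at least `j` at the start to
height at most `j` at the end. Hence there is no gap between the site and any letter. -/
theorem mem_of_mem_adm {m : ℕ} {j : ℤ} {l : List ℤ} (h : l ∈ adm m j) {w y : ℤ} (hw : w ∈ l)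
    (hy : w ≤ y ∧ y ≤ j ∨ j ≤ y ∧ y ≤ w) : y ∈ l := by
  have h := (mem_adm.1 h).2
  rcases hy with hy | hy
  · have h' : List.IsChain Slow ((j + 1) :: l) := by
      rw [← List.cons_append] at h
      exact h.left_of_append
    exact mem_of_isChain_of_le h' hw hy.1 (by omega)
  · exact mem_of_isChain_of_ge h.of_cons hw hy.2 (by omega)

theorem exists_le_of_mem_adm {m : ℕ} {j : ℤ} {l : List ℤ} (h : l ∈ adm m j) :
    ∃ w ∈ l, w ≤ j := by
  have h := (mem_adm.1 h).2
  rcases List.eq_nil_or_concat l with rfl | ⟨l', w, rfl⟩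
  · rw [List.nil_append, List.isChain_cons_cons] at h
    have := h.1
    unfold Slow at this
    omega
  · rw [List.concat_eq_append] at h ⊢
    refine ⟨w, by simp, ?_⟩
    have h2 := h.of_cons
    rw [List.append_assoc, List.singleton_append] at h2
    have := h2.right_of_append
    rw [List.isChain_cons_cons] at this
    have := this.1
    unfold Slow at this
    omega

theorem mem_adm_self {m : ℕ} {j : ℤ} {l : List ℤ} (h : l ∈ adm m j) : j ∈ l := by
  obtain ⟨w, hw, hwj⟩ := exists_le_of_mem_adm h
  exact mem_of_mem_adm h hw (Or.inl ⟨hwj, le_rfl⟩)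

theorem cf_current (ω : ℂ) (m : ℕ) (j : ℤ) (s : Multiset ℤ) :
    cf ω s (current ω m j) = ∑ l ∈ adm m j, if (l : Multiset ℤ) = s then wt ω l else 0 := by
  rw [current, map_sum]
  exact Finset.sum_congr rfl fun l _ => cf_word ω s l

theorem cf_current_eq_zero {ω : ℂ} {m : ℕ} {j : ℤ} {s : Multiset ℤ}
    (h : ∀ l ∈ adm m j, (l : Multiset ℤ) ≠ s) : cf ω s (current ω m j) = 0 := by
  rw [cf_current]
  exact Finset.sum_eq_zero fun l hl => if_neg (h l hl)

theorem eig_cons (ω : ℂ) (j i : ℤ) (s : Multiset ℤ) :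
    eig ω j (i ::ₘ s) = theta ω j i * eig ω j s := by simp [eig]

theorem norm_eig (ω : ℂ) (j : ℤ) (s : Multiset ℤ) : ‖eig ω j s‖ = ‖ω‖ ^ s.count j := by
  induction s using Multiset.induction_on with
  | empty => simp [eig]
  | cons i s ih =>
    rw [eig_cons, norm_mul, ih, Multiset.count_cons, pow_add]
    unfold theta
    split_ifs with h1 h2 h3 h4
    · omega
    · simp
    · rw [norm_mul, norm_zpow, norm_neg, norm_one, one_zpow, one_mul, pow_one, mul_comm]
    · omega
    · omega
    · simp

theorem eig_eq_one {ω : ℂ} {j : ℤ} {s : Multiset ℤ} (h : ∀ i ∈ s, j < i) : eig ω j s = 1 := by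
  refine Multiset.prod_eq_one fun x hx => ?_
  obtain ⟨i, hi, rfl⟩ := Multiset.mem_map.1 hx
  have := h i hi
  rw [theta, if_neg (by omega), if_neg (by omega)]

theorem eig_eq_one_of_lt {ω : ℂ} {j : ℤ} {s : Multiset ℤ} (hs : Even (Multiset.card s))
    (h : ∀ i ∈ s, i < j) : eig ω j s = 1 := by
  have : s.map (theta ω j) = s.map fun _ => (-1 : ℂ) :=
    Multiset.map_congr rfl fun i hi => if_pos (h i hi)
  rw [eig, this, Multiset.map_const', Multiset.prod_replicate]
  exact hs.neg_one_pow

theorem eig_eq_pow {ω : ℂ} {k : ℤ} {s : Multiset ℤ} (h : ∀ i ∈ s, k ≤ i) :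
    eig ω k s = ((-1) ^ k * ω) ^ s.count k := by
  induction s using Multiset.induction_on with
  | empty => simp [eig]
  | cons i s ih =>
    rw [eig_cons, ih fun j hj => h j (Multiset.mem_cons_of_mem hj), Multiset.count_cons]
    have := h i (Multiset.mem_cons_self i s)
    rw [theta, if_neg (by omega)]
    by_cases hi : i = k
    · rw [if_pos hi, if_pos hi.symm, pow_succ']
    · rw [if_neg hi, if_neg (Ne.symm hi), one_mul, add_zero]

theorem eig_ne_one {ω : ℂ} (hω : 1 < ‖ω‖) {j : ℤ} {s : Multiset ℤ} (hj : j ∈ s) :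
    eig ω j s ≠ 1 := by
  intro h
  have h1 := norm_eig ω j s
  rw [h, norm_one] at h1
  exact absurd h1 (one_lt_pow₀ hω (Multiset.count_ne_zero.2 hj)).ne

/-- Induction upwards from the smallest letter `k`. If `j` occurs in the content, `exists_potential`
links `j` to `j + 1`, and `|ω| > 1` makes the cancelled factors nonzero. If it does not, the gap at
`j` makes both sides vanish. -/
theorem cf_current_mul_of_one_lt {ω : ℂ} (hω : 1 < ‖ω‖) (m : ℕ) {s : Multiset ℤ}
    (hs : Even (Multiset.card s)) {k : ℤ} (hk : k ∈ s) (hmin : ∀ i ∈ s, k ≤ i) (j : ℤ) :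
    cf ω s (current ω m j) * (eig ω k s - 1) = cf ω s (current ω m k) * (eig ω j s - 1) := by
  have hω0 : ω ≠ 0 := fun h => by rw [h, norm_zero] at hω; linarith
  rcases lt_or_ge j k with hjk | hjk
  · rw [eig_eq_one (j := j) fun i hi => hjk.trans_le (hmin i hi), cf_current_eq_zero]
    · simp
    · rintro l hl rfl
      have := hmin j (mem_adm_self hl)
      omega
  · induction j, hjk using Int.leInduction with
    | base => rfl
    | succ j hjk ih =>
      by_cases hj : j ∈ s
      · obtain ⟨w, h1, h2⟩ := exists_potential hω0 m j hs
        have e1 : eig ω j s - 1 ≠ 0 := sub_ne_zero.2 (eig_ne_one hω hj)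
        have e2 : eig ω j s * eig ω (j + 1) s - 1 ≠ 0 := by
          refine sub_ne_zero.2 fun h => ?_
          have h3 := congrArg norm h
          rw [norm_mul, norm_eig, norm_eig, ← pow_add, norm_one] at h3
          refine absurd h3.symm (one_lt_pow₀ hω ?_).ne
          have := Multiset.count_ne_zero.2 hj
          omega
        refine mul_left_cancel₀ (mul_ne_zero e1 e2) ?_
        linear_combination (-(eig ω j s - 1) * (eig ω k s - 1)) * h2 +
          (eig ω (j + 1) s - 1) * (eig ω k s - 1) * h1 +
          (eig ω (j + 1) s - 1) * (eig ω j s * eig ω (j + 1) s - 1) * ih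
      · have hz : cf ω s (current ω m (j + 1)) = 0 := by
          refine cf_current_eq_zero ?_
          rintro l hl rfl
          exact hj (mem_of_mem_adm hl (w := k) hk (Or.inl ⟨hjk, by omega⟩))
        rw [hz, zero_mul]
        -- Either all letters lie below `j + 1` and the eigenvalue is `1` because their number is
        -- even, or a letter above the gap prevents the content from occurring in the current at
        -- `k`.
        by_cases hi : ∀ i ∈ s, i < j + 1
        · rw [eig_eq_one_of_lt hs hi, sub_self, mul_zero]
        · push Not at hi
          obtain ⟨i, his, hi⟩ := hi
          rw [cf_current_eq_zero, zero_mul]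
          rintro l hl rfl
          exact hj (mem_of_mem_adm hl (w := i) his (Or.inr ⟨hjk, by omega⟩))

/-! ### Passage from `|ω| > 1` to the unit circle. -/

theorem continuous_exch (n i : ℤ) : Continuous fun ω => exch ω n i := by
  unfold exch
  split_ifs <;> fun_prop

theorem continuous_wt (l : List ℤ) : Continuous fun ω => wt ω l := by
  induction l with
  | nil => exact continuous_const
  | cons n l ih =>
    refine Continuous.mul ?_ ih
    unfold cost
    simp only [Multiset.map_coe, Multiset.prod_coe]
    exact continuous_list_prod _ fun i _ => continuous_exch n i

theorem continuous_eig (j : ℤ) (s : Multiset ℤ) : Continuous fun ω => eig ω j s := by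
  unfold eig
  refine continuous_multiset_prod _ fun i _ => ?_
  unfold theta
  split_ifs <;> fun_prop

theorem continuous_cf_current (m : ℕ) (j : ℤ) (s : Multiset ℤ) :
    Continuous fun ω => cf ω s (current ω m j) := by
  simp only [cf_current]
  refine continuous_finsetSum _ fun l _ => ?_
  split_ifs
  · exact continuous_wt l
  · exact continuous_const

/-- A function which vanishes outside the closed unit disc vanishes at the points of its boundary
where it is continuous. -/
theorem eq_zero_of_continuousAt {f : ℂ → ℂ} (h : ∀ ω, 1 < ‖ω‖ → f ω = 0) {ω : ℂ}
    (hω : 1 ≤ ‖ω‖) (hf : ContinuousAt f ω) : f ω = 0 := by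
  have h1 : Filter.Tendsto (fun r : ℝ => (r : ℂ) * ω) (nhdsWithin 1 (Set.Ioi 1)) (nhds ω) := by
    have : Filter.Tendsto (fun r : ℝ => (r : ℂ) * ω) (nhds 1) (nhds (((1 : ℝ) : ℂ) * ω)) :=
      Continuous.tendsto (by fun_prop) 1
    rw [Complex.ofReal_one, one_mul] at this
    exact this.mono_left nhdsWithin_le_nhds
  have h2 : Filter.Tendsto (fun r : ℝ => f ((r : ℂ) * ω)) (nhdsWithin 1 (Set.Ioi 1))
      (nhds (f ω)) := hf.tendsto.comp h1
  refine tendsto_nhds_unique h2 (tendsto_const_nhds.congr' ?_)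
  filter_upwards [self_mem_nhdsWithin] with r hr
  rw [h]
  rw [norm_mul, Complex.norm_real, Real.norm_of_nonneg (zero_le_one.trans hr.le)]
  exact one_lt_mul_of_lt_of_le hr hω

theorem cf_current_mul {ω : ℂ} (hω : 1 ≤ ‖ω‖) (m : ℕ) {s : Multiset ℤ}
    (hs : Even (Multiset.card s)) {k : ℤ} (hk : k ∈ s) (hmin : ∀ i ∈ s, k ≤ i) (j : ℤ) :
    cf ω s (current ω m j) * (eig ω k s - 1) = cf ω s (current ω m k) * (eig ω j s - 1) := by
  have := eq_zero_of_continuousAt (f := fun ω => cf ω s (current ω m j) * (eig ω k s - 1) -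
      cf ω s (current ω m k) * (eig ω j s - 1))
    (fun ω hω => sub_eq_zero.2 (cf_current_mul_of_one_lt hω m hs hk hmin j)) hω
    (Continuous.continuousAt (by
      have := continuous_cf_current m j s
      have := continuous_cf_current m k s
      have := continuous_eig j s
      have := continuous_eig k s
      fun_prop))
  exact sub_eq_zero.1 this

/-- The smallest letter of `l` is `k`. -/
def IsMin (k : ℤ) (l : List ℤ) : Prop := k ∈ l ∧ ∀ y ∈ l, k ≤ y

open Classical in
/-- The part of the current which consists of the words with smallest letter `k`. -/
noncomputable def currentMin (ω : ℂ) (m : ℕ) (j k : ℤ) : QAlg ω :=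
  ∑ l ∈ (adm m j).filter (IsMin k), word ω l

open Classical in
/-- The part of the Hamiltonian, up to a constant factor, which consists of the words with smallest
letter `k`. -/
noncomputable def density (ω : ℂ) (m : ℕ) (k : ℤ) : QAlg ω :=
  ∑ l ∈ (adm m k).filter (IsMin k), (eig ω k l - 1)⁻¹ • word ω l

/-- No denominator of the Hamiltonian of degree `m` vanishes. -/
def Regular (ω : ℂ) (m : ℕ) : Prop := ∀ n : ℕ, 1 ≤ n → n ≤ m → ω ^ n ≠ 1 ∧ (-ω) ^ n ≠ 1

theorem regular_of_one_lt {ω : ℂ} (hω : 1 < ‖ω‖) (m : ℕ) : Regular ω m := by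
  intro n hn _
  constructor <;> intro h <;> have h := congrArg norm h <;>
    simp only [norm_pow, norm_neg, norm_one] at h <;>
    exact absurd h.symm (one_lt_pow₀ hω (by omega)).ne

theorem Regular.pow_ne_one {ω : ℂ} {m : ℕ} (h : Regular ω m) (k : ℤ) {n : ℕ} (h1 : 1 ≤ n)
    (h2 : n ≤ m) : ((-1) ^ k * ω) ^ n ≠ 1 := by
  rcases Int.even_or_odd k with hk | hk
  · rw [hk.neg_one_zpow, one_mul]; exact (h n h1 h2).1
  · rw [hk.neg_one_zpow, neg_one_mul]; exact (h n h1 h2).2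

theorem Regular.eig_ne_one {ω : ℂ} {m : ℕ} (h : Regular ω m) {k : ℤ} {s : Multiset ℤ}
    (hk : k ∈ s) (hs : Multiset.card s = m) (hmin : ∀ i ∈ s, k ≤ i) : eig ω k s ≠ 1 := by
  rw [eig_eq_pow hmin]
  refine h.pow_ne_one k (Nat.one_le_iff_ne_zero.2 (Multiset.count_ne_zero.2 hk)) ?_
  rw [← hs]
  exact Multiset.count_le_card k s

theorem cf_filter_sum (ω : ℂ) (A : Finset (List ℤ)) (p : List ℤ → Prop) [DecidablePred p]
    (c : List ℤ → ℂ) {s : Multiset ℤ} {b : ℂ} (P : Prop)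
    (hp : ∀ l : List ℤ, (l : Multiset ℤ) = s → (p l ↔ P))
    (hc : ∀ l : List ℤ, (l : Multiset ℤ) = s → c l = b) [Decidable P] :
    cf ω s (∑ l ∈ A.filter p, c l • word ω l) =
      if P then b * cf ω s (∑ l ∈ A, word ω l) else 0 := by
  rw [map_sum, map_sum, Finset.sum_filter]
  split_ifs with hP
  · rw [Finset.mul_sum]
    refine Finset.sum_congr rfl fun l _ => ?_
    rw [map_smul, cf_word, smul_eq_mul]
    by_cases hl : (l : Multiset ℤ) = s
    · rw [if_pos ((hp l hl).2 hP), hc l hl]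
    · simp [hl]
  · refine Finset.sum_eq_zero fun l _ => ?_
    rw [map_smul, cf_word]
    by_cases hl : (l : Multiset ℤ) = s
    · rw [if_neg (fun h => hP ((hp l hl).1 h))]
    · simp [hl]

open Classical in
theorem cf_currentMin (ω : ℂ) (m : ℕ) (j k : ℤ) (s : Multiset ℤ) :
    cf ω s (currentMin ω m j k) =
      if k ∈ s ∧ ∀ y ∈ s, k ≤ y then cf ω s (current ω m j) else 0 := by
  have := cf_filter_sum ω (adm m j) (IsMin k) (fun _ => 1) (s := s) (b := 1)
    (k ∈ s ∧ ∀ y ∈ s, k ≤ y) (fun l hl => by subst hl; rfl) fun _ _ => rfl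
  simpa [currentMin, current] using this

open Classical in
theorem cf_density (ω : ℂ) (m : ℕ) (k : ℤ) (s : Multiset ℤ) :
    cf ω s (density ω m k) =
      if k ∈ s ∧ ∀ y ∈ s, k ≤ y then (eig ω k s - 1)⁻¹ * cf ω s (current ω m k) else 0 :=
  cf_filter_sum ω (adm m k) (IsMin k) (fun l => (eig ω k l - 1)⁻¹)
    (k ∈ s ∧ ∀ y ∈ s, k ≤ y) (fun l hl => by subst hl; rfl) fun l hl => by rw [hl]

theorem cf_current_of_card_ne {ω : ℂ} {m : ℕ} {j : ℤ} {s : Multiset ℤ}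
    (h : Multiset.card s ≠ m) : cf ω s (current ω m j) = 0 :=
  cf_current_eq_zero fun l hl hs => h (by rw [← hs, Multiset.coe_card, (mem_adm.1 hl).1])

/-- The potential equation: the division by `eig ω k s - 1` in the density is what `cf_current_mul`
requires, simultaneously for all sites `j`. -/
theorem scale_theta_density {ω : ℂ} (hω : 1 ≤ ‖ω‖) {m : ℕ} (hm : Even m) (hr : Regular ω m)
    (j k : ℤ) :
    scale ω (theta ω j) (density ω m k) = density ω m k + currentMin ω m j k := by
  classical
  refine ext_cf fun s => ?_
  rw [cf_scale, map_add, cf_density, cf_currentMin]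
  split_ifs with h
  · by_cases hs : Multiset.card s = m
    · have h1 := cf_current_mul hω m (hs ▸ hm) h.1 h.2 j
      have h2 : eig ω k s - 1 ≠ 0 := sub_ne_zero.2 (hr.eig_ne_one h.1 hs h.2)
      change eig ω j s * _ = _
      field_simp
      linear_combination -h1
    · rw [cf_current_of_card_ne hs, cf_current_of_card_ne hs]; simp
  · simp

/-! ### Monomials and words -/

theorem proj_monomial (ω : ℂ) {m : ℕ} (α : Fin m → ℤ) :
    proj ω (monomial α) = word ω (List.ofFn α) := by
  simp only [monomial, word, map_list_prod, List.map_ofFn]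
  rfl

theorem shift_gen (k n : ℤ) : shift k (gen n) = gen (n + k) := by simp [shift, gen]

theorem shift_monomial (k : ℤ) {m : ℕ} (α : Fin m → ℤ) :
    shift k (monomial α) = monomial fun i => α i + k := by
  simp only [monomial, map_list_prod, List.map_ofFn, Function.comp_def, shift_gen]

/-- The bounds on the intermediate entries are consequences of the two end conditions, since each
step descends by at most one. -/
theorem mem_admissible {n : ℕ} {α : Fin (n + 1) → ℤ} :
    α ∈ admissible (n + 1) ↔ 0 ≤ α 0 ∧ α (Fin.last n) ≤ 0 ∧
      ∀ i : Fin n, α i.castSucc ≤ α i.succ + 1 := by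
  simp only [admissible, Finset.mem_filter, Fintype.mem_piFinset, Finset.mem_Icc]
  constructor
  · rintro ⟨h1, h2⟩
    refine ⟨by simpa using (h1 0).1, by simpa using (h1 (Fin.last n)).2, fun i => h2 _ _ ?_⟩
    simp
  · rintro ⟨h1, h2, h3⟩
    refine ⟨fun i => ⟨?_, ?_⟩, fun i j hij => ?_⟩
    · induction i using Fin.induction with
      | zero => simpa using h1
      | succ i ih =>
        have := h3 i
        simp at ih ⊢
        omega
    · induction i using Fin.reverseInduction with
      | last => simpa using h2
      | cast i ih =>
        have := h3 i
        simp at ih ⊢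
        omega
    · have hi : (i : ℕ) < n := by omega
      have e1 : i = (⟨i, hi⟩ : Fin n).castSucc := rfl
      have e2 : j = (⟨i, hi⟩ : Fin n).succ := Fin.ext hij
      rw [e1, e2]
      exact h3 _

theorem ofFn_get_cast {A : Type*} {l : List A} {m : ℕ} (h : l.length = m) :
    List.ofFn (fun i : Fin m => l.get (i.cast h.symm)) = l := by
  subst h
  exact List.ofFn_get l

theorem ofFn_mem_adm {n : ℕ} (j : ℤ) (α : Fin (n + 1) → ℤ) :
    List.ofFn (fun i => α i + j) ∈ adm (n + 1) j ↔ α ∈ admissible (n + 1) := by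
  rw [mem_adm, mem_admissible, List.isChain_cons, List.isChain_append, List.isChain_ofFn,
    List.getLast?_eq_getLast_of_ne_nil (by simp), List.getLast_ofFn]
  simp only [List.ofFn_succ, List.cons_append, List.head?_cons,
    Option.mem_def, Option.some.injEq, forall_eq', List.isChain_singleton, Slow]
  constructor
  · rintro ⟨-, h1, h2, -, h3⟩
    refine ⟨by omega, ?_, fun i => ?_⟩
    · change α (Fin.last n) + j ≤ _ at h3
      omega
    · have := h2 i (by omega)
      change α i.castSucc + j ≤ α i.succ + j + 1 at this
      omega
  · rintro ⟨h1, h2, h3⟩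
    refine ⟨by simp, by omega, fun i hi => ?_, trivial, ?_⟩
    · have := h3 ⟨i, by omega⟩
      change _ ≤ α ⟨i + 1, _⟩ + 1 at this
      change α ⟨i, _⟩ ≤ _ at this
      omega
    · change α (Fin.last n) + j ≤ _
      omega

theorem sum_adm {A : Type*} [AddCommMonoid A] {m : ℕ} (hm : 0 < m) (j : ℤ) (f : List ℤ → A) :
    ∑ l ∈ adm m j, f l = ∑ α ∈ admissible m, f (List.ofFn fun i => α i + j) := by
  obtain ⟨n, rfl⟩ : ∃ n, m = n + 1 := ⟨m - 1, by omega⟩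
  symm
  refine Finset.sum_bij (fun α _ => List.ofFn fun i => α i + j)
    (fun α hα => (ofFn_mem_adm j α).2 hα) (fun α _ β _ h => ?_) (fun l hl => ?_) fun _ _ => rfl
  · funext i
    have := congrFun (List.ofFn_injective h) i
    omega
  · have hl' := (mem_adm.1 hl).1
    have e : List.ofFn (fun i : Fin (n + 1) => (l.get (i.cast hl'.symm) - j) + j) = l := by
      simp only [sub_add_cancel]
      exact ofFn_get_cast hl'
    exact ⟨fun i => l.get (i.cast hl'.symm) - j, (ofFn_mem_adm j _).1 (by rwa [e]), e⟩

theorem proj_shift_volterraX (ω : ℂ) {m : ℕ} (hm : 0 < m) (j : ℤ) :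
    proj ω (shift j (volterraX m)) = current ω m j := by
  rw [volterraX, current, sum_adm hm, map_sum, map_sum]
  exact Finset.sum_congr rfl fun α _ => by rw [shift_monomial, proj_monomial]

theorem shift_shift (j k : ℤ) (x : FreeAlg) : shift j (shift k x) = shift (k + j) x := by
  have : (shift j).comp (shift k) = shift (k + j) := by
    refine FreeAlgebra.hom_ext (funext fun n => ?_)
    change shift j (shift k (gen n)) = shift (k + j) (gen n)
    rw [shift_gen, shift_gen, shift_gen, add_assoc]
  exact DFunLike.congr_fun this x

theorem proj_volterraK (ω : ℂ) {m : ℕ} (hm : 0 < m) (n : ℤ) :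
    proj ω (volterraK m n) =
      current ω m (n + 1) * u ω n - u ω n * current ω m (n - 1) := by
  rw [volterraK, map_sub, map_sub, map_mul, map_mul, map_mul, map_mul, shift_shift, shift_shift,
    proj_shift_volterraX ω hm, proj_shift_volterraX ω hm, shift_gen, zero_add, add_comm 1 n,
    neg_add_eq_sub]
  rfl

/-! ### The normal ordering polynomials -/

theorem mult_eq_count {m : ℕ} (α : Fin m → ℤ) (i : ℤ) :
    mult α i = Multiset.count i (List.ofFn α : Multiset ℤ) := by
  rw [← Fin.univ_val_map, Multiset.count_map, mult, Finset.card_def, Finset.filter_val]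
  simp only [eq_comm]

theorem similar_iff {m : ℕ} {α β : Fin m → ℤ} :
    Similar α β ↔ (List.ofFn α : Multiset ℤ) = List.ofFn β := by
  simp only [Similar, mult_eq_count, Multiset.ext]

/-- The exchange factors as polynomials. -/
noncomputable def exchPoly (n i : ℤ) : ℤ[X] :=
  if n < i then (if i = n + 1 then ((n.negOnePow : ℤˣ) : ℤ) • X else -1) else 1

theorem aeval_exchPoly (ω : ℂ) (n i : ℤ) : aeval ω (exchPoly n i) = exch ω n i := by
  unfold exchPoly exch
  split_ifs
  · rw [map_zsmul, aeval_X, zsmul_eq_mul, Int.cast_negOnePow]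
  · simp
  · simp

/-- The factor between a word and its decreasing rearrangement, as a polynomial. -/
noncomputable def wtPoly : List ℤ → ℤ[X]
  | [] => 1
  | n :: l => (l.map (exchPoly n)).prod * wtPoly l

theorem aeval_wtPoly (ω : ℂ) (l : List ℤ) : aeval ω (wtPoly l) = wt ω l := by
  induction l with
  | nil => simp [wtPoly, wt]
  | cons n l ih =>
    rw [wtPoly, wt, map_mul, ih, map_list_prod, List.map_map, cost, Multiset.map_coe,
      Multiset.prod_coe]
    simp only [Function.comp_def, aeval_exchPoly]

/-- The relations are not shift invariant: a shift by `k` replaces `ω` by `(-1)^k ω`. This is why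
the polynomials in the Hamiltonian are evaluated there. -/
theorem exch_add (ω : ℂ) (k n i : ℤ) : exch ω (n + k) (i + k) = exch ((-1) ^ k * ω) n i := by
  unfold exch
  rw [zpow_add₀ (by norm_num), mul_assoc]
  simp only [add_lt_add_iff_right, add_right_comm n k 1, add_left_inj]

theorem wt_map_add (ω : ℂ) (k : ℤ) (l : List ℤ) :
    wt ω (l.map (· + k)) = wt ((-1) ^ k * ω) l := by
  induction l with
  | nil => rfl
  | cons n l ih =>
    rw [List.map_cons, wt, wt, ih]
    simp only [cost, Multiset.map_coe, List.map_map, Function.comp_def, exch_add]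

theorem pairwise_of_mem_indexSet {m : ℕ} {α : Fin m → ℤ} (hα : α ∈ indexSet m) :
    (List.ofFn α).Pairwise (· ≥ ·) := by
  rw [indexSet, Finset.mem_filter] at hα
  rw [← List.isChain_iff_pairwise, List.isChain_ofFn]
  exact fun i hi => hα.2.1 _ _ rfl

open Classical in
-- `u_α` is itself a decreasing word, of weight `1`, and all similar monomials are multiples of it;
-- the condition is therefore one equation for its coefficient.
theorem isNormalPoly_iff {m : ℕ} {α : Fin m → ℤ} (hα : α ∈ indexSet m) (p : ℤ[X]) :
    IsNormalPoly α p ↔ ∀ ω : ℂ, ω ≠ 0 → aeval ω p =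
      ∑ β ∈ (admissible m).filter (fun β => Similar β α), wt ω (List.ofFn β) := by
  refine forall₂_congr fun ω _ => ?_
  rw [map_sum, proj_monomial]
  constructor
  · intro h
    have h := congrArg (cf ω (List.ofFn α : Multiset ℤ)) h
    rw [map_smul, map_sum, cf_word, if_pos rfl, wt_eq_one (pairwise_of_mem_indexSet hα),
      smul_eq_mul, mul_one] at h
    rw [h]
    refine Finset.sum_congr rfl fun β hβ => ?_
    rw [proj_monomial, cf_word, if_pos (similar_iff.1 (Finset.mem_filter.1 hβ).2)]
  · intro h
    refine ext_cf fun s => ?_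
    rw [map_smul, map_sum, cf_word, h, smul_eq_mul, Finset.sum_mul]
    refine Finset.sum_congr rfl fun β hβ => ?_
    rw [proj_monomial, cf_word, similar_iff.1 (Finset.mem_filter.1 hβ).2,
      wt_eq_one (pairwise_of_mem_indexSet hα)]
    split_ifs <;> simp

theorem existsUnique_isNormalPoly {m : ℕ} {α : Fin m → ℤ} (hα : α ∈ indexSet m) :
    ∃! p, IsNormalPoly α p := by
  classical
  refine ⟨∑ β ∈ (admissible m).filter (fun β => Similar β α), wtPoly (List.ofFn β),
    (isNormalPoly_iff hα _).2 fun ω _ => ?_, fun p hp => ?_⟩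
  · rw [map_sum]
    exact Finset.sum_congr rfl fun β _ => aeval_wtPoly ω _
  · replace hp := (isNormalPoly_iff hα p).1 hp
    -- Uniqueness: the two polynomials agree at every nonzero complex number, hence at infinitely
    -- many points.
    refine Polynomial.map_injective (Int.castRingHom ℂ) Int.cast_injective ?_
    refine Polynomial.eq_of_infinite_eval_eq _ _ (Set.Infinite.mono (s := {0}ᶜ) ?_
      (Set.finite_singleton (0 : ℂ)).infinite_compl)
    intro ω hω
    have h := hp ω hω
    simp only [← aeval_wtPoly, ← map_sum] at h
    simpa only [Set.mem_ofPred_eq, aeval_def, eval₂_eq_eval_map, algebraMap_int_eq] using h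

open Classical in
theorem aeval_normalPoly {m : ℕ} {α : Fin m → ℤ} (hα : α ∈ indexSet m) {ω : ℂ} (hω : ω ≠ 0) :
    aeval ω (normalPoly α) =
      ∑ β ∈ (admissible m).filter (fun β => Similar β α), wt ω (List.ofFn β) :=
  (isNormalPoly_iff hα _).1 (Classical.epsilon_spec (existsUnique_isNormalPoly hα).exists) ω hω

theorem ofFn_add {m : ℕ} (α : Fin m → ℤ) (k : ℤ) :
    List.ofFn (fun i => α i + k) = (List.ofFn α).map (· + k) := by
  rw [List.map_ofFn]; rfl

theorem coe_map_add_inj {l l' : List ℤ} (k : ℤ) :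
    ((l.map (· + k) : List ℤ) : Multiset ℤ) = (l'.map (· + k) : List ℤ) ↔
      (l : Multiset ℤ) = l' := by
  rw [← Multiset.map_coe, ← Multiset.map_coe]
  exact (Multiset.map_injective (add_left_injective k)).eq_iff

theorem aeval_normalPoly_eq_cf {m : ℕ} {α : Fin m → ℤ} (hα : α ∈ indexSet m) {ω : ℂ} (hω : ω ≠ 0)
    (hm : 0 < m) (k : ℤ) :
    aeval ((-1) ^ k * ω) (normalPoly α) =
      cf ω ((List.ofFn fun i => α i + k : List ℤ) : Multiset ℤ) (current ω m k) := by
  classical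
  rw [aeval_normalPoly hα (mul_ne_zero (neg_one_zpow_ne_zero k) hω), cf_current, sum_adm hm,
    Finset.sum_filter]
  refine Finset.sum_congr rfl fun β _ => ?_
  rw [ofFn_add, ofFn_add, wt_map_add, similar_iff]
  simp only [coe_map_add_inj]
  congr

theorem isMin_ofFn {m : ℕ} (hm : 0 < m) {α : Fin m → ℤ} (hα : α ∈ indexSet m) (k : ℤ) :
    IsMin k (List.ofFn fun i => α i + k) := by
  have h1 := pairwise_of_mem_indexSet hα
  rw [List.pairwise_ofFn] at h1
  rw [indexSet, Finset.mem_filter] at hα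
  obtain ⟨n, rfl⟩ : ∃ n, m = n + 1 := ⟨m - 1, by omega⟩
  have h0 := hα.2.2 (Fin.last n) (by simp)
  refine ⟨List.mem_ofFn.2 ⟨Fin.last n, by simp [h0]⟩, fun y hy => ?_⟩
  obtain ⟨i, rfl⟩ := List.mem_ofFn.1 hy
  rcases eq_or_ne i (Fin.last n) with rfl | hi
  · simp [h0]
  · have := h1 (Fin.lt_last_iff_ne_last.2 hi)
    simp only [ge_iff_le, h0] at this
    simp [this]

/-- The index is the decreasing rearrangement of the word, lowered by `k`. Absence of gaps in
admissible words bounds its descents by one. -/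
theorem exists_indexSet {m : ℕ} (hm : 0 < m) {k : ℤ} {l : List ℤ} (hl : l ∈ adm m k)
    (hk : IsMin k l) :
    ∃ α ∈ indexSet m, ((List.ofFn fun i => α i + k : List ℤ) : Multiset ℤ) = l := by
  obtain ⟨n, rfl⟩ : ∃ n, m = n + 1 := ⟨m - 1, by omega⟩
  set t := Multiset.sort (l : Multiset ℤ) (· ≥ ·) with ht
  have htl : (t : Multiset ℤ) = l := Multiset.sort_eq _ _
  have hmem : ∀ y, y ∈ t ↔ y ∈ l := fun y => by simp [ht]
  have htn : t.length = n + 1 := by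
    rw [ht, Multiset.length_sort, Multiset.coe_card, (mem_adm.1 hl).1]
  have e : List.ofFn (fun i : Fin (n + 1) => (t.get (i.cast htn.symm) - k) + k) = t := by
    simp only [sub_add_cancel]
    exact ofFn_get_cast htn
  set α : Fin (n + 1) → ℤ := fun i => t.get (i.cast htn.symm) - k with hα
  have hval : ∀ i, α i + k ∈ l := fun i => by
    rw [← hmem, ← e]; exact List.mem_ofFn.2 ⟨i, rfl⟩
  have hex : ∀ y ∈ l, ∃ i, α i + k = y := fun y hy => by
    rw [← hmem, ← e] at hy; exact List.mem_ofFn.1 hy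
  have hanti : ∀ ⦃i j⦄, i < j → α i + k ≥ α j + k := by
    have : t.Pairwise (· ≥ ·) := Multiset.pairwise_sort _ _
    rw [← e] at this
    exact List.pairwise_ofFn.1 this
  have hanti' : ∀ ⦃i j⦄, i ≤ j → α j + k ≤ α i + k := fun i j hij => by
    rcases hij.eq_or_lt with rfl | h
    · rfl
    · exact hanti h
  have hmin : ∀ i, 0 ≤ α i := fun i => by have := hk.2 _ (hval i); omega
  have hlast : α (Fin.last n) = 0 := by
    obtain ⟨i, hi⟩ := hex k hk.1
    have := hanti' (Fin.le_last i)
    have := hmin (Fin.last n)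
    omega
  refine ⟨α, ?_, by rw [e, htl]⟩
  rw [indexSet, Finset.mem_filter, mem_admissible]
  refine ⟨⟨hmin 0, hlast.le, fun i => ?_⟩, fun i j hij => ?_, fun i hi => ?_⟩
  · by_contra hlt
    -- A descent by two or more would skip a height that lies between the site and a letter of the
    -- word; but such a height must occur, and the rearrangement has no room for it.
    obtain ⟨p, hp⟩ := hex (α i.succ + k + 1) (mem_of_mem_adm hl (hval i.castSucc) (Or.inr (by
      have := hmin i.succ; omega)))
    rcases Fin.le_or_lt p i.castSucc with h | h
    · have := hanti' h; omega
    · have := hanti' (Fin.castSucc_lt_iff_succ_le.1 h); omega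
  · have := hanti' (i := i) (j := j) (by rw [Fin.le_def]; omega)
    omega
  · have : i = Fin.last n := Fin.ext (by simpa using hi)
    rw [this, hlast]

theorem eq_of_mem_indexSet {m : ℕ} {α β : Fin m → ℤ} (hα : α ∈ indexSet m) (hβ : β ∈ indexSet m)
    {k : ℤ} (h : ((List.ofFn fun i => α i + k : List ℤ) : Multiset ℤ) =
      (List.ofFn fun i => β i + k : List ℤ)) : α = β := by
  rw [ofFn_add, ofFn_add, coe_map_add_inj] at h
  exact List.ofFn_injective (List.Perm.eq_of_pairwise' (pairwise_of_mem_indexSet hα)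
    (pairwise_of_mem_indexSet hβ) (Multiset.coe_eq_coe.1 h))

/-- Contents with smallest letter `k` that occur in the current at `k` correspond to single indices
`α`. There `P_α((-1)^k ω)` is the coefficient of the current and `((-1)^k ω)^{ν(α,0)}` is the
eigenvalue. -/
theorem hamiltonianTerm_eq {ω : ℂ} (hω : ω ≠ 0) {m : ℕ} (hm : 0 < m) (k : ℤ) :
    hamiltonianTerm ω m k = (ω ^ m - 1) • density ω m k := by
  classical
  refine ext_cf fun s => ?_
  rw [hamiltonianTerm, map_sum, map_smul, cf_density]
  have hterm : ∀ α ∈ indexSet m, cf ω s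
      (((ω ^ m - 1) / (((-1) ^ k * ω) ^ mult α 0 - 1) *
        aeval ((-1) ^ k * ω) (normalPoly α)) • proj ω (shift k (monomial α))) =
      if ((List.ofFn fun i => α i + k : List ℤ) : Multiset ℤ) = s then
        (ω ^ m - 1) * ((eig ω k s - 1)⁻¹ * cf ω s (current ω m k)) else 0 := by
    intro α hα
    rw [shift_monomial, proj_monomial, map_smul, cf_word]
    split_ifs with h
    · rw [aeval_normalPoly_eq_cf hα hω hm, h, wt_eq_one, smul_eq_mul, mul_one, div_eq_mul_inv,
        mul_assoc, ← h, eig_eq_pow (isMin_ofFn hm hα k).2, ofFn_add, ← Multiset.map_coe]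
      · congr 4
        rw [mult_eq_count, ← Multiset.count_map_eq_count' (· + k) _ (add_left_injective k),
          zero_add]
      · rw [ofFn_add, List.pairwise_map]
        exact (pairwise_of_mem_indexSet hα).imp fun h => by simpa using h
    · simp
  rw [Finset.sum_congr rfl hterm]
  split_ifs with hs
  · by_cases hex : ∃ l ∈ adm m k, (l : Multiset ℤ) = s
    · obtain ⟨l, hl, rfl⟩ := hex
      obtain ⟨α, hα, hαl⟩ := exists_indexSet hm hl hs
      rw [Finset.sum_eq_single_of_mem α hα, if_pos hαl, smul_eq_mul]
      intro β hβ hne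
      exact if_neg fun h => hne (eq_of_mem_indexSet hβ hα (h.trans hαl.symm))
    · push Not at hex
      rw [cf_current_eq_zero hex]
      simp
  · rw [smul_zero]
    refine Finset.sum_eq_zero fun α hα => if_neg ?_
    rintro rfl
    exact hs (isMin_ofFn hm hα k)

/-! ### The Heisenberg form -/

/-- Both sides are multiplicative in `a`, and on generators this is a restatement of the relations:
the weights of `θ_{n+1}` and `-θ_{n-1}` differ at `i` by the factor that `u_i` acquires in passing
`u_n`. -/
theorem scale_theta_mul_u (ω : ℂ) (n : ℤ) (a : QAlg ω) :
    scale ω (theta ω (n + 1)) a * u ω n =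
      u ω n * scale ω (fun i => -theta ω (n - 1) i) a := by
  induction a using QAlg.induction with
  | hc c => rw [AlgHom.commutes, AlgHom.commutes, Algebra.commutes]
  | hu i =>
    rw [scale_u, scale_u, smul_mul_assoc, mul_smul_comm]
    unfold theta
    rcases lt_trichotomy i n with h | rfl | h
    · rcases eq_or_ne i (n - 1) with rfl | h'
      · have := u_adjacent ω (n - 1)
        rw [sub_add_cancel] at this
        rw [if_pos (by omega), if_neg (by omega), if_pos rfl, this]
        module
      · rw [if_pos (by omega), if_pos (by omega), u_far ω i n (by
          rw [abs_sub_comm, abs_of_pos] <;> omega)]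
        module
    · rw [if_pos (by omega), if_neg (by omega), if_neg (by omega)]
    · rcases eq_or_ne i (n + 1) with rfl | h'
      · rw [if_neg (by omega), if_pos rfl, if_neg (by omega), if_neg (by omega), u_adjacent,
          zpow_add₀ (by norm_num)]
        module
      · rw [if_neg (by omega), if_neg (by omega), if_neg (by omega), if_neg (by omega),
          u_far ω i n (by rw [abs_of_pos] <;> omega)]
        module
  | hadd a b ha hb => rw [map_add, map_add, add_mul, mul_add, ha, hb]
  | hmul a b ha hb => rw [map_mul, map_mul, mul_assoc, hb, ← mul_assoc, ha, mul_assoc]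

theorem cf_density_of_card_ne {ω : ℂ} {m : ℕ} {k : ℤ} {s : Multiset ℤ}
    (h : Multiset.card s ≠ m) : cf ω s (density ω m k) = 0 := by
  classical
  rw [cf_density, cf_current_of_card_ne h, mul_zero, ite_self]

theorem scale_neg_density (ω : ℂ) {m : ℕ} (hm : Even m) (f : ℤ → ℂ) (k : ℤ) :
    scale ω (fun i => -f i) (density ω m k) = scale ω f (density ω m k) := by
  refine ext_cf fun s => ?_
  rw [cf_scale, cf_scale]
  by_cases h : Multiset.card s = m
  · congr 1
    have : (s.map fun i => -f i) = (s.map f).map Neg.neg := by rw [Multiset.map_map]; rfl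
    rw [this, Multiset.prod_map_neg, Multiset.card_map, h, hm.neg_one_pow, one_mul]
  · rw [cf_density_of_card_ne h, mul_zero, mul_zero]

theorem density_mul_u {ω : ℂ} (hω : 1 ≤ ‖ω‖) {m : ℕ} (hm : Even m) (hr : Regular ω m)
    (k n : ℤ) :
    density ω m k * u ω n - u ω n * density ω m k =
      u ω n * currentMin ω m (n - 1) k - currentMin ω m (n + 1) k * u ω n := by
  have h := scale_theta_mul_u ω n (density ω m k)
  rw [scale_neg_density ω hm, scale_theta_density hω hm hr, scale_theta_density hω hm hr,
    add_mul, mul_add] at h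
  rw [sub_eq_sub_iff_add_eq_add, h, add_comm]

theorem currentMin_eq_zero (ω : ℂ) {m : ℕ} {j k : ℤ} (h : ¬(j - m ≤ k ∧ k ≤ j + m)) :
    currentMin ω m j k = 0 := by
  classical
  refine Finset.sum_eq_zero fun l hl => ?_
  rw [Finset.mem_filter, mem_adm] at hl
  have := bounds_of_isChain_slow hl.1.2 k hl.2.1
  rw [hl.1.1] at this
  exact absurd this h

theorem IsMin.eq {k k' : ℤ} {l : List ℤ} (h : IsMin k l) (h' : IsMin k' l) : k = k' :=
  le_antisymm (h.2 _ h'.1) (h'.2 _ h.1)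

theorem exists_isMin {l : List ℤ} (h : l ≠ []) : ∃ k, IsMin k l := by
  obtain ⟨k, hk, h⟩ := l.toFinset.exists_min_image id (by simpa using h)
  exact ⟨k, by simpa using hk, by simpa using h⟩

theorem sum_currentMin (ω : ℂ) {m : ℕ} {j : ℤ} {A : Finset ℤ}
    (hA : Finset.Icc (j - m) (j + m) ⊆ A) :
    ∑ k ∈ A, currentMin ω m j k = current ω m j := by
  classical
  simp only [currentMin, Finset.sum_filter]
  rw [Finset.sum_comm, current]
  refine Finset.sum_congr rfl fun l hl => ?_
  obtain ⟨k, hk⟩ := exists_isMin (List.ne_nil_of_mem (mem_adm_self hl))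
  have hb := bounds_of_isChain_slow (mem_adm.1 hl).2 k hk.1
  rw [(mem_adm.1 hl).1] at hb
  rw [Finset.sum_eq_single_of_mem k (hA (Finset.mem_Icc.2 hb)), if_pos hk]
  exact fun k' _ hne => if_neg fun hk' => hne (hk'.eq hk)

theorem lie_hamiltonian_u {ω : ℂ} (hω : 1 ≤ ‖ω‖) (l : ℕ+) (hr : Regular ω (2 * l)) (n : ℤ) :
    ⁅hamiltonian ω l, toFormal ω (u ω n)⁆ =
      (1 - ω ^ (2 * (l : ℕ))) • toFormal ω (proj ω (volterraK (2 * l) n)) := by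
  have hω0 : ω ≠ 0 := fun h => by rw [h, norm_zero] at hω; linarith
  have hm : 0 < 2 * (l : ℕ) := Nat.mul_pos two_pos l.pos
  have hfin := hamiltonianTerm_finite ω (2 * l) hm
  have hterm := fun k => hamiltonianTerm_eq hω0 hm k
  have hdens := fun k => density_mul_u hω (even_two_mul (l : ℕ)) hr k n
  rw [proj_volterraK ω hm]
  rw [Ring.lie_def]
  refine Subtype.ext (funext fun N => ?_)
  change (∑ᶠ k, trunc ω N (hamiltonianTerm ω (2 * l) k)) * trunc ω N (u ω n) -
    trunc ω N (u ω n) * (∑ᶠ k, trunc ω N (hamiltonianTerm ω (2 * l) k)) =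
    (1 - ω ^ (2 * (l : ℕ))) • trunc ω N _
  generalize 2 * (l : ℕ) = m at *
  rw [finsum_mul' _ _ (hfin N), mul_finsum' _ _ (hfin N),
    ← finsum_sub_distrib ((hfin N).subset fun k hk h => hk (by rw [h, zero_mul]))
      ((hfin N).subset fun k hk h => hk (by rw [h, mul_zero]))]
  have h1 : ∀ k, trunc ω N (hamiltonianTerm ω m k) * trunc ω N (u ω n) -
      trunc ω N (u ω n) * trunc ω N (hamiltonianTerm ω m k) =
      trunc ω N ((1 - ω ^ m) •
        (currentMin ω m (n + 1) k * u ω n - u ω n * currentMin ω m (n - 1) k)) := by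
    intro k
    rw [← map_mul, ← map_mul, ← map_sub, hterm, smul_mul_assoc, mul_smul_comm, ← smul_sub, hdens,
      ← neg_sub (u ω n * _), smul_neg, ← neg_smul, neg_sub]
  -- Before summation each commutator is supported on smallest letters within distance `m` of `n ±
  -- 1`, so the infinite sum becomes finite and reassembles the full currents.
  rw [finsum_congr h1, finsum_eq_sum_of_support_subset (s := Finset.Icc (n - 1 - m) (n + 1 + m)),
    ← map_sum, ← Finset.smul_sum, Finset.sum_sub_distrib, ← Finset.sum_mul, ← Finset.mul_sum,
    sum_currentMin, sum_currentMin, map_smul]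
  · exact Finset.Icc_subset_Icc (by omega) (by omega)
  · exact Finset.Icc_subset_Icc (by omega) (by omega)
  · intro k hk
    by_contra hk'
    rw [Finset.coe_Icc, Set.mem_Icc] at hk'
    rw [Function.mem_support, currentMin_eq_zero ω (by omega),
      currentMin_eq_zero ω (by omega)] at hk
    simp at hk

theorem lie_mul_eq {R : Type*} [Ring R] (h a b : R) : ⁅h, a * b⁆ = ⁅h, a⁆ * b + a * ⁅h, b⁆ := by
  simp only [Ring.lie_def, sub_mul, mul_sub, mul_assoc]
  abel

theorem lie_add_eq {R : Type*} [Ring R] (h a b : R) : ⁅h, a + b⁆ = ⁅h, a⁆ + ⁅h, b⁆ := by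
  simp only [Ring.lie_def, add_mul, mul_add]
  abel

/-- The elements whose commutator with `H` lies in the algebra form a subalgebra, so checking the
generators suffices. Linearity and the Leibniz rule then descend through the injection `toFormal`.
-/
theorem exists_derivation {ω : ℂ} (H : Formal ω)
    (h : ∀ n, ∃ y, toFormal ω y = ⁅H, toFormal ω (u ω n)⁆) :
    ∃ D : QAlg ω →ₗ[ℂ] QAlg ω, (∀ a b, D (a * b) = D a * b + a * D b) ∧
      ∀ a, toFormal ω (D a) = ⁅H, toFormal ω a⁆ := by
  have hex : ∀ a, ∃ y, toFormal ω y = ⁅H, toFormal ω a⁆ := by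
    intro a
    induction a using QAlg.induction with
    | hc c => exact ⟨0, by rw [map_zero, AlgHom.commutes, Ring.lie_def, Algebra.commutes, sub_self]⟩
    | hu n => exact h n
    | hadd a b ha hb =>
      obtain ⟨x, hx⟩ := ha
      obtain ⟨y, hy⟩ := hb
      exact ⟨x + y, by rw [map_add, map_add, lie_add_eq, hx, hy]⟩
    | hmul a b ha hb =>
      obtain ⟨x, hx⟩ := ha
      obtain ⟨y, hy⟩ := hb
      refine ⟨x * b + a * y, ?_⟩
      rw [map_add, map_mul, map_mul, map_mul, hx, hy, lie_mul_eq]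
  choose D hD using hex
  refine ⟨⟨⟨D, fun a b => toFormal_injective ω ?_⟩, fun c a => toFormal_injective ω ?_⟩,
    fun a b => toFormal_injective ω ?_, hD⟩
  · rw [map_add, hD, hD, hD, map_add, lie_add_eq]
  · rw [RingHom.id_apply, map_smul, hD, hD, map_smul, Ring.lie_def, Ring.lie_def,
      mul_smul_comm, smul_mul_assoc, smul_sub]
  · change toFormal ω (D (a * b)) = toFormal ω (D a * b + a * D b)
    rw [map_add, map_mul, map_mul, hD, hD, hD, map_mul, lie_mul_eq]

theorem derivation_ext {ω : ℂ} {D D' : QAlg ω →ₗ[ℂ] QAlg ω}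
    (h : ∀ a b, D (a * b) = D a * b + a * D b) (h' : ∀ a b, D' (a * b) = D' a * b + a * D' b)
    (hu : ∀ n, D (u ω n) = D' (u ω n)) : D = D' := by
  have key : ∀ E : QAlg ω →ₗ[ℂ] QAlg ω, (∀ a b, E (a * b) = E a * b + a * E b) → E 1 = 0 := by
    intro E hE
    simpa using hE 1 1
  refine LinearMap.ext fun a => ?_
  induction a using QAlg.induction with
  | hc c => rw [Algebra.algebraMap_eq_smul_one, map_smul, map_smul, key D h, key D' h']
  | hu n => exact hu n
  | hadd a b ha hb => rw [map_add, map_add, ha, hb]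
  | hmul a b ha hb => rw [h, h', ha, hb]

/-- With `E = exp(i l ħ)` one has `1 - ω^{2l} = E (E⁻¹ - E)` and `2 sin(l ħ) = i (E⁻¹ - E)`;
nonresonance keeps the sine from vanishing. -/
theorem heisenberg_factor (ħ : ℝ) (l : ℕ+) (hr : Regular (Circle.exp ħ) (2 * l)) :
    Complex.I / (2 * (Real.sin (l * ħ) : ℂ)) * (1 - (Circle.exp ħ : ℂ) ^ (2 * (l : ℕ))) =
      (Circle.exp (ħ / 2) : ℂ) ^ (2 * (l : ℕ)) := by
  have hm : 0 < 2 * (l : ℕ) := Nat.mul_pos two_pos l.pos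
  have h1 := (hr _ hm le_rfl).1
  set E := Complex.exp ((l * ħ : ℝ) * Complex.I) with hE
  have hE0 : E ≠ 0 := Complex.exp_ne_zero _
  have e1 : (Circle.exp ħ : ℂ) ^ (2 * (l : ℕ)) = E ^ 2 := by
    rw [Circle.coe_exp, ← Complex.exp_nat_mul, hE, ← Complex.exp_nat_mul]
    congr 1; push_cast; ring
  have e2 : (Circle.exp (ħ / 2) : ℂ) ^ (2 * (l : ℕ)) = E := by
    rw [Circle.coe_exp, ← Complex.exp_nat_mul, hE]
    congr 1; push_cast; ring
  have e3 : (Real.sin (l * ħ) : ℂ) = (E⁻¹ - E) * Complex.I / 2 := by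
    rw [Complex.ofReal_sin, Complex.sin, hE, ← Complex.exp_neg, neg_mul]
  rw [e1] at h1 ⊢
  rw [e2, e3]
  have hI := Complex.I_ne_zero
  have h2 : E⁻¹ - E ≠ 0 := by
    intro h
    apply h1
    rw [sub_eq_zero] at h
    rw [sq]
    nth_rw 1 [← h]
    exact inv_mul_cancel₀ hE0
  rw [show 2 * ((E⁻¹ - E) * Complex.I / 2) = (E⁻¹ - E) * Complex.I by ring]
  rw [div_mul_eq_mul_div, div_eq_iff (mul_ne_zero h2 hI)]
  field_simp

theorem heisenberg (ħ : ℝ) (l : ℕ+) (hr : Regular (Circle.exp ħ) (2 * l)) (n : ℤ) :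
    (Complex.I / (2 * (Real.sin (l * ħ) : ℂ))) •
        ⁅hamiltonian (Circle.exp ħ) l, toFormal (Circle.exp ħ) (u (Circle.exp ħ) n)⁆ =
      toFormal (Circle.exp ħ) ((Circle.exp (ħ / 2) : ℂ) ^ (2 * (l : ℕ)) •
        proj (Circle.exp ħ) (volterraK (2 * l) n)) := by
  rw [lie_hamiltonian_u (Circle.norm_coe _).ge l hr, smul_smul, heisenberg_factor ħ l hr, map_smul]

theorem existsUnique_flow (ħ : ℝ) (l : ℕ+) (hr : Regular (Circle.exp ħ) (2 * l)) :
    ∃! D : QAlg (Circle.exp ħ) →ₗ[ℂ] QAlg (Circle.exp ħ),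
      IsVolterraFlow (Circle.exp (ħ / 2)) (Circle.exp ħ) (2 * l) D := by
  set c : ℂ := Complex.I / (2 * (Real.sin (l * ħ) : ℂ))
  have h : ∀ n, ⁅c • hamiltonian (Circle.exp ħ) l, toFormal (Circle.exp ħ) (u (Circle.exp ħ) n)⁆ =
      toFormal (Circle.exp ħ) ((Circle.exp (ħ / 2) : ℂ) ^ (2 * (l : ℕ)) •
        proj (Circle.exp ħ) (volterraK (2 * l) n)) := fun n => by
    rw [← heisenberg ħ l hr, Ring.lie_def, Ring.lie_def, mul_smul_comm, smul_mul_assoc, smul_sub]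
  obtain ⟨D, hD, hDu⟩ := exists_derivation (c • hamiltonian (Circle.exp ħ) l)
    fun n => ⟨_, (h n).symm⟩
  refine ⟨D, ⟨hD, fun n => toFormal_injective _ ((hDu _).trans (h n))⟩, fun D' hD' => ?_⟩
  refine derivation_ext hD'.1 hD fun n => (hD'.2 n).trans ?_
  exact (toFormal_injective _ ((hDu _).trans (h n))).symm

/-! ### Self-adjointness -/

theorem star_smul_eq (ω : Circle) (c : ℂ) (a : QAlg (ω : ℂ)) :
    star (c • a) = starRingEnd ℂ c • star a := by
  rw [Algebra.smul_def, star_mul, star_algebraMap, ← Algebra.commutes, ← Algebra.smul_def]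

theorem star_word (ω : Circle) (l : List ℤ) : star (word ω l) = word ω l.reverse := by
  induction l with
  | nil => simp
  | cons n l ih => rw [word_cons, star_mul, ih, star_u, List.reverse_cons, word_append]; simp

theorem star_scale (ω : Circle) (f : ℤ → ℂ) (a : QAlg (ω : ℂ)) :
    star (scale ω f a) = scale ω (fun i => starRingEnd ℂ (f i)) (star a) := by
  induction a using QAlg.induction with
  | hc c => simp only [AlgHom.commutes, star_algebraMap]
  | hu n => rw [scale_u, star_smul_eq, star_u, scale_u]
  | hadd a b ha hb => simp only [map_add, star_add, ha, hb]
  | hmul a b ha hb => simp only [map_mul, star_mul, ha, hb]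

/-- The coefficientwise conjugation of series. -/
noncomputable def pstar (ω : Circle) (x : PowerSeries (QAlg (ω : ℂ))) :
    PowerSeries (QAlg (ω : ℂ)) :=
  PowerSeries.mk fun n => star (PowerSeries.coeff n x)

theorem coeff_pstar (ω : Circle) (n : ℕ) (x : PowerSeries (QAlg (ω : ℂ))) :
    PowerSeries.coeff n (pstar ω x) = star (PowerSeries.coeff n x) :=
  PowerSeries.coeff_mk _ _

theorem pstar_mul (ω : Circle) (x y : PowerSeries (QAlg (ω : ℂ))) :
    pstar ω (x * y) = pstar ω y * pstar ω x := by
  ext n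
  rw [coeff_pstar, PowerSeries.coeff_mul, PowerSeries.coeff_mul, star_sum,
    ← Finset.Nat.sum_antidiagonal_swap]
  simp only [star_mul, coeff_pstar, Prod.fst_swap, Prod.snd_swap]

theorem pstar_one_sub (ω : Circle) (x : PowerSeries (QAlg (ω : ℂ))) :
    pstar ω (1 - x) = 1 - pstar ω x := by
  ext n
  rw [coeff_pstar, map_sub, map_sub, coeff_pstar, star_sub, PowerSeries.coeff_one]
  split_ifs <;> simp

theorem coeff_pgen (ω : ℂ) (i : ℤ) (n : ℕ) :
    PowerSeries.coeff n (pgen ω i) = if n = 1 then u ω i else 0 := by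
  unfold pgen
  cases n with
  | zero => rw [PowerSeries.coeff_zero_X_mul, if_neg (by omega)]
  | succ n => rw [PowerSeries.coeff_succ_X_mul, PowerSeries.coeff_C]; simp

theorem pstar_pgen (ω : Circle) (i : ℤ) : pstar ω (pgen ω i) = pgen ω i := by
  ext n
  rw [coeff_pstar, coeff_pgen]
  split_ifs <;> simp [star_u]

/-- The weights by which a word with smallest letter at least `x` differs from its reversal in the
current at `x`. -/
noncomputable def raise (ω : ℂ) (x i : ℤ) : ℂ := if i ≤ x then 1 else (-1) ^ x * ω

theorem X_dvd_pscale (ω : ℂ) (f : ℤ → ℂ) {x : PowerSeries (QAlg ω)} (h : PowerSeries.X ∣ x) :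
    PowerSeries.X ∣ pscale ω f x := by
  have := map_dvd (pscale ω f) h
  rwa [pscale, PowerSeries.map_X] at this

theorem pscale_one_sub (ω : ℂ) (f : ℤ → ℂ) (x : PowerSeries (QAlg ω)) :
    pscale ω f (1 - x) = 1 - pscale ω f x := by rw [map_sub, map_one]

/-- The weights `raise` satisfy precisely this recursion: in passing `u_x`, the neighbour `x + 1`
gains `(-1)^x ω`, and a higher letter changes its weight from `(-1)^{x+1} ω` to `(-1)^x ω`. -/
theorem pgen_mul_pscale_pgen (ω : ℂ) {x i : ℤ} (h : x < i) :
    pgen ω x * pscale ω (raise ω (x + 1)) (pgen ω i) =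
      pscale ω (raise ω x) (pgen ω i) * pgen ω x := by
  rw [pscale_pgen, pscale_pgen, mul_smul_comm, smul_mul_assoc, raise, raise]
  rcases eq_or_ne i (x + 1) with rfl | hi
  · rw [if_pos le_rfl, if_neg (by omega), one_smul, (towerRel_pgen ω).adjacent]
  · rw [if_neg (by omega), if_neg (by omega), (towerRel_pgen ω).far x i (by omega), zpow_add₀ (by norm_num)]
    module

theorem pgen_mul_pscale_highSeries (ω : ℂ) {x : ℤ} (d : ℕ) {y : ℤ} (h : x < y) :
    pgen ω x * pscale ω (raise ω (x + 1)) (highSeries ω d y) =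
      pscale ω (raise ω x) (highSeries ω d y) * pgen ω x := by
  induction d generalizing y with
  | zero => rw [highSeries_zero, map_zero, map_zero, mul_zero, zero_mul]
  | succ d ih =>
    have ih := ih (y := y + 1) (by omega)
    refine ((isAdic_X _).unit (X_dvd_pscale ω (raise ω x)
      (highSeries_dvd ω d (y + 1)))).mul_left_cancel ?_
    have e : pgen ω x * pscale ω (raise ω (x + 1)) (1 - highSeries ω d (y + 1)) =
        pscale ω (raise ω x) (1 - highSeries ω d (y + 1)) * pgen ω x := by
      rw [pscale_one_sub, pscale_one_sub, mul_sub, sub_mul, ih, one_mul, mul_one]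
    rw [← pscale_one_sub, ← mul_assoc, ← e, mul_assoc, ← mul_assoc (pscale ω (raise ω x) _),
      ← map_mul, ← map_mul, mul_highSeries, pgen_mul_pscale_pgen ω h]

theorem raise_self (ω : ℂ) (x : ℤ) : raise ω x x = 1 := if_pos le_rfl

/-- The conjugate of `(1 - R_{x+1})⁻¹ v_x` has `v_x` on the left. Moving it back to the right turns
the weights of `raise` at `x + 1`, given by induction, into those at `x`. -/
theorem pstar_highSeries (ω : Circle) (d : ℕ) (x : ℤ) :
    pstar ω (highSeries ω d x) = pscale ω (raise ω x) (highSeries ω d x) := by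
  induction d generalizing x with
  | zero =>
    rw [highSeries_zero, map_zero]
    ext n
    simp [coeff_pstar]
  | succ d ih =>
    have h1 := congrArg (pstar ω) (mul_highSeries (ω : ℂ) d x)
    have h2 := congrArg (pscale ω (raise ω x)) (mul_highSeries (ω : ℂ) d x)
    have h3 := pgen_mul_pscale_highSeries (ω : ℂ) d (by omega : x < x + 1)
    rw [pstar_mul, pstar_one_sub, ih, pstar_pgen] at h1
    rw [map_mul, pscale_one_sub, pscale_pgen, raise_self, one_smul] at h2
    have u1 := (isAdic_X _).unit (X_dvd_pscale (ω : ℂ) (raise ω (x + 1))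
      (highSeries_dvd (ω : ℂ) d (x + 1)))
    have u2 := (isAdic_X _).unit (X_dvd_pscale (ω : ℂ) (raise ω x)
      (highSeries_dvd (ω : ℂ) d (x + 1)))
    refine u1.mul_right_cancel (h1.trans (u2.mul_left_cancel ?_))
    rw [← mul_assoc, h2, mul_sub, sub_mul, h3, one_mul, mul_one]

/-- In a window with bottom `k`, an admissible word at `k` ends with `k`; cutting after each `k`
shows it as a nonempty product of high atoms. Here `T_k` has depth one and is just `v_k`. -/
theorem one_sub_highSeries_mul (ω : ℂ) (d : ℕ) (k : ℤ) :
    (1 - highSeries ω (d + 1) k) * slowSeries ω k (k + d) k k = highSeries ω (d + 1) k := by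
  have h := slowSeries_mid ω 0 d k
  have h1 := lowSeries_mul ω 0 k
  rw [lowSeries_zero, sub_zero, mul_one, zero_add] at h1
  rw [zero_add, h1, Nat.cast_zero, sub_zero] at h
  have h2 := mul_highSeries ω d k
  refine ((isAdic_X _).unit (highSeries_dvd ω d (k + 1))).mul_left_cancel ?_
  rw [h2, ← mul_assoc, mul_sub, h2, mul_one,
    sub_sub, add_comm]
  exact h

theorem star_currentMin (ω : Circle) (m : ℕ) (k : ℤ) :
    star (currentMin ω m k k) = scale ω (raise ω k) (currentMin ω m k k) := by
  classical
  have hR := highSeries_dvd (ω : ℂ) (m + 1) k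
  have hF := one_sub_highSeries_mul (ω : ℂ) m k
  set R := highSeries (ω : ℂ) (m + 1) k with hRdef
  set F := slowSeries (ω : ℂ) k (k + m) k k with hFdef
  -- `F = (1 - R)⁻¹ R` commutes with `R`, which matches the reversed order of factors after
  -- conjugation.
  have hF' : F * (1 - R) = R := by
    refine ((isAdic_X _).unit hR).mul_left_cancel ?_
    rw [← mul_assoc, hF, mul_sub, sub_mul, one_mul, mul_one]
  have hs : pstar ω F = pscale ω (raise ω k) F := by
    have h1 := congrArg (pstar ω) hF
    have h2 := congrArg (pscale ω (raise ω k)) hF'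
    rw [pstar_mul, pstar_one_sub, hRdef, pstar_highSeries, ← hRdef] at h1
    rw [map_mul, pscale_one_sub] at h2
    exact ((isAdic_X _).unit (X_dvd_pscale (ω : ℂ) _ hR)).mul_right_cancel (h1.trans h2.symm)
  have hc : PowerSeries.coeff m F = currentMin ω m k k := by
    rw [hFdef, slowSeries, PowerSeries.coeff_mk, currentMin]
    congr 1
    ext l
    rw [mem_slowWords, Finset.mem_filter, mem_adm]
    constructor
    · rintro ⟨h1, h2, h3⟩
      have h4 : l ∈ adm m k := mem_adm.2 ⟨h1, h3⟩
      exact ⟨⟨h1, h3⟩, mem_adm_self h4, fun y hy => (h2 y hy).1⟩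
    · rintro ⟨⟨h1, h2⟩, h3⟩
      refine ⟨h1, fun y hy => ⟨h3.2 y hy, ?_⟩, h2⟩
      rw [← h1]
      exact (bounds_of_isChain_slow h2 y hy).2
  rw [← hc, ← coeff_pstar, hs, coeff_pscale]

theorem norm_neg_one_zpow_mul (ω : Circle) (k : ℤ) : ‖(-1 : ℂ) ^ k * ω‖ = 1 := by
  rw [norm_mul, norm_zpow, norm_neg, norm_one, one_zpow, Circle.norm_coe, one_mul]

theorem conj_eig_mul_eig (ω : Circle) (j : ℤ) (s : Multiset ℤ) :
    (s.map fun i => starRingEnd ℂ (theta ω j i)).prod * eig ω j s = 1 := by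
  rw [eig, ← Multiset.prod_map_mul]
  refine Multiset.prod_eq_one fun x hx => ?_
  obtain ⟨i, -, rfl⟩ := Multiset.mem_map.1 hx
  rw [← Complex.normSq_eq_conj_mul_self, Complex.normSq_eq_norm_sq]
  unfold theta
  split_ifs
  · simp
  · rw [norm_neg_one_zpow_mul]; simp
  · simp

/-- Exactly one of the two weights of a letter is nontrivial, and it is `(-1)^k ω`; the signs cancel
because the number of letters is even. -/
theorem raise_mul_eig {ω : ℂ} {k : ℤ} {s : Multiset ℤ} (hs : Even (Multiset.card s))
    (h : ∀ i ∈ s, k ≤ i) : (s.map (raise ω k)).prod * eig ω k s = ω ^ Multiset.card s := by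
  have : (s.map fun i => raise ω k i * theta ω k i) = s.map fun _ => (-1) ^ k * ω := by
    refine Multiset.map_congr rfl fun i hi => ?_
    have := h i hi
    rw [raise, theta, if_neg (by omega : ¬ i < k)]
    by_cases hik : i = k
    · rw [if_pos hik.le, if_pos hik, one_mul]
    · rw [if_neg (by omega), if_neg hik, mul_one]
  rw [eig, ← Multiset.prod_map_mul, this, Multiset.map_const', Multiset.prod_replicate, mul_pow,
    ← zpow_natCast, zpow_comm, zpow_natCast, hs.neg_one_pow, one_zpow, one_mul]

theorem cf_star_density {ω : Circle} {m : ℕ} {k : ℤ} {s : Multiset ℤ}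
    (h : ¬((k ∈ s ∧ ∀ y ∈ s, k ≤ y) ∧ Multiset.card s = m)) :
    cf ω s (star (density ω m k)) = 0 := by
  classical
  rw [density, star_sum, map_sum]
  refine Finset.sum_eq_zero fun l hl => ?_
  rw [star_smul_eq, star_word, map_smul, cf_word, if_neg, smul_zero]
  rintro rfl
  rw [Finset.mem_filter, mem_adm] at hl
  refine h ⟨?_, by simp [hl.1.1]⟩
  simpa [IsMin] using hl.2

theorem star_density (ω : Circle) {m : ℕ} (hm : Even m) (hr : Regular ω m) (k : ℤ) :
    star (density ω m k) = -((ω : ℂ) ^ m • density ω m k) := by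
  classical
  have h1 := scale_theta_density (Circle.norm_coe ω).ge hm hr k k
  have h2 := congrArg star h1
  rw [star_scale, star_add, star_currentMin] at h2
  refine ext_cf fun s => ?_
  have h1 := congrArg (cf ω s) h1
  have h2 := congrArg (cf ω s) h2
  rw [cf_scale, map_add] at h1 h2
  rw [cf_scale] at h2
  rw [map_neg, map_smul, smul_eq_mul]
  by_cases hs : (k ∈ s ∧ ∀ y ∈ s, k ≤ y) ∧ Multiset.card s = m
  · have e1 := conj_eig_mul_eig ω k s
    have e2 := raise_mul_eig (ω := ω) (hs.2 ▸ hm) hs.1.2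
    have e3 : eig ω k s - 1 ≠ 0 := sub_ne_zero.2 (hr.eig_ne_one hs.1.1 hs.2 hs.1.2)
    rw [hs.2] at e2
    change eig ω k s * _ = _ at h1
    -- Let `e` be the eigenvalue, `c` the coefficient of the current and `δ*` that of the conjugate
    -- density. Multiplying the conjugated potential equation by `e`, whose conjugate is its
    -- inverse, gives `(e - 1) δ* = -ω^m c`, and `c` is `e - 1` times the coefficient of the
    -- density.
    refine mul_left_cancel₀ e3 ?_
    linear_combination (-eig ω k s) * h2 + cf ω s (star (density ω m k)) * e1 -
      cf ω s (currentMin ω m k k) * e2 + (ω : ℂ) ^ m * h1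
  · rw [cf_star_density hs, cf_density]
    split_ifs with h
    · rw [cf_current_of_card_ne fun h' => hs ⟨h, h'⟩]; simp
    · simp

theorem star_hamiltonianTerm (ω : Circle) {m : ℕ} (hm0 : 0 < m) (hm : Even m)
    (hr : Regular ω m) (k : ℤ) : star (hamiltonianTerm ω m k) = hamiltonianTerm ω m k := by
  rw [hamiltonianTerm_eq (Circle.coe_ne_zero ω) hm0, star_smul_eq, star_density ω hm hr, smul_neg,
    smul_smul]
  have h : starRingEnd ℂ (ω : ℂ) * ω = 1 := by
    rw [← Complex.normSq_eq_conj_mul_self, Complex.normSq_eq_norm_sq, Circle.norm_coe]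
    norm_num
  have h' : starRingEnd ℂ (ω : ℂ) ^ m * (ω : ℂ) ^ m = 1 := by rw [← mul_pow, h, one_pow]
  have e : starRingEnd ℂ ((ω : ℂ) ^ m - 1) * (ω : ℂ) ^ m = -((ω : ℂ) ^ m - 1) := by
    rw [map_sub, map_one, map_pow]
    linear_combination h'
  rw [e, neg_smul, neg_neg]

theorem isSelfAdjoint_hamiltonian (ω : Circle) (l : ℕ+) (hr : Regular ω (2 * l)) :
    IsSelfAdjoint (hamiltonian ω l) := by
  have hm : 0 < 2 * (l : ℕ) := Nat.mul_pos two_pos l.pos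
  refine Subtype.ext (funext fun N => ?_)
  have hfin := hamiltonianTerm_finite (ω : ℂ) (2 * l) hm N
  change star (∑ᶠ k, trunc ω N (hamiltonianTerm ω (2 * l) k)) =
    ∑ᶠ k, trunc ω N (hamiltonianTerm ω (2 * l) k)
  refine ((starAddEquiv : QAlg (ω : ℂ) ≃+ QAlg (ω : ℂ)).toAddMonoidHom.map_finsum hfin).trans
    (finsum_congr fun k => ?_)
  change star (trunc ω N _) = _
  rw [← trunc_star, star_hamiltonianTerm ω hm (even_two_mul _) hr]

/-! ### Insertions of admissible words -/

/-- The letters of a word at the site `j`, with the virtual first letter `j + 1` and the virtual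
last letter `j - 1`. -/
def ext (j : ℤ) (l : List ℤ) (k : ℕ) : ℤ := ((j + 1) :: (l ++ [j - 1])).getD k 0

theorem mem_adm_iff_ext {m : ℕ} {j : ℤ} {l : List ℤ} :
    l ∈ adm m j ↔ l.length = m ∧ ∀ k ≤ m, ext j l k ≤ ext j l (k + 1) + 1 := by
  rw [mem_adm, List.isChain_iff_getElem]
  refine and_congr_right fun hl => ⟨fun h k hk => ?_, fun h k hk => ?_⟩
  · have := h k (by simp; omega)
    unfold ext
    rwa [List.getD_eq_getElem _ _ (by simp; omega), List.getD_eq_getElem _ _ (by simp; omega)]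
  · simp only [List.length_cons, List.length_append, List.length_nil] at hk
    have := h k (by omega)
    unfold ext at this
    rwa [List.getD_eq_getElem _ _ (by simp; omega),
      List.getD_eq_getElem _ _ (by simp; omega)] at this

theorem ext_zero (j : ℤ) (l : List ℤ) : ext j l 0 = j + 1 := rfl

theorem ext_succ {j : ℤ} {l : List ℤ} {k : ℕ} (h : k < l.length) :
    ext j l (k + 1) = l.getD k 0 := by
  rw [ext, List.getD_cons_succ, List.getD_append _ _ _ _ h]

theorem ext_last {j : ℤ} {l : List ℤ} {k : ℕ} (h : k = l.length + 1) : ext j l k = j - 1 := by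
  subst h
  rw [ext, List.getD_cons_succ, List.getD_append_right _ _ _ _ le_rfl]
  simp

theorem ext_append_left (j : ℤ) (a b b' : List ℤ) {k : ℕ} (h : k ≤ a.length) :
    ext j (a ++ b) k = ext j (a ++ b') k := by
  unfold ext
  rw [List.append_assoc, List.append_assoc, ← List.cons_append, ← List.cons_append,
    List.getD_append _ _ _ _ (by simp; omega), List.getD_append _ _ _ _ (by simp; omega)]

theorem ext_append_right (j : ℤ) (a a' b : List ℤ) {k k' : ℕ} (n : ℕ) (h : k = a.length + n + 1)
    (h' : k' = a'.length + n + 1) : ext j (a ++ b) k = ext j (a' ++ b) k' := by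
  subst h h'
  unfold ext
  rw [List.getD_cons_succ, List.getD_cons_succ, List.append_assoc, List.append_assoc,
    List.getD_append_right a _ _ _ (by omega), List.getD_append_right a' _ _ _ (by omega),
    Nat.add_sub_cancel_left, Nat.add_sub_cancel_left]

theorem ext_mid (j c : ℤ) (a W b : List ℤ) {k k' : ℕ} (n : ℕ) (hn : n < W.length)
    (h : k = a.length + n + 1) (h' : k' = n + 1) :
    ext j (a ++ (W ++ b)) k = ext c W k' := by
  subst h h'
  rw [ext_succ hn, ext_succ (by simp; omega), List.getD_append_right _ _ _ _ (by omega),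
    Nat.add_sub_cancel_left, List.getD_append _ _ _ _ hn]

/-- Admissible words into which an admissible word has been inserted. -/
theorem insert_iff {p q i : ℕ} (hp : 0 < p) {j c : ℤ} {a W b : List ℤ} (ha : a.length = i)
    (hW : W.length = p) (hb : i + b.length = q) :
    a ++ b ∈ adm q j ∧ W ∈ adm p c ↔
      ((∀ k ≤ p + q, k ≠ i → k ≠ i + p →
          ext j (a ++ (W ++ b)) k ≤ ext j (a ++ (W ++ b)) (k + 1) + 1) ∧
        ext j (a ++ (W ++ b)) i ≤ ext j (a ++ (W ++ b)) (i + p + 1) + 1) ∧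
      c ≤ ext j (a ++ (W ++ b)) (i + 1) ∧ ext j (a ++ (W ++ b)) (i + p) ≤ c := by
  have hl : ∀ k ≤ i, ext j (a ++ b) k = ext j (a ++ (W ++ b)) k := fun k hk =>
    ext_append_left j a b _ (by omega)
  have hr : ∀ n, ext j (a ++ b) (i + n + 1) = ext j (a ++ (W ++ b)) (i + p + n + 1) := fun n => by
    rw [← List.append_assoc]
    exact ext_append_right j a (a ++ W) b n (by omega) (by simp; omega)
  have hm : ∀ n < p, ext j (a ++ (W ++ b)) (i + n + 1) = ext c W (n + 1) := fun n hn =>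
    ext_mid j c a W b n (by omega) (by omega) rfl
  have h0 : ext c W 0 = c + 1 := rfl
  have h1 : ext c W (p + 1) = c - 1 := ext_last (by omega)
  rw [mem_adm_iff_ext, mem_adm_iff_ext]
  constructor
  · rintro ⟨⟨-, h2⟩, -, h3⟩
    refine ⟨⟨fun k hk hki hkp => ?_, ?_⟩, ?_, ?_⟩
    · rcases lt_or_ge k i with h | h
      · have := h2 k (by omega)
        rwa [hl k (by omega), hl (k + 1) (by omega)] at this
      · rcases lt_or_ge k (i + p) with h' | h'
        · obtain ⟨n, rfl⟩ : ∃ n, k = i + n + 1 := ⟨k - i - 1, by omega⟩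
          have := h3 (n + 1) (by omega)
          rwa [← hm n (by omega), ← hm (n + 1) (by omega)] at this
        · obtain ⟨n, rfl⟩ : ∃ n, k = i + p + n + 1 := ⟨k - i - p - 1, by omega⟩
          have := h2 (i + n + 1) (by omega)
          rwa [hr, show i + n + 1 + 1 = i + (n + 1) + 1 by ring, hr] at this
    · have := h2 i (by omega)
      have h4 := hr 0
      rw [add_zero, add_zero] at h4
      rwa [hl i le_rfl, h4] at this
    · have := h3 0 (by omega)
      have h4 := hm 0 hp
      rw [h0, ← h4] at this
      simpa using this
    · have := h3 p le_rfl
      obtain ⟨n, rfl⟩ : ∃ n, p = n + 1 := ⟨p - 1, by omega⟩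
      rw [h1, ← hm n (by omega)] at this
      change ext j _ (i + n + 1) ≤ c
      omega
  · rintro ⟨⟨h2, h3⟩, h4, h5⟩
    refine ⟨⟨by simp; omega, fun k hk => ?_⟩, hW, fun k hk => ?_⟩
    · rcases lt_trichotomy k i with h | rfl | h
      · rw [hl k (by omega), hl (k + 1) (by omega)]
        exact h2 k (by omega) (by omega) (by omega)
      · have h6 := hr 0
        rw [add_zero, add_zero] at h6
        rwa [hl k le_rfl, h6]
      · obtain ⟨n, rfl⟩ : ∃ n, k = i + n + 1 := ⟨k - i - 1, by omega⟩
        rw [hr, show i + n + 1 + 1 = i + (n + 1) + 1 by ring, hr]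
        exact h2 _ (by omega) (by omega) (by omega)
    · rcases Nat.eq_zero_or_pos k with rfl | h
      · have h6 := hm 0 hp
        rw [zero_add, add_zero] at h6
        rw [h0, zero_add, ← h6]
        omega
      · obtain ⟨n, rfl⟩ : ∃ n, k = n + 1 := ⟨k - 1, by omega⟩
        rcases hk.eq_or_lt with h | h
        · rw [h, h1, ← h, ← hm n (by omega)]
          rw [← h] at h5
          change ext j _ (i + n + 1) ≤ c at h5
          omega
        · rw [← hm n (by omega), ← hm (n + 1) h]
          exact h2 _ (by omega) (by omega) (by omega)

theorem mem_adm_add_iff {p q i : ℕ} {j : ℤ} {u : List ℤ} (hp : 0 < p) (hi : i ≤ q)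
    (hu : u.length = p + q) :
    u ∈ adm (p + q) j ↔ (∀ k ≤ p + q, k ≠ i → k ≠ i + p → ext j u k ≤ ext j u (k + 1) + 1) ∧
      ext j u i ≤ ext j u (i + 1) + 1 ∧ ext j u (i + p) ≤ ext j u (i + p + 1) + 1 := by
  rw [mem_adm_iff_ext]
  refine ⟨fun h => ⟨fun k hk _ _ => h.2 k hk, h.2 _ (by omega), h.2 _ (by omega)⟩,
    fun h => ⟨hu, fun k hk => ?_⟩⟩
  by_cases h1 : k = i
  · rw [h1]; exact h.2.1
  · by_cases h2 : k = i + p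
    · rw [h2]; exact h.2.2
    · exact h.1 k hk h1 h2

/-- The block is recovered by cutting at the fixed positions `i` and `i + p`, so insertion is a
bijection even though the site of the block depends on the outer word. -/
theorem sum_insert {A : Type*} [AddCommMonoid A] (f : List ℤ → A) {p q i : ℕ} (hi : i ≤ q)
    {j : ℤ} (c : List ℤ → ℤ) (P : List ℤ → Prop) [DecidablePred P]
    (h : ∀ a W b : List ℤ, a.length = i → W.length = p → i + b.length = q →
      (a ++ b ∈ adm q j ∧ W ∈ adm p (c (a ++ b)) ↔
        a ++ (W ++ b) ∈ adm (p + q) j ∧ P (a ++ (W ++ b)))) :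
    ∑ l ∈ adm q j, ∑ W ∈ adm p (c l), f (l.take i ++ (W ++ l.drop i)) =
      ∑ u ∈ (adm (p + q) j).filter P, f u := by
  rw [Finset.sum_sigma']
  refine Finset.sum_bij' (fun x _ => x.1.take i ++ (x.2 ++ x.1.drop i))
    (fun u _ => ⟨u.take i ++ (u.drop i).drop p, (u.drop i).take p⟩) ?_ ?_ ?_ ?_ ?_
  · rintro ⟨l, W⟩ hx
    rw [Finset.mem_sigma] at hx
    have h1 : l.length = q := (mem_adm.1 hx.1).1
    have h2 : W.length = p := (mem_adm.1 hx.2).1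
    rw [Finset.mem_filter]
    refine (h _ _ _ (by simp; omega) h2 (by simp; omega)).1 ?_
    rw [List.take_append_drop]
    exact hx
  · intro u hu
    rw [Finset.mem_filter] at hu
    have h1 := (mem_adm.1 hu.1).1
    rw [Finset.mem_sigma]
    refine (h _ _ _ (by simp; omega) (by simp; omega) (by simp; omega)).2 ?_
    rw [List.take_append_drop, List.take_append_drop]
    exact hu
  · rintro ⟨l, W⟩ hx
    rw [Finset.mem_sigma] at hx
    have h1 : l.length = q := (mem_adm.1 hx.1).1
    have h2 : W.length = p := (mem_adm.1 hx.2).1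
    have h3 : (l.take i).length = i := by simp; omega
    rw [Sigma.mk.injEq, heq_eq_eq]
    constructor
    · change List.take i (l.take i ++ (W ++ l.drop i)) ++
        List.drop p (List.drop i (l.take i ++ (W ++ l.drop i))) = l
      rw [List.take_left' h3, List.drop_left' h3, List.drop_left' h2, List.take_append_drop]
    · change List.take p (List.drop i (l.take i ++ (W ++ l.drop i))) = W
      rw [List.drop_left' h3, List.take_left' h2]
  · intro u hu
    have h1 := (mem_adm.1 (Finset.mem_filter.1 hu).1).1
    have h3 : (u.take i).length = i := by simp; omega
    change List.take i (u.take i ++ _) ++ (List.take p (u.drop i) ++ List.drop i (u.take i ++ _)) = u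
    rw [List.take_left' h3, List.drop_left' h3, List.take_append_drop, List.take_append_drop]
  · exact fun _ _ => rfl

/-- The first inequality says that the outer word is admissible without the block, the second that
the block ends no higher than its site. That it starts high enough is already slowness of `u` at
`i`. -/
theorem sum_insert_after {A : Type*} [AddCommMonoid A] (f : List ℤ → A) {p q i : ℕ}
    (hp : 0 < p) (hi : i ≤ q) (j : ℤ) :
    ∑ l ∈ adm q j, ∑ W ∈ adm p (ext j l i - 1), f (l.take i ++ (W ++ l.drop i)) =
      ∑ u ∈ adm (p + q) j, if ext j u i ≤ ext j u (i + p + 1) + 1 ∧ ext j u (i + p) < ext j u i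
        then f u else 0 := by
  rw [← Finset.sum_filter]
  refine sum_insert f hi (fun l => ext j l i - 1) _ fun a W b ha hW hb => ?_
  rw [insert_iff hp ha hW hb, mem_adm_add_iff hp hi (by simp; omega),
    ext_append_left j a b (W ++ b) ha.ge]
  constructor
  · rintro ⟨⟨h1, h2⟩, h3, h4⟩
    exact ⟨⟨h1, by omega, by omega⟩, by omega, by omega⟩
  · rintro ⟨⟨h1, h2, h3⟩, h4, h5⟩
    exact ⟨⟨h1, by omega⟩, by omega, by omega⟩

theorem sum_insert_before {A : Type*} [AddCommMonoid A] (f : List ℤ → A) {p q i : ℕ}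
    (hp : 0 < p) (hi : i ≤ q) (j : ℤ) :
    ∑ l ∈ adm q j, ∑ W ∈ adm p (ext j l (i + 1) + 1), f (l.take i ++ (W ++ l.drop i)) =
      ∑ u ∈ adm (p + q) j, if ext j u i ≤ ext j u (i + p + 1) + 1 ∧
        ext j u (i + p + 1) < ext j u (i + 1) then f u else 0 := by
  rw [← Finset.sum_filter]
  refine sum_insert f hi (fun l => ext j l (i + 1) + 1) _ fun a W b ha hW hb => ?_
  have e : ext j (a ++ b) (i + 1) = ext j (a ++ (W ++ b)) (i + p + 1) := by
    rw [← List.append_assoc]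
    exact ext_append_right j a (a ++ W) b 0 (by omega) (by simp; omega)
  rw [insert_iff hp ha hW hb, mem_adm_add_iff hp hi (by simp; omega), e]
  constructor
  · rintro ⟨⟨h1, h2⟩, h3, h4⟩
    exact ⟨⟨h1, by omega, by omega⟩, by omega, by omega⟩
  · rintro ⟨⟨h1, h2, h3⟩, h4, h5⟩
    exact ⟨⟨h1, by omega⟩, by omega, by omega⟩

theorem current_mul_current (ω : ℂ) {p : ℕ} (hp : 0 < p) (q : ℕ) (j : ℤ) :
    current ω p j * current ω q j = ∑ u ∈ adm (p + q) j,
      if ext j u p ≤ j ∧ j ≤ ext j u (p + 1) then word ω u else 0 := by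
  rw [← Finset.sum_filter, current, current, Finset.sum_mul_sum, Finset.sum_comm,
    ← sum_insert (word ω) (Nat.zero_le q) (fun _ => j)]
  · simp
  · intro a W b ha hW hb
    rw [insert_iff hp ha hW hb, mem_adm_add_iff hp (Nat.zero_le q) (by simp; omega), zero_add,
      zero_add, ext_zero]
    constructor
    · rintro ⟨⟨h1, h2⟩, h3, h4⟩
      exact ⟨⟨h1, by omega, by omega⟩, by omega, by omega⟩
    · rintro ⟨⟨h1, h2, h3⟩, h4, h5⟩
      exact ⟨⟨h1, by omega⟩, by omega, by omega⟩

/-! ### The derivation of words -/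

/-- The derivation `u_n ↦ u_n X_{n-1} - X_{n+1} u_n`, with the currents `X`, on words. -/
noncomputable def flow (ω : ℂ) (m : ℕ) : List ℤ → QAlg ω
  | [] => 0
  | n :: l => (u ω n * current ω m (n - 1) - current ω m (n + 1) * u ω n) * word ω l +
      u ω n * flow ω m l

theorem flow_eq (ω : ℂ) (m : ℕ) (l : List ℤ) :
    flow ω m l = ∑ i ∈ Finset.range l.length,
      (∑ W ∈ adm m (l.getD i 0 - 1), word ω (l.take (i + 1) ++ (W ++ l.drop (i + 1))) -
        ∑ W ∈ adm m (l.getD i 0 + 1), word ω (l.take i ++ (W ++ l.drop i))) := by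
  induction l with
  | nil => rfl
  | cons n l ih =>
    rw [flow, ih, List.length_cons, Finset.sum_range_succ', add_comm, Finset.mul_sum]
    congr 1
    · refine Finset.sum_congr rfl fun i _ => ?_
      simp [mul_sub, Finset.mul_sum]
    · simp [current, sub_mul, Finset.mul_sum, Finset.sum_mul, mul_assoc]

/-- A telescoping sum: inserting after a letter and inserting before the same letter differ only in
which pair of outer neighbours must be compatible. The virtual letters `j + 1` and `j - 1` supply
the two boundary terms. -/
theorem sum_flow (ω : ℂ) {p : ℕ} (hp : 0 < p) (q : ℕ) (j : ℤ) :
    ∑ l ∈ adm q j, flow ω p l = ∑ u ∈ adm (p + q) j,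
      ((if ext j u q ≤ j then word ω u else 0) -
        (if j ≤ ext j u (p + 1) then word ω u else 0)) := by
  have h1 : ∀ l ∈ adm q j, flow ω p l = ∑ i ∈ Finset.range q,
      (∑ W ∈ adm p (ext j l (i + 1) - 1), word ω (l.take (i + 1) ++ (W ++ l.drop (i + 1))) -
        ∑ W ∈ adm p (ext j l (i + 1) + 1), word ω (l.take i ++ (W ++ l.drop i))) := by
    intro l hl
    have hlq := (mem_adm.1 hl).1
    rw [flow_eq, hlq]
    refine Finset.sum_congr rfl fun i hi => ?_
    rw [Finset.mem_range] at hi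
    rw [ext_succ (by omega)]
  rw [Finset.sum_congr rfl h1, Finset.sum_comm]
  have h2 : ∀ i ∈ Finset.range q, ∑ l ∈ adm q j,
      (∑ W ∈ adm p (ext j l (i + 1) - 1), word ω (l.take (i + 1) ++ (W ++ l.drop (i + 1))) -
        ∑ W ∈ adm p (ext j l (i + 1) + 1), word ω (l.take i ++ (W ++ l.drop i))) =
      ∑ u ∈ adm (p + q) j,
        ((if ext j u (i + 1) ≤ ext j u (i + 1 + p + 1) + 1 then word ω u else 0) -
          (if ext j u i ≤ ext j u (i + p + 1) + 1 then word ω u else 0)) := by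
    intro i hi
    rw [Finset.mem_range] at hi
    rw [Finset.sum_sub_distrib, sum_insert_after (word ω) hp (by omega) j,
      sum_insert_before (word ω) hp (by omega) j, ← Finset.sum_sub_distrib]
    refine Finset.sum_congr rfl fun u hu => ?_
    have h3 := (mem_adm_iff_ext.1 hu).2 i (by omega)
    have h4 := (mem_adm_iff_ext.1 hu).2 (i + p + 1) (by omega)
    rw [show i + 1 + p = i + p + 1 by ring]
    -- Both insertions carry the same strict inequality. When it fails, both remaining conditions
    -- hold automatically, so it may be dropped from the difference.
    by_cases h5 : ext j u (i + p + 1) < ext j u (i + 1)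
    · simp only [h5, and_true]
    · rw [if_neg (fun h => h5 h.2), if_neg (fun h => h5 h.2), if_pos (by omega),
        if_pos (by omega), sub_self, sub_self]
  rw [Finset.sum_congr rfl h2, Finset.sum_comm]
  refine Finset.sum_congr rfl fun u hu => ?_
  rw [Finset.sum_range_sub fun i =>
    if ext j u i ≤ ext j u (i + p + 1) + 1 then word ω u else 0]
  have hl := (mem_adm.1 hu).1
  rw [ext_last (k := q + p + 1) (by omega), ext_zero, sub_add_cancel, zero_add]
  simp only [add_le_add_iff_right]

/-- The flows of the currents commute. -/
theorem sum_flow_sub_sum_flow (ω : ℂ) {p q : ℕ} (hp : 0 < p) (hq : 0 < q) (j : ℤ) :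
    ∑ l ∈ adm q j, flow ω p l - ∑ l ∈ adm p j, flow ω q l +
      (current ω p j * current ω q j - current ω q j * current ω p j) = 0 := by
  rw [sum_flow ω hp, sum_flow ω hq, current_mul_current ω hp, current_mul_current ω hq,
    add_comm q p, ← Finset.sum_sub_distrib, ← Finset.sum_sub_distrib, ← Finset.sum_add_distrib]
  refine Finset.sum_eq_zero fun u hu => ?_
  have h1 := (mem_adm_iff_ext.1 hu).2 p (by omega)
  have h2 := (mem_adm_iff_ext.1 hu).2 q (by omega)
  -- Inclusion and exclusion at one cut of the word: neighbours with `x ≤ y + 1` satisfy `x ≤ j` or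
  -- `j ≤ y`. The six terms are this identity for the cut after position `q` minus the one after
  -- position `p`.
  have key : ∀ x y : ℤ, x ≤ y + 1 → (if x ≤ j then word ω u else 0) +
      (if j ≤ y then word ω u else 0) - (if x ≤ j ∧ j ≤ y then word ω u else 0) = word ω u := by
    intro x y hxy
    by_cases hx : x ≤ j <;> by_cases hy : j ≤ y
    · simp [hx, hy]
    · simp [hx, hy]
    · simp [hx, hy]
    · omega
  refine Eq.trans ?_ (sub_eq_zero.2 ((key _ _ h2).trans (key _ _ h1).symm))
  abel

/-! ### Commuting Hamiltonians -/

/-- Truncation is a rescaling with weights `0` and `1`, hence commutes with every `θ_j`. -/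
theorem trunc_eq_scale (ω : ℂ) (N : ℕ) (a : QAlg ω) :
    trunc ω N a = scale ω (fun n => if |n| < (N : ℤ) then 1 else 0) a := by
  induction a using QAlg.induction with
  | hc c => rw [AlgHom.commutes, AlgHom.commutes]
  | hu n => rw [trunc_u, scale_u]; split_ifs <;> simp
  | hadd a b ha hb => rw [map_add, map_add, ha, hb]
  | hmul a b ha hb => rw [map_mul, map_mul, ha, hb]

theorem scale_trunc (ω : ℂ) (f : ℤ → ℂ) (N : ℕ) (a : QAlg ω) :
    scale ω f (trunc ω N a) = trunc ω N (scale ω f a) := by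
  rw [trunc_eq_scale, trunc_eq_scale, scale_scale, scale_scale, mul_comm]

theorem trunc_word_eq_zero (ω : ℂ) {N : ℕ} {k : ℤ} {l : List ℤ} (hk : k ∈ l)
    (h : k ∉ Finset.Ioo (-(N : ℤ)) N) : trunc ω N (word ω l) = 0 := by
  rw [trunc_eq_scale, scale_word, Multiset.prod_eq_zero, zero_smul]
  refine Multiset.mem_map.2 ⟨k, by simpa using hk, if_neg ?_⟩
  rwa [abs_lt, ← Finset.mem_Ioo]

theorem trunc_density_eq_zero (ω : ℂ) (m : ℕ) {N : ℕ} {k : ℤ}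
    (h : k ∉ Finset.Ioo (-(N : ℤ)) N) : trunc ω N (density ω m k) = 0 := by
  classical
  rw [density, map_sum]
  refine Finset.sum_eq_zero fun l hl => ?_
  rw [map_smul, trunc_word_eq_zero ω (Finset.mem_filter.1 hl).2.1 h, smul_zero]

theorem trunc_currentMin_eq_zero (ω : ℂ) (m : ℕ) (j : ℤ) {N : ℕ} {k : ℤ}
    (h : k ∉ Finset.Ioo (-(N : ℤ)) N) : trunc ω N (currentMin ω m j k) = 0 := by
  classical
  rw [currentMin, map_sum]
  exact Finset.sum_eq_zero fun l hl =>
    trunc_word_eq_zero ω (Finset.mem_filter.1 hl).2.1 h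

theorem sum_trunc_currentMin (ω : ℂ) (m : ℕ) (j : ℤ) (N : ℕ) :
    ∑ k ∈ Finset.Ioo (-(N : ℤ)) N, trunc ω N (currentMin ω m j k) =
      trunc ω N (current ω m j) := by
  rw [← sum_currentMin ω (A := Finset.Ioo (-(N : ℤ)) N ∪ Finset.Icc (j - m) (j + m))
    Finset.subset_union_right, map_sum]
  exact Finset.sum_subset Finset.subset_union_left fun k _ hk =>
    trunc_currentMin_eq_zero ω m j hk

/-- The truncated Hamiltonian, up to a constant factor. -/
noncomputable def total (ω : ℂ) (m N : ℕ) : QAlg ω :=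
  ∑ k ∈ Finset.Ioo (-(N : ℤ)) N, trunc ω N (density ω m k)

theorem hamiltonian_apply {ω : ℂ} (hω : ω ≠ 0) (l : ℕ+) (N : ℕ) :
    (hamiltonian ω l).1 N = (ω ^ (2 * (l : ℕ)) - 1) • total ω (2 * l) N := by
  change ∑ᶠ k, trunc ω N (hamiltonianTerm ω (2 * l) k) = _
  have h : ∀ k, trunc ω N (hamiltonianTerm ω (2 * l) k) =
      (ω ^ (2 * (l : ℕ)) - 1) • trunc ω N (density ω (2 * l) k) := fun k => by
    rw [hamiltonianTerm_eq hω (Nat.mul_pos two_pos l.pos), map_smul]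
  rw [finsum_congr h, total, Finset.smul_sum, finsum_eq_sum_of_support_subset]
  intro k hk
  by_contra hk'
  rw [Finset.mem_coe] at hk'
  exact hk (by simp only [trunc_density_eq_zero ω _ hk', smul_zero])

theorem scale_theta_total {ω : ℂ} (hω : 1 ≤ ‖ω‖) {m : ℕ} (hm : Even m) (hr : Regular ω m)
    (j : ℤ) (N : ℕ) :
    scale ω (theta ω j) (total ω m N) = total ω m N + trunc ω N (current ω m j) := by
  rw [total, map_sum, ← sum_trunc_currentMin, ← Finset.sum_add_distrib]
  refine Finset.sum_congr rfl fun k _ => ?_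
  rw [scale_trunc, scale_theta_density hω hm hr, map_add]

theorem lie_total_u {ω : ℂ} (hω : 1 ≤ ‖ω‖) {m : ℕ} (hm : Even m) (hr : Regular ω m) (N : ℕ)
    (n : ℤ) :
    ⁅total ω m N, trunc ω N (u ω n)⁆ =
      trunc ω N (u ω n * current ω m (n - 1) - current ω m (n + 1) * u ω n) := by
  rw [Ring.lie_def, total, Finset.sum_mul, Finset.mul_sum, ← Finset.sum_sub_distrib, map_sub,
    map_mul, map_mul, ← sum_trunc_currentMin, ← sum_trunc_currentMin, Finset.mul_sum,
    Finset.sum_mul, ← Finset.sum_sub_distrib]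
  refine Finset.sum_congr rfl fun k _ => ?_
  rw [← map_mul, ← map_mul, ← map_sub, density_mul_u hω hm hr, map_sub, map_mul, map_mul]

theorem lie_total_word {ω : ℂ} (hω : 1 ≤ ‖ω‖) {m : ℕ} (hm : Even m) (hr : Regular ω m) (N : ℕ)
    (l : List ℤ) :
    ⁅total ω m N, trunc ω N (word ω l)⁆ = trunc ω N (flow ω m l) := by
  induction l with
  | nil => simp [flow, Ring.lie_def]
  | cons n l ih =>
    rw [word_cons, map_mul, lie_mul_eq, ih, lie_total_u hω hm hr, flow, map_add, map_mul, map_mul]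

theorem lie_total_current {ω : ℂ} (hω : 1 ≤ ‖ω‖) {m : ℕ} (hm : Even m) (hr : Regular ω m)
    (q : ℕ) (j : ℤ) (N : ℕ) :
    ⁅total ω m N, trunc ω N (current ω q j)⁆ = trunc ω N (∑ l ∈ adm q j, flow ω m l) := by
  rw [current, map_sum, map_sum, Ring.lie_def, Finset.mul_sum, Finset.sum_mul,
    ← Finset.sum_sub_distrib]
  exact Finset.sum_congr rfl fun l _ => lie_total_word hω hm hr N l

/-- By the potential equation the image is the commutator of `h_p + X_p` and `h_q + X_q`. The cross
terms are flows of currents, and they cancel with `[X_p, X_q]` by `sum_flow_sub_sum_flow`. -/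
theorem scale_theta_lie_total {ω : ℂ} (hω : 1 ≤ ‖ω‖) {p q : ℕ} (hp : Even p) (hq : Even q)
    (hp0 : 0 < p) (hq0 : 0 < q) (hrp : Regular ω p) (hrq : Regular ω q) (N : ℕ) (j : ℤ) :
    scale ω (theta ω j) ⁅total ω p N, total ω q N⁆ = ⁅total ω p N, total ω q N⁆ := by
  have h1 := lie_total_current hω hp hrp q j N
  have h2 := lie_total_current hω hq hrq p j N
  have h3 := congrArg (trunc ω N) (sum_flow_sub_sum_flow ω hp0 hq0 j)
  rw [map_add, map_sub, ← h1, ← h2, map_sub, map_mul, map_mul, map_zero] at h3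
  rw [Ring.lie_def, map_sub, map_mul, map_mul, scale_theta_total hω hp hrp,
    scale_theta_total hω hq hrq, ← sub_eq_zero, ← h3, Ring.lie_def, Ring.lie_def]
  simp only [mul_add, add_mul]
  abel

theorem scale_zero_total (ω : ℂ) (m N : ℕ) : scale ω (fun _ => 0) (total ω m N) = 0 := by
  classical
  rw [total, map_sum]
  refine Finset.sum_eq_zero fun k _ => ?_
  rw [scale_trunc, density, map_sum, Finset.sum_eq_zero, map_zero]
  intro l hl
  rw [map_smul, scale_word, Multiset.prod_eq_zero, zero_smul, smul_zero]
  exact Multiset.mem_map.2 ⟨k, by simpa using (Finset.mem_filter.1 hl).2.1, rfl⟩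

/-- Invariance under `θ_j` kills every content that contains `j`, as its eigenvalue is not `1` for
`|ω| > 1`. The empty content is excluded because sending all generators to `0` annihilates the
Hamiltonians. -/
theorem lie_total_of_one_lt {ω : ℂ} (hω : 1 < ‖ω‖) {p q : ℕ} (hp : Even p) (hq : Even q)
    (hp0 : 0 < p) (hq0 : 0 < q) (N : ℕ) : ⁅total ω p N, total ω q N⁆ = 0 := by
  refine ext_cf fun s => ?_
  rw [map_zero]
  rcases s.empty_or_exists_mem with rfl | ⟨j, hj⟩
  · have h := cf_scale ω (fun _ => 0) 0 ⁅total ω p N, total ω q N⁆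
    rw [Ring.lie_def, map_sub, map_mul, map_mul, scale_zero_total, scale_zero_total] at h
    simpa [Ring.lie_def] using h.symm
  · have h := congrArg (cf ω s) (scale_theta_lie_total hω.le hp hq hp0 hq0
      (regular_of_one_lt hω p) (regular_of_one_lt hω q) N j)
    rw [cf_scale] at h
    have h' : (eig ω j s - 1) * cf ω s ⁅total ω p N, total ω q N⁆ = 0 := by
      rw [sub_mul, one_mul, sub_eq_zero]; exact h
    exact (mul_eq_zero.1 h').resolve_left (sub_ne_zero.2 (eig_ne_one hω hj))

/-- The coefficient is a finite sum of polynomials in `ω` divided by factors `eig - 1`, which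
regularity keeps away from zero at the given point. -/
theorem continuousAt_cf_total_mul {ω : ℂ} {p q : ℕ} (hp : Regular ω p) (hq : Regular ω q)
    (N : ℕ) (s : Multiset ℤ) :
    ContinuousAt (fun ω => cf ω s (total ω p N * total ω q N)) ω := by
  classical
  have hc : ∀ m, Regular ω m → ∀ k, ∀ l ∈ (adm m k).filter (IsMin k),
      ContinuousAt (fun ω => (eig ω k l - 1)⁻¹) ω := by
    intro m hm k l hl
    rw [Finset.mem_filter] at hl
    refine ContinuousAt.inv₀ ((continuous_eig k l).sub continuous_const).continuousAt
      (sub_ne_zero.2 (hm.eig_ne_one ?_ ?_ ?_))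
    · simpa using hl.2.1
    · simpa using (mem_adm.1 hl.1).1
    · simpa using hl.2.2
  simp only [total, density, map_sum, map_smul, trunc_eq_scale, scale_word, Finset.sum_mul,
    Finset.mul_sum, smul_mul_assoc, mul_smul_comm, ← word_append, cf_word, smul_eq_mul]
  refine tendsto_finsetSum _ fun k _ => tendsto_finsetSum _ fun l hl =>
    tendsto_finsetSum _ fun k' _ => tendsto_finsetSum _ fun l' hl' => ?_
  have h1 := hc _ hq _ _ hl
  have h2 := hc _ hp _ _ hl'
  have h3 : ContinuousAt (fun ω => if ((l' ++ l : List ℤ) : Multiset ℤ) = s then wt ω (l' ++ l)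
      else 0) ω := by
    split_ifs
    · exact (continuous_wt _).continuousAt
    · exact continuousAt_const
  exact h1.mul (continuousAt_const.mul (h2.mul (continuousAt_const.mul h3)))

theorem lie_total {ω : ℂ} (hω : 1 ≤ ‖ω‖) {p q : ℕ} (hp : Even p) (hq : Even q)
    (hp0 : 0 < p) (hq0 : 0 < q) (hrp : Regular ω p) (hrq : Regular ω q) (N : ℕ) :
    ⁅total ω p N, total ω q N⁆ = 0 := by
  refine ext_cf fun s => ?_
  rw [map_zero]
  refine eq_zero_of_continuousAt (f := fun ω => cf ω s ⁅total ω p N, total ω q N⁆)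
    (fun ω hω => by rw [lie_total_of_one_lt hω hp hq hp0 hq0, map_zero]) hω ?_
  simp only [Ring.lie_def, map_sub]
  exact (continuousAt_cf_total_mul hrp hrq N s).sub (continuousAt_cf_total_mul hrq hrp N s)

theorem lie_hamiltonian_hamiltonian {ω : ℂ} (hω : 1 ≤ ‖ω‖) (l₁ l₂ : ℕ+)
    (h₁ : Regular ω (2 * l₁)) (h₂ : Regular ω (2 * l₂)) :
    ⁅hamiltonian ω l₁, hamiltonian ω l₂⁆ = 0 := by
  have hω0 : ω ≠ 0 := fun h => by rw [h, norm_zero] at hω; linarith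
  refine Subtype.ext (funext fun N => ?_)
  change (hamiltonian ω l₁).1 N * (hamiltonian ω l₂).1 N -
    (hamiltonian ω l₂).1 N * (hamiltonian ω l₁).1 N = 0
  have h := lie_total hω (even_two_mul (l₁ : ℕ)) (even_two_mul (l₂ : ℕ))
    (Nat.mul_pos two_pos l₁.pos) (Nat.mul_pos two_pos l₂.pos) h₁ h₂ N
  rw [Ring.lie_def] at h
  rw [hamiltonian_apply hω0, hamiltonian_apply hω0, smul_mul_smul_comm, smul_mul_smul_comm,
    mul_comm (ω ^ (2 * (l₂ : ℕ)) - 1), ← smul_sub, h, smul_zero]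

end Volterra

theorem theorem2 :
    -- the normal ordering polynomials are well defined
    (∀ l : ℕ+, ∀ α ∈ Volterra.indexSet (2 * l), ∃! p, Volterra.IsNormalPoly α p) ∧
    ∀ ħ : ℝ,
      (∀ l : ℕ+, Volterra.NonResonant (Circle.exp ħ) l →
        -- the flow exists on the quantum algebra, is unique, and has the Heisenberg form
        (∃! D : Volterra.QAlg (Circle.exp ħ) →ₗ[ℂ] Volterra.QAlg (Circle.exp ħ),
          Volterra.IsVolterraFlow (Circle.exp (ħ / 2)) (Circle.exp ħ) (2 * l) D) ∧
        (∀ D : Volterra.QAlg (Circle.exp ħ) →ₗ[ℂ] Volterra.QAlg (Circle.exp ħ),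
          Volterra.IsVolterraFlow (Circle.exp (ħ / 2)) (Circle.exp ħ) (2 * l) D →
          ∀ n : ℤ, Volterra.toFormal (Circle.exp ħ) (D (Volterra.u (Circle.exp ħ) n)) =
            (Complex.I / (2 * (Real.sin (l * ħ) : ℂ))) •
              ⁅Volterra.hamiltonian (Circle.exp ħ) l,
                Volterra.toFormal (Circle.exp ħ) (Volterra.u (Circle.exp ħ) n)⁆) ∧
        -- the Hamiltonian is self-adjoint
        IsSelfAdjoint (Volterra.hamiltonian (Circle.exp ħ) l)) ∧
      -- the Hamiltonians commute with each other
      (∀ l₁ l₂ : ℕ+, Volterra.NonResonant (Circle.exp ħ) l₁ →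
        Volterra.NonResonant (Circle.exp ħ) l₂ →
        ⁅Volterra.hamiltonian (Circle.exp ħ) l₁, Volterra.hamiltonian (Circle.exp ħ) l₂⁆ = 0) := by
  refine ⟨fun l α hα => Volterra.existsUnique_isNormalPoly hα, fun ħ => ⟨fun l hl =>
    ⟨Volterra.existsUnique_flow ħ l hl, fun D hD n => ?_,
      Volterra.isSelfAdjoint_hamiltonian _ l hl⟩, fun l₁ l₂ h₁ h₂ =>
    Volterra.lie_hamiltonian_hamiltonian (Circle.norm_coe _).ge l₁ l₂ h₁ h₂⟩⟩
  rw [hD.2 n, ← Volterra.heisenberg ħ l hl]
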